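/- Let $d\ge 1$, let $p>1$, with $p<\frac{d+2}{d-2}$ if $d\ge 3$, and let $\beta>0$. Let $V:\mathbb R^d\to[0,\infty)$ be measurable with $V(x)\to\infty$ as $|x|\to\infty$. Let $L_z=i(x_2\partial_{x_1}-x_1\partial_{x_2})$ if $d\ge2$ and $L_z=0$ if $d=1$. Let $\Omega\in\mathbb R$ satisfy $\Omega=0$ or $0<|\Omega|<\Omega_{\max}$, where $$\Omega_{\max}=\sup\Big\{\gamma>0:\ \lim_{|x|\to\infty}\Big(V(x)-\tfrac{\gamma^2}{2}(x_1^2+x_2^2)\Big)=\infty\Big\}\le\infty$$ (for $d=1$ the term $x_1^2+x_2^2$ is read as $0$, since there is no rotation). Let $X=\{\phi\in H^1(\mathbb R^d;\mathbb C):\int V|\phi|^2<\infty\}$ and, for $\phi\in X$ and $\omega\in\mathbb R$, put $$S_{\Omega,\omega}(\phi)=\tfrac12\|\nabla\phi\|_{L^2}^2+\int V|\phi|^2+\tfrac{2\beta}{p+1}\|\phi\|_{L^{p+1}}^{p+1}-\Omega\int\overline{\phi}\,L_z\phi+\omega\|\phi\|_{L^2}^2,$$ $$\lambda_0(\Omega)=\inf_{0\ne\phi\in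 X}\frac{\int\big(\frac12|\nabla\phi|^2+V|\phi|^2-\Omega\overline\phi L_z\phi\big)}{\|\phi\|_{L^2}^2},$$ with $\lambda_0(\Omega)=+\infty$ if $X=\{0\}$. An *action ground state* for $\omega$ is a nonzero weak solution $\phi\in X$ (tested against all elements of $X$) of $$-\tfrac12\Delta\phi+V\phi+\beta|\phi|^{p-1}\phi-\Omega L_z\phi+\omega\phi=0$$ whose action $S_{\Omega,\omega}(\phi)$ is minimal among all nonzero weak solutions in $X$. Let $\mathcal A_{\Omega,\omega}$ be the set of action ground states, $\mathcal N_{\Omega,\omega}=\{\|\phi\|_{L^2}^2:\phi\in\mathcal A_{\Omega,\omega}\}$, $m^*(\omega)=\sup\mathcal N_{\Omega,\omega}$, $m_*(\omega)=\inf\mathcal N_{\Omega,\omega}$, and $S^g_\Omega(\omega)=\inf_{\phi\in X}S_{\Omega,\omega}(\phi)$. Then for every $\omega<-\lambda_0(\Omega)$ the infimum defining $S^g_\Omega(\omega)$ is attained, and $\phi\in X$ attains it if and only if $\phi\in\mathcal A_{\Omega,\omega}$; so $S^g_\Omega(\omega)$ is the action of every action ground state. Moreover: 1. $S^g_\Omega$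 is concave on $(-\infty,-\lambda_0(\Omega))$. 2. At every $\omega<-\lambda_0(\Omega)$ both one-sided derivatives of $S^g_\Omega$ exist, and $$(S^g_\Omega)'_-(\omega)=m^*(\omega),\qquad (S^g_\Omega)'_+(\omega)=m_*(\omega).$$ 3. For every $\omega<-\lambda_0(\Omega)$ the set $\mathcal N_{\Omega,\omega}$ is nonempty and both extrema are attained: $m^*(\omega)\in\mathcal N_{\Omega,\omega}$ and $m_*(\omega)\in\mathcal N_{\Omega,\omega}$. -/

import Mathlib

open MeasureTheory Filter Topology Set
open scoped ComplexConjugate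

namespace RNLS

noncomputable section

/-- The domain `ℝ^d` with its Euclidean norm. -/
abbrev Pt (d : ℕ) : Type := EuclideanSpace ℝ (Fin d)

open scoped ContDiff in
/-- `v` is the weak partial derivative `∂_i u` on `ℝ^d`: both functions are locally integrable and
`∫ (∂_i η) u = - ∫ η v` for every real test function `η ∈ C_c^∞(ℝ^d)`. -/
structure IsWeakPartial {d : ℕ} (i : Fin d) (u v : Pt d → ℂ) : Prop where
  locInt_fun : LocallyIntegrable u volume
  locInt_deriv : LocallyIntegrable v volume
  integral_eq : ∀ η : Pt d → ℝ, ContDiff ℝ ∞ η → HasCompactSupport η →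
    ∫ x, (fderiv ℝ η x (EuclideanSpace.single i 1)) • u x = - ∫ x, η x • v x

/-- Weak partial derivatives are unique almost everywhere. -/
theorem IsWeakPartial.ae_eq {d : ℕ} {i : Fin d} {u v w : Pt d → ℂ}
    (hv : IsWeakPartial i u v) (hw : IsWeakPartial i u w) : v =ᵐ[volume] w :=
  ae_eq_of_integral_contDiff_smul_eq hv.locInt_deriv hw.locInt_deriv fun η h1 h2 =>
    neg_injective ((hv.integral_eq η h1 h2).symm.trans (hw.integral_eq η h1 h2))

open Classical in
/-- The weak partial derivative `∂_i u` (a representative of it; it is zero if there is none). -/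
def weakPartial {d : ℕ} (i : Fin d) (u : Pt d → ℂ) : Pt d → ℂ :=
  if h : ∃ v, IsWeakPartial i u v then h.choose else 0

theorem isWeakPartial_weakPartial {d : ℕ} {i : Fin d} {u v : Pt d → ℂ}
    (h : IsWeakPartial i u v) : IsWeakPartial i u (weakPartial i u) := by
  have h' : ∃ v, IsWeakPartial i u v := ⟨v, h⟩
  rw [weakPartial, dif_pos h']
  exact h'.choose_spec

theorem IsWeakPartial.weakPartial_ae_eq {d : ℕ} {i : Fin d} {u v : Pt d → ℂ}
    (h : IsWeakPartial i u v) : weakPartial i u =ᵐ[volume] v :=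
  (isWeakPartial_weakPartial h).ae_eq h

/-- Membership in `X = H¹(ℝ^d) ∩ L²_V(ℝ^d)`: `u ∈ L²`, each weak partial derivative of `u` exists
and is in `L²`, and `∫ V |u|² < ∞`. -/
structure MemX {d : ℕ} (V : Pt d → ℝ) (u : Pt d → ℂ) : Prop where
  memLp : MemLp u 2 volume
  hasWeakPartial : ∀ i, IsWeakPartial i u (weakPartial i u)
  memLp_weakPartial : ∀ i, MemLp (weakPartial i u) 2 volume
  integrable_potential : Integrable (fun x => V x * ‖u x‖ ^ 2) volume

/-- The angular momentum operator: `L_z u = i (x₂ ∂₁ u - x₁ ∂₂ u)` for `d ≥ 2` (coordinates are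
numbered from `0` here), and `L_z = 0` for `d = 1`. -/
def Lz {d : ℕ} (u : Pt d → ℂ) (x : Pt d) : ℂ :=
  if h : 2 ≤ d then
    Complex.I * ((x ⟨1, by omega⟩ : ℂ) * weakPartial ⟨0, by omega⟩ u x
      - (x ⟨0, by omega⟩ : ℂ) * weakPartial ⟨1, by omega⟩ u x)
  else 0

/-- `x₁² + x₂²` for `d ≥ 2`; it is `0` for `d = 1`, where there is no rotation. -/
def planarSq {d : ℕ} (x : Pt d) : ℝ :=
  if h : 2 ≤ d then x ⟨0, by omega⟩ ^ 2 + x ⟨1, by omega⟩ ^ 2 else 0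

/-- The maximal rotation speed
`Ω_max = sup {γ > 0 : V(x) - (γ²/2)(x₁² + x₂²) → ∞ as |x| → ∞}`, possibly `+∞`; it is `-∞` if there
is no such `γ`. -/
def rotMax {d : ℕ} (V : Pt d → ℝ) : EReal :=
  ⨆ γ ∈ {γ : ℝ | 0 < γ ∧
    Tendsto (fun x : Pt d => V x - γ ^ 2 / 2 * planarSq x) (cocompact (Pt d)) atTop}, (γ : EReal)

/-- The mass `‖u‖²_{L²}`. -/
def mass {d : ℕ} (u : Pt d → ℂ) : ℝ := ∫ x, ‖u x‖ ^ 2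

/-- The rotation term `L_Ω(u) = -Ω ∫ ū L_z u`; the integral is real for `u ∈ X`. -/
def rotTerm {d : ℕ} (Ω : ℝ) (u : Pt d → ℂ) : ℝ :=
  - Ω * (∫ x, conj (u x) * Lz u x).re

/-- The quadratic form of `R = -½ Δ + V - Ω L_z`. -/
def quadForm {d : ℕ} (V : Pt d → ℝ) (Ω : ℝ) (u : Pt d → ℂ) : ℝ :=
  1 / 2 * (∫ x, ∑ i, ‖weakPartial i u x‖ ^ 2) + (∫ x, V x * ‖u x‖ ^ 2) + rotTerm Ω u

/-- The energy `E(u) = ½ ‖∇u‖² + ∫ V |u|² + (2β/(p+1)) ‖u‖_{L^{p+1}}^{p+1} + L_Ω(u)`. -/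
def energy {d : ℕ} (V : Pt d → ℝ) (p β Ω : ℝ) (u : Pt d → ℂ) : ℝ :=
  quadForm V Ω u + 2 * β / (p + 1) * ∫ x, ‖u x‖ ^ (p + 1)

/-- The action `S_{Ω,ω}(u) = E(u) + ω ‖u‖²_{L²}`. -/
def action {d : ℕ} (V : Pt d → ℝ) (p β Ω ω : ℝ) (u : Pt d → ℂ) : ℝ :=
  energy V p β Ω u + ω * mass u

/-- The bottom `λ₀(Ω)` of the spectrum of `R`: the infimum of the Rayleigh quotient over the nonzero
elements of `X`. -/
def lambda0 {d : ℕ} (V : Pt d → ℝ) (Ω : ℝ) : EReal :=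
  ⨅ u ∈ {u : Pt d → ℂ | MemX V u ∧ ¬ u =ᵐ[volume] 0}, ((quadForm V Ω u / mass u : ℝ) : EReal)

/-- The frequency interval `(-∞, -λ₀(Ω))`. -/
def freqs {d : ℕ} (V : Pt d → ℝ) (Ω : ℝ) : Set ℝ := {ω : ℝ | (ω : EReal) < - lambda0 V Ω}

/-- `u` is a nontrivial solution in `X` of the stationary equation
`-½ Δu + V u + β |u|^{p-1} u - Ω L_z u + ω u = 0`, in the weak sense (tested with all `v ∈ X`). -/
structure IsSolution {d : ℕ} (V : Pt d → ℝ) (p β Ω ω : ℝ) (u : Pt d → ℂ) : Prop where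
  memX : MemX V u
  ne_zero : ¬ u =ᵐ[volume] 0
  weak_eq : ∀ v : Pt d → ℂ, MemX V v →
    1 / 2 * (∫ x, ∑ i, weakPartial i u x * conj (weakPartial i v x))
      + (∫ x, (V x : ℂ) * u x * conj (v x))
      + (β : ℂ) * (∫ x, ((‖u x‖ ^ (p - 1) : ℝ) : ℂ) * u x * conj (v x))
      - (Ω : ℂ) * (∫ x, Lz u x * conj (v x))
      + (ω : ℂ) * (∫ x, u x * conj (v x)) = 0

/-- The set `𝒜_{Ω,ω}` of action ground states: the nontrivial solutions of the stationary equation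
that have the least action among all nontrivial solutions. -/
def groundStates {d : ℕ} (V : Pt d → ℝ) (p β Ω ω : ℝ) : Set (Pt d → ℂ) :=
  {u | IsSolution V p β Ω ω u ∧
    ∀ v, IsSolution V p β Ω ω v → action V p β Ω ω u ≤ action V p β Ω ω v}

/-- The set `𝒩_{Ω,ω}` of the masses of the action ground states. -/
def groundMasses {d : ℕ} (V : Pt d → ℝ) (p β Ω ω : ℝ) : Set ℝ :=
  mass '' groundStates V p β Ω ω

/-- `m^*(ω) = sup 𝒩_{Ω,ω}`. -/
def mSup {d : ℕ} (V : Pt d → ℝ) (p β Ω ω : ℝ) : ℝ := sSup (groundMasses V p β Ω ω)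

/-- `m_*(ω) = inf 𝒩_{Ω,ω}`. -/
def mInf {d : ℕ} (V : Pt d → ℝ) (p β Ω ω : ℝ) : ℝ := sInf (groundMasses V p β Ω ω)

/-- The ground-state action `S^g_Ω(ω) = inf_{u ∈ X} S_{Ω,ω}(u)`. -/
def groundAction {d : ℕ} (V : Pt d → ℝ) (p β Ω ω : ℝ) : ℝ :=
  sInf (action V p β Ω ω '' {u | MemX V u})

end

end RNLS

/-!
The proof is the direct method in the calculus of variations, followed by a compactness argument in
the frequency.

*Minimizers exist.* As `Ω = 0` or `|Ω| < Ω_max`, the rotation term is pointwise dominated, with a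
factor `θ < 1`, by the kinetic and potential energy densities plus a multiple of the mass density
(`exists_subordinate`). A multiple of the mass is in turn absorbed by the confining potential at
infinity and by the nonlinearity where `|u|` is large, so the action is coercive on `X` for every
real `ω` (`Admissible.exists_coercive`). Bounded sequences in `X` are relatively compact in `L²`
(`exists_subseq_tendsto_eLpNorm`). The quadratic part of the action plus a multiple of the mass is
a nonnegative form that controls the gradient, and the nonlinearity is convex. Hence the
parallelogram identity bounds the gradient of the difference of two near-minimizers by their excess
actions and their `L²` distance (`Admissible.gradient_sub_le`). Therefore an `L²`-convergent
minimizing sequence has `L²`-convergent gradients, Fatou's lemma applies to an almost everywhere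
convergent subsequence, and the limit is a minimizer whose mass is the limit of the masses
(`Admissible.exists_subseq_minimizer`). No weak topology on `X` is needed.

*Minimizers are the action ground states.* A minimizer solves the Euler-Lagrange equation, which is
the stationary equation because `L_z` is symmetric (`Subordinate.integral_Lz_symm`,
`Admissible.weakForm_eq_zero`). For `ω < -λ₀(Ω)` the minimum is negative, so that minimizers are
nonzero (`Admissible.groundAction_neg`). As a solution has at least the minimal action over `X`,
and some minimizer is a solution, the solutions of least action are exactly the minimizers
(`Admissible.mem_groundStates_iff`).

*Dependence on `ω`.* For fixed `u` the action is affine in `ω` with slope `‖u‖²`. The infimum is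
therefore concave, the mass of a minimizer is a supergradient (`Admissible.groundAction_le_add`),
and masses of minimizers decrease in `ω`. Minimizers at frequencies `ω_n → ω` form a minimizing
sequence at `ω`, so their masses accumulate only at masses of minimizers at `ω`
(`Admissible.exists_subseq_mass`). With a constant sequence this makes the set of masses compact,
and with `ω_n ↓ ω` or `ω_n ↑ ω` it identifies the limits of the difference quotients as the
smallest and the largest mass.

The statement uses only `H¹` functions on `ℝ^d` given by weak partial derivatives, so the Sobolev
and Rellich theorems are derived here for them by mollification.
-/

namespace RNLS

open scoped ENNReal

variable {d : ℕ}

section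

open scoped ContDiff Convolution

/-! ### Algebra of weak partial derivatives -/

theorem IsWeakPartial.integrable_smul_fun {i : Fin d} {u v : Pt d → ℂ} (h : IsWeakPartial i u v)
    {η : Pt d → ℝ} (hη : ContDiff ℝ ∞ η) (hc : HasCompactSupport η) :
    Integrable (fun x => (fderiv ℝ η x (EuclideanSpace.single i 1)) • u x) volume :=
  h.locInt_fun.integrable_smul_left_of_hasCompactSupport
    ((hη.continuous_fderiv (by simp)).clm_apply continuous_const) (hc.fderiv_apply (𝕜 := ℝ) _)

theorem IsWeakPartial.integrable_smul_deriv {i : Fin d} {u v : Pt d → ℂ} (h : IsWeakPartial i u v)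
    {η : Pt d → ℝ} (hη : ContDiff ℝ ∞ η) (hc : HasCompactSupport η) :
    Integrable (fun x => η x • v x) volume :=
  h.locInt_deriv.integrable_smul_left_of_hasCompactSupport hη.continuous hc

theorem IsWeakPartial.add {i : Fin d} {u v u' v' : Pt d → ℂ} (h : IsWeakPartial i u v)
    (h' : IsWeakPartial i u' v') : IsWeakPartial i (u + u') (v + v') where
  locInt_fun := h.locInt_fun.add h'.locInt_fun
  locInt_deriv := h.locInt_deriv.add h'.locInt_deriv
  integral_eq η h1 h2 := by
    simp only [Pi.add_apply, smul_add]
    rw [integral_add (h.integrable_smul_fun h1 h2) (h'.integrable_smul_fun h1 h2),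
      integral_add (h.integrable_smul_deriv h1 h2) (h'.integrable_smul_deriv h1 h2),
      h.integral_eq η h1 h2, h'.integral_eq η h1 h2, neg_add]

theorem IsWeakPartial.const_smul {i : Fin d} {u v : Pt d → ℂ} (h : IsWeakPartial i u v) (c : ℂ) :
    IsWeakPartial i (c • u) (c • v) where
  locInt_fun := h.locInt_fun.smul c
  locInt_deriv := h.locInt_deriv.smul c
  integral_eq η h1 h2 := by
    simp only [Pi.smul_apply, smul_comm _ c]
    rw [integral_smul, integral_smul, h.integral_eq η h1 h2, smul_neg]

theorem IsWeakPartial.congr {i : Fin d} {u v u' v' : Pt d → ℂ} (h : IsWeakPartial i u v)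
    (hu : u =ᵐ[volume] u') (hv : v =ᵐ[volume] v') : IsWeakPartial i u' v' where
  locInt_fun := h.locInt_fun.congr hu
  locInt_deriv := h.locInt_deriv.congr hv
  integral_eq η h1 h2 := by
    have a : (fun x => (fderiv ℝ η x (EuclideanSpace.single i 1)) • u x) =ᵐ[volume]
        fun x => (fderiv ℝ η x (EuclideanSpace.single i 1)) • u' x :=
      hu.mono fun x hx => by simp only [hx]
    have b : (fun x => η x • v x) =ᵐ[volume] fun x => η x • v' x :=
      hv.mono fun x hx => by simp only [hx]
    rw [← integral_congr_ae a, ← integral_congr_ae b]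
    exact h.integral_eq η h1 h2

/-- Pairing with a fixed square-integrable function is continuous in `L²`. -/
theorem tendsto_integral_mul_of_tendsto_eLpNorm {α : Type*} [MeasurableSpace α] {μ : Measure α}
    {g f : α → ℂ} {F : ℕ → α → ℂ} (hg : MemLp g 2 μ) (hf : MemLp f 2 μ)
    (hF : ∀ n, MemLp (F n) 2 μ)
    (h : Tendsto (fun n => eLpNorm (F n - f) 2 μ) atTop (𝓝 0)) :
    Tendsto (fun n => ∫ x, g x * F n x ∂μ) atTop (𝓝 (∫ x, g x * f x ∂μ)) := by
  have key : ∀ k : α → ℂ, ∀ hk : MemLp k 2 μ,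
      ∫ x, g x * k x ∂μ = inner ℂ (hg.star.toLp _) (hk.toLp k) := by
    intro k hk
    rw [L2.inner_def]
    refine integral_congr_ae ?_
    filter_upwards [hg.star.coeFn_toLp, hk.coeFn_toLp] with x h1 h2
    rw [h1, h2]
    simp [mul_comm]
  rw [key f hf]
  simp_rw [fun n => key (F n) (hF n)]
  have hT : Tendsto (fun n => (hF n).toLp (F n)) atTop (𝓝 (hf.toLp f)) :=
    (Lp.tendsto_Lp_iff_tendsto_eLpNorm'' F hF f hf).2 h
  exact tendsto_const_nhds.inner hT

theorem memLp_two_ofReal {η : Pt d → ℝ} (hη : Continuous η) (hc : HasCompactSupport η) :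
    MemLp (fun x => (η x : ℂ)) 2 volume := by
  refine Continuous.memLp_of_hasCompactSupport (by fun_prop) ?_
  exact hc.comp_left (g := fun t : ℝ => (t : ℂ)) (by simp)

/-- The graph of the weak partial derivative is closed in `L² × L²`. -/
theorem IsWeakPartial.of_tendsto {i : Fin d} {u v : Pt d → ℂ} {U W : ℕ → Pt d → ℂ}
    (h : ∀ n, IsWeakPartial i (U n) (W n)) (hU : ∀ n, MemLp (U n) 2 volume)
    (hW : ∀ n, MemLp (W n) 2 volume) (hu : MemLp u 2 volume) (hv : MemLp v 2 volume)
    (hUu : Tendsto (fun n => eLpNorm (U n - u) 2 volume) atTop (𝓝 0))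
    (hWv : Tendsto (fun n => eLpNorm (W n - v) 2 volume) atTop (𝓝 0)) :
    IsWeakPartial i u v where
  locInt_fun := hu.locallyIntegrable (by norm_num)
  locInt_deriv := hv.locallyIntegrable (by norm_num)
  integral_eq η h1 h2 := by
    have a := tendsto_integral_mul_of_tendsto_eLpNorm
      (memLp_two_ofReal ((h1.continuous_fderiv (by simp)).clm_apply
        (continuous_const (y := EuclideanSpace.single i 1))) (h2.fderiv_apply (𝕜 := ℝ) _)) hu hU hUu
    have b := (tendsto_integral_mul_of_tendsto_eLpNorm
      (memLp_two_ofReal h1.continuous h2) hv hW hWv).neg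
    refine tendsto_nhds_unique a (b.congr fun n => ?_)
    have := (h n).integral_eq η h1 h2
    simp only [Complex.real_smul] at this
    exact this.symm

/-! ### The space `X` -/

theorem MemX.weakPartial_add {V : Pt d → ℝ} {u v : Pt d → ℂ} (hu : MemX V u) (hv : MemX V v)
    (i : Fin d) : weakPartial i (u + v) =ᵐ[volume] weakPartial i u + weakPartial i v :=
  ((hu.hasWeakPartial i).add (hv.hasWeakPartial i)).weakPartial_ae_eq

theorem MemX.weakPartial_smul {V : Pt d → ℝ} {u : Pt d → ℂ} (hu : MemX V u) (c : ℂ)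
    (i : Fin d) : weakPartial i (c • u) =ᵐ[volume] c • weakPartial i u :=
  ((hu.hasWeakPartial i).const_smul c).weakPartial_ae_eq

/-- A criterion for membership in `X` in terms of arbitrary square-integrable weak derivatives. -/
theorem MemX.of_isWeakPartial {V : Pt d → ℝ} {u : Pt d → ℂ} {v : Fin d → Pt d → ℂ}
    (hu : MemLp u 2 volume) (h : ∀ i, IsWeakPartial i u (v i)) (hv : ∀ i, MemLp (v i) 2 volume)
    (hV : Integrable (fun x => V x * ‖u x‖ ^ 2) volume) : MemX V u where
  memLp := hu
  hasWeakPartial i := isWeakPartial_weakPartial (h i)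
  memLp_weakPartial i := (hv i).ae_eq (h i).weakPartial_ae_eq.symm
  integrable_potential := hV

theorem MemX.add {V : Pt d → ℝ} (hVm : AEMeasurable V volume) (hV0 : ∀ x, 0 ≤ V x)
    {u v : Pt d → ℂ} (hu : MemX V u) (hv : MemX V v) : MemX V (u + v) := by
  refine MemX.of_isWeakPartial (hu.memLp.add hv.memLp)
    (fun i => (hu.hasWeakPartial i).add (hv.hasWeakPartial i))
    (fun i => (hu.memLp_weakPartial i).add (hv.memLp_weakPartial i)) ?_
  refine ((hu.integrable_potential.add hv.integrable_potential).const_mul 2).mono'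
    (hVm.aestronglyMeasurable.mul
      ((hu.memLp.add hv.memLp).aestronglyMeasurable.norm.pow 2)) (ae_of_all _ fun x => ?_)
  have h0 := hV0 x
  rw [Real.norm_of_nonneg (by positivity)]
  simp only [Pi.add_apply]
  have h1 : ‖u x + v x‖ ^ 2 ≤ 2 * (‖u x‖ ^ 2 + ‖v x‖ ^ 2) := by
    nlinarith [norm_add_le (u x) (v x), norm_nonneg (u x + v x), sq_nonneg (‖u x‖ - ‖v x‖)]
  nlinarith [mul_le_mul_of_nonneg_left h1 h0]

theorem MemX.smul {V : Pt d → ℝ} {u : Pt d → ℂ} (hu : MemX V u) (c : ℂ) : MemX V (c • u) := by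
  refine MemX.of_isWeakPartial (hu.memLp.const_smul c)
    (fun i => (hu.hasWeakPartial i).const_smul c)
    (fun i => (hu.memLp_weakPartial i).const_smul c) ?_
  refine (hu.integrable_potential.const_mul (‖c‖ ^ 2)).congr (ae_of_all _ fun x => ?_)
  simp only [Pi.smul_apply, norm_smul]
  ring

/-! ### Mollification -/

/-- Jensen's inequality: the squared `L²` norm of an average is at most the average of the squared
`L²` norms. -/
theorem lintegral_sq_enorm_integral_le {X Y : Type*} [MeasurableSpace X] [MeasurableSpace Y]
    {μ : Measure X} {ν : Measure Y} [SFinite μ] [IsProbabilityMeasure ν] {F : X × Y → ℂ}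
    (hF : AEStronglyMeasurable F (μ.prod ν)) :
    ∫⁻ x, ‖∫ y, F (x, y) ∂ν‖ₑ ^ 2 ∂μ ≤ ∫⁻ y, ∫⁻ x, ‖F (x, y)‖ₑ ^ 2 ∂μ ∂ν := by
  rw [← lintegral_lintegral_swap (f := fun x y => ‖F (x, y)‖ₑ ^ 2) (hF.enorm.pow_const 2)]
  refine lintegral_mono_ae ?_
  filter_upwards [hF.prodMk_left] with x hx
  have h1 : eLpNorm' (fun y => F (x, y)) 1 ν ≤ eLpNorm' (fun y => F (x, y)) 2 ν :=
    eLpNorm'_le_eLpNorm'_of_exponent_le one_pos one_le_two ν hx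
  simp only [eLpNorm', ENNReal.rpow_one, div_one] at h1
  calc ‖∫ y, F (x, y) ∂ν‖ₑ ^ 2 ≤ (∫⁻ y, ‖F (x, y)‖ₑ ∂ν) ^ 2 := by
        gcongr; exact enorm_integral_le_lintegral_enorm _
    _ ≤ ((∫⁻ y, ‖F (x, y)‖ₑ ^ (2:ℝ) ∂ν) ^ (1 / 2 : ℝ)) ^ 2 := by gcongr
    _ = ∫⁻ y, ‖F (x, y)‖ₑ ^ 2 ∂ν := by
        rw [← ENNReal.rpow_natCast, ← ENNReal.rpow_mul]
        simp

/-- A function of `x` averaged in `y` against a normalized bump function is bounded in `L²` by the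
worst `y` in the support of the bump. -/
theorem lintegral_sq_enorm_integral_bump_le (φ : ContDiffBump (0 : Pt d)) {F : Pt d × Pt d → ℂ}
    (hF : AEStronglyMeasurable F (volume.prod volume)) {δ : ℝ≥0∞}
    (h : ∀ y ∈ Metric.ball (0 : Pt d) φ.rOut, ∫⁻ x, ‖F (x, y)‖ₑ ^ 2 ≤ δ) :
    ∫⁻ x, ‖∫ y, φ.normed volume y • F (x, y)‖ₑ ^ 2 ≤ δ := by
  set ν : Measure (Pt d) := volume.withDensity fun y => ENNReal.ofReal (φ.normed volume y) with hν
  have hm : Measurable fun y => ENNReal.ofReal (φ.normed (volume : Measure (Pt d)) y) :=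
    φ.continuous_normed.measurable.ennreal_ofReal
  have hp : IsProbabilityMeasure ν := by
    constructor
    rw [hν, withDensity_apply _ MeasurableSet.univ, Measure.restrict_univ,
      ← ofReal_integral_eq_lintegral_ofReal φ.integrable_normed
        (ae_of_all _ fun x => φ.nonneg_normed x), φ.integral_normed, ENNReal.ofReal_one]
  have hac : (volume : Measure (Pt d)).prod ν ≪ volume.prod volume :=
    Measure.AbsolutelyContinuous.rfl.prod (withDensity_absolutelyContinuous _ _)
  have key := lintegral_sq_enorm_integral_le (hF.mono_ac hac)
  have e : ∀ x, ∫ y, F (x, y) ∂ν = ∫ y, φ.normed volume y • F (x, y) := by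
    intro x
    rw [hν, integral_withDensity_eq_integral_toReal_smul hm (ae_of_all _ fun _ => by simp)]
    simp [ENNReal.toReal_ofReal (φ.nonneg_normed _)]
  simp_rw [e] at key
  refine key.trans ?_
  have : ∀ᵐ y ∂ν, ∫⁻ x, ‖F (x, y)‖ₑ ^ 2 ≤ δ := by
    rw [hν, ae_withDensity_iff hm]
    refine ae_of_all _ fun y hy => h y ?_
    rw [← φ.support_normed_eq (μ := volume)]
    intro h0
    exact hy (by simp [h0])
  calc ∫⁻ y, (∫⁻ x, ‖F (x, y)‖ₑ ^ 2) ∂ν ≤ ∫⁻ y, δ ∂ν := lintegral_mono_ae this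
    _ = δ := by simp

/-- Mollification `φ * f` by the normalized bump function `φ`. -/
noncomputable def mollify (φ : ContDiffBump (0 : Pt d)) (f : Pt d → ℂ) : Pt d → ℂ :=
  φ.normed volume ⋆[ContinuousLinearMap.lsmul ℝ ℝ, volume] f

theorem mollify_eq_integral (φ : ContDiffBump (0 : Pt d)) (f : Pt d → ℂ) (x : Pt d) :
    mollify φ f x = ∫ y, φ.normed volume y • f (x - y) := rfl

theorem mollify_eq_integral_swap (φ : ContDiffBump (0 : Pt d)) (f : Pt d → ℂ) (x : Pt d) :
    mollify φ f x = ∫ y, φ.normed volume (x - y) • f y := convolution_lsmul_swap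

theorem integrable_mollify (φ : ContDiffBump (0 : Pt d)) {f : Pt d → ℂ}
    (hf : LocallyIntegrable f volume) (x : Pt d) :
    Integrable (fun y => φ.normed volume y • f (x - y)) volume :=
  (φ.hasCompactSupport_normed.convolutionExists_left (ContinuousLinearMap.lsmul ℝ ℝ)
    φ.continuous_normed hf x)

theorem contDiff_mollify (φ : ContDiffBump (0 : Pt d)) {f : Pt d → ℂ}
    (hf : LocallyIntegrable f volume) : ContDiff ℝ ∞ (mollify φ f) :=
  φ.hasCompactSupport_normed.contDiff_convolution_left _ φ.contDiff_normed hf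

theorem aestronglyMeasurable_sub {f : Pt d → ℂ} (hf : AEStronglyMeasurable f volume) :
    AEStronglyMeasurable (fun p : Pt d × Pt d => f (p.1 - p.2)) (volume.prod volume) :=
  hf.comp_quasiMeasurePreserving (quasiMeasurePreserving_sub volume volume)

theorem lintegral_mollify_le (φ : ContDiffBump (0 : Pt d)) {f : Pt d → ℂ}
    (hf : AEStronglyMeasurable f volume) :
    ∫⁻ x, ‖mollify φ f x‖ₑ ^ 2 ≤ ∫⁻ x, ‖f x‖ₑ ^ 2 :=
  lintegral_sq_enorm_integral_bump_le φ (F := fun p => f (p.1 - p.2)) (aestronglyMeasurable_sub hf)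
    fun y _ => (lintegral_sub_right_eq_self (fun x => ‖f x‖ₑ ^ 2) y).le

/-- The mollification error is bounded by the modulus of continuity of translations. -/
theorem lintegral_mollify_sub_le (φ : ContDiffBump (0 : Pt d)) {f : Pt d → ℂ}
    (hf : LocallyIntegrable f volume) {δ : ℝ≥0∞}
    (h : ∀ y ∈ Metric.ball (0 : Pt d) φ.rOut, ∫⁻ x, ‖f (x - y) - f x‖ₑ ^ 2 ≤ δ) :
    ∫⁻ x, ‖mollify φ f x - f x‖ₑ ^ 2 ≤ δ := by
  have e : ∀ x, mollify φ f x - f x = ∫ y, φ.normed volume y • (f (x - y) - f x) := by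
    intro x
    simp only [smul_sub]
    rw [integral_sub (integrable_mollify φ hf x) (φ.integrable_normed.smul_const _),
      integral_smul_const, φ.integral_normed, one_smul, mollify_eq_integral]
  simp_rw [e]
  exact lintegral_sq_enorm_integral_bump_le φ (F := fun p => f (p.1 - p.2) - f p.1)
    ((aestronglyMeasurable_sub hf.aestronglyMeasurable).sub hf.aestronglyMeasurable.comp_fst) h

/-- Mollification commutes with weak differentiation. -/
theorem fderiv_mollify (φ : ContDiffBump (0 : Pt d)) {i : Fin d} {u v : Pt d → ℂ}
    (h : IsWeakPartial i u v) (x : Pt d) :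
    fderiv ℝ (mollify φ u) x (EuclideanSpace.single i 1) = mollify φ v x := by
  have e : mollify φ u = u ⋆[(ContinuousLinearMap.lsmul ℝ ℝ).flip, volume] φ.normed volume :=
    (convolution_flip _).symm
  have h1 := φ.hasCompactSupport_normed (μ := volume).hasFDerivAt_convolution_right
    (ContinuousLinearMap.lsmul ℝ ℝ : ℝ →L[ℝ] ℂ →L[ℝ] ℂ).flip h.locInt_fun
    (φ.contDiff_normed (n := 1)) x
  rw [e, h1.fderiv, convolution_precompR_apply _ h.locInt_fun
    (φ.hasCompactSupport_normed.fderiv ℝ)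
    (φ.contDiff_normed (n := 1) |>.continuous_fderiv (by simp)), mollify_eq_integral_swap,
    convolution_def]
  have hη : ContDiff ℝ ∞ fun y => φ.normed (volume : Measure (Pt d)) (x - y) :=
    φ.contDiff_normed.comp (by fun_prop)
  have hc : HasCompactSupport fun y => φ.normed (volume : Measure (Pt d)) (x - y) :=
    φ.hasCompactSupport_normed.comp_homeomorph (Homeomorph.subLeft x)
  have h2 := h.integral_eq _ hη hc
  have h3 : ∀ y, fderiv ℝ (fun y => φ.normed (volume : Measure (Pt d)) (x - y)) y
      = - fderiv ℝ (φ.normed volume) (x - y) := fun y => by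
    have hd := ((φ.contDiff_normed (μ := volume) (n := 1)).differentiable (by simp)
      (x - y)).hasFDerivAt.comp y ((hasFDerivAt_id y).const_sub x)
    refine hd.fderiv.trans ?_
    ext
    simp
  simp only [h3, _root_.neg_apply, neg_smul, integral_neg, neg_inj] at h2
  simpa using h2

/-! ### Translations of functions with a square-integrable gradient -/

theorem clm_apply_eq_sum (L : Pt d →L[ℝ] ℂ) (y : Pt d) :
    L y = ∑ i, (y i : ℝ) • L (EuclideanSpace.single i 1) := by
  conv_lhs => rw [← (EuclideanSpace.basisFun (Fin d) ℝ).sum_repr y]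
  simp

theorem enorm_sq_clm_apply_le (L : Pt d →L[ℝ] ℂ) (y : Pt d) :
    ‖L y‖ₑ ^ 2 ≤ ‖y‖ₑ ^ 2 * ∑ i, ‖L (EuclideanSpace.single i 1)‖ₑ ^ 2 := by
  have h : ‖L y‖ ^ 2 ≤ ‖y‖ ^ 2 * ∑ i, ‖L (EuclideanSpace.single i 1)‖ ^ 2 := by
    rw [clm_apply_eq_sum, EuclideanSpace.norm_sq_eq]
    calc ‖∑ i, (y i : ℝ) • L (EuclideanSpace.single i 1)‖ ^ 2
        ≤ (∑ i, ‖y i‖ * ‖L (EuclideanSpace.single i 1)‖) ^ 2 := by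
          gcongr
          refine (norm_sum_le _ _).trans (Finset.sum_le_sum fun i _ => ?_)
          rw [norm_smul]
      _ ≤ _ := Finset.sum_mul_sq_le_sq_mul_sq _ _ _
  have h' := ENNReal.ofReal_le_ofReal h
  rw [ENNReal.ofReal_mul (by positivity), ENNReal.ofReal_sum_of_nonneg (fun i _ => by positivity)]
    at h'
  simpa [ENNReal.ofReal_pow, ofReal_norm] using h'

/-- The `L²` modulus of continuity of a smooth function is controlled by the gradient: integrate
along the segment from `x` to `x - y`. -/
theorem lintegral_translate_sub_le_of_contDiff {g : Pt d → ℂ} (hg : ContDiff ℝ ∞ g) (y : Pt d) :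
    ∫⁻ x, ‖g (x - y) - g x‖ₑ ^ 2
      ≤ ‖y‖ₑ ^ 2 * ∑ i, ∫⁻ x, ‖fderiv ℝ g x (EuclideanSpace.single i 1)‖ₑ ^ 2 := by
  have hcf : Continuous (fderiv ℝ g) := hg.continuous_fderiv (by simp)
  have e : ∀ x, g (x - y) - g x
      = ∫ t in Ioc (0:ℝ) 1, fderiv ℝ g (x - t • y) (-y) := by
    intro x
    have hd : ∀ t ∈ uIcc (0:ℝ) 1, HasDerivAt (fun t : ℝ => g (x - t • y))
        (fderiv ℝ g (x - t • y) (-y)) t := by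
      intro t _
      have h1 : HasDerivAt (fun t : ℝ => x - t • y) (-y) t := by
        simpa using ((hasDerivAt_id t).smul_const y).const_sub x
      exact ((hg.differentiable (by simp)) _).hasFDerivAt.comp_hasDerivAt t h1
    have := intervalIntegral.integral_eq_sub_of_hasDerivAt hd
      (Continuous.intervalIntegrable (by fun_prop) _ _)
    rw [intervalIntegral.integral_of_le zero_le_one] at this
    rw [this]
    simp
  have hp : IsProbabilityMeasure ((volume : Measure ℝ).restrict (Ioc 0 1)) := ⟨by simp⟩
  simp_rw [e]
  refine (lintegral_sq_enorm_integral_le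
    (F := fun p : Pt d × ℝ => fderiv ℝ g (p.1 - p.2 • y) (-y))
    (Continuous.aestronglyMeasurable (by fun_prop))).trans ?_
  calc _ ≤ ∫⁻ t in Ioc (0:ℝ) 1,
        ‖y‖ₑ ^ 2 * ∑ i, ∫⁻ x, ‖fderiv ℝ g x (EuclideanSpace.single i 1)‖ₑ ^ 2 := by
        refine lintegral_mono fun t => ?_
        have hmm : ∀ i : Fin d, Measurable
            fun x => ‖fderiv ℝ g x (EuclideanSpace.single i 1)‖ₑ ^ 2 := fun i =>
          (Continuous.measurable (by fun_prop))
        rw [← lintegral_finsetSum _ fun i _ => hmm i, ← lintegral_const_mul _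
          (Finset.measurable_sum _ fun i _ => hmm i)]
        rw [← lintegral_sub_right_eq_self (fun x => ‖y‖ₑ ^ 2 *
          ∑ i, ‖fderiv ℝ g x (EuclideanSpace.single i 1)‖ₑ ^ 2) (t • y)]
        refine lintegral_mono fun x => ?_
        simpa using enorm_sq_clm_apply_le (fderiv ℝ g (x - t • y)) (-y)
    _ = _ := by simp

/-- A sequence of bump functions shrinking to the origin. -/
noncomputable def bumpSeq (d n : ℕ) : ContDiffBump (0 : Pt d) where
  rIn := 1 / (n + 1)
  rOut := 2 * (1 / (n + 1))
  rIn_pos := by positivity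
  rIn_lt_rOut := by
    have : (0:ℝ) < 1 / (n + 1) := by positivity
    linarith

theorem tendsto_bumpSeq_rOut : Tendsto (fun n => (bumpSeq d n).rOut) atTop (𝓝 0) := by
  have := (tendsto_one_div_add_atTop_nhds_zero_nat (𝕜 := ℝ)).const_mul 2
  simpa [bumpSeq] using this

theorem ae_tendsto_mollify {f : Pt d → ℂ} (hf : LocallyIntegrable f volume) :
    ∀ᵐ x, Tendsto (fun n => mollify (bumpSeq d n) f x) atTop (𝓝 (f x)) :=
  ContDiffBump.ae_convolution_tendsto_right_of_locallyIntegrable tendsto_bumpSeq_rOut (K := 2)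
    (Eventually.of_forall fun _ => le_of_eq rfl) hf

/-- Fatou's lemma for a uniformly bounded sequence of integrals. -/
theorem lintegral_le_of_ae_tendsto {α : Type*} [MeasurableSpace α] {μ : Measure α}
    {F : ℕ → α → ℝ≥0∞} {f : α → ℝ≥0∞} {C : ℝ≥0∞}
    (hF : ∀ n, AEMeasurable (F n) μ) (h : ∀ᵐ x ∂μ, Tendsto (fun n => F n x) atTop (𝓝 (f x)))
    (hC : ∀ n, ∫⁻ x, F n x ∂μ ≤ C) : ∫⁻ x, f x ∂μ ≤ C :=
  calc ∫⁻ x, f x ∂μ = ∫⁻ x, liminf (fun n => F n x) atTop ∂μ :=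
        lintegral_congr_ae (h.mono fun _ hx => hx.liminf_eq.symm)
    _ ≤ liminf (fun n => ∫⁻ x, F n x ∂μ) atTop := lintegral_liminf_le' hF
    _ ≤ liminf (fun _ => C) atTop := liminf_le_liminf (Eventually.of_forall hC)
    _ = C := liminf_const C

/-- The translation estimate for weak gradients, by passing to the limit in the estimate for
mollifications. -/
theorem lintegral_translate_sub_le {u : Pt d → ℂ} {v : Fin d → Pt d → ℂ}
    (hu : LocallyIntegrable u volume) (h : ∀ i, IsWeakPartial i u (v i)) (y : Pt d) :
    ∫⁻ x, ‖u (x - y) - u x‖ₑ ^ 2 ≤ ‖y‖ₑ ^ 2 * ∑ i, ∫⁻ x, ‖v i x‖ₑ ^ 2 := by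
  have hs := fun n => contDiff_mollify (bumpSeq d n) hu
  refine lintegral_le_of_ae_tendsto
    (F := fun n x => ‖mollify (bumpSeq d n) u (x - y) - mollify (bumpSeq d n) u x‖ₑ ^ 2)
    (fun n => ?_) ?_ fun n => ?_
  · have := (hs n).continuous
    exact (Continuous.measurable (by fun_prop)).aemeasurable
  · have a := ae_tendsto_mollify hu
    have b := (measurePreserving_sub_right volume y).quasiMeasurePreserving.ae a
    filter_upwards [a, b] with x ha hb
    exact ((ENNReal.continuous_pow 2).tendsto _).comp (hb.sub ha).enorm
  · refine (lintegral_translate_sub_le_of_contDiff (hs n) y).trans ?_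
    refine mul_le_mul_right (Finset.sum_le_sum fun i _ => ?_) _
    simp_rw [fderiv_mollify _ (h i)]
    exact lintegral_mollify_le _ (h i).locInt_deriv.aestronglyMeasurable

/-- Mollification at scale `r` moves a function by at most `r ‖∇u‖` in `L²`; this uniformity on
gradient-bounded sets drives the compactness proof. -/
theorem lintegral_mollify_sub_le_gradient (φ : ContDiffBump (0 : Pt d)) {u : Pt d → ℂ}
    {v : Fin d → Pt d → ℂ} (hu : LocallyIntegrable u volume) (h : ∀ i, IsWeakPartial i u (v i)) :
    ∫⁻ x, ‖mollify φ u x - u x‖ₑ ^ 2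
      ≤ ENNReal.ofReal (φ.rOut) ^ 2 * ∑ i, ∫⁻ x, ‖v i x‖ₑ ^ 2 := by
  refine lintegral_mollify_sub_le φ hu fun y hy => (lintegral_translate_sub_le hu h y).trans ?_
  gcongr
  rw [← ofReal_norm]
  exact ENNReal.ofReal_le_ofReal (by simpa using (Metric.mem_ball.1 hy).le)

theorem eLpNorm_two_sq {α : Type*} [MeasurableSpace α] {μ : Measure α} (f : α → ℂ) :
    eLpNorm f 2 μ ^ 2 = ∫⁻ x, ‖f x‖ₑ ^ 2 ∂μ := by
  have := eLpNorm_nnreal_pow_eq_lintegral (f := f) (μ := μ) (p := 2) (by norm_num)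
  simpa using this

theorem eLpNorm_two_le_of_lintegral {α : Type*} [MeasurableSpace α] {μ : Measure α} {f : α → ℂ}
    {C : ℝ≥0∞} (h : ∫⁻ x, ‖f x‖ₑ ^ 2 ∂μ ≤ C ^ 2) : eLpNorm f 2 μ ≤ C := by
  rw [← eLpNorm_two_sq] at h
  exact (ENNReal.pow_right_strictMono two_ne_zero).le_iff_le.1 h

/-- Mollifications converge in `L²`. -/
theorem tendsto_eLpNorm_mollify_sub {f : Pt d → ℂ} (hf : MemLp f 2 volume) :
    Tendsto (fun n => eLpNorm (mollify (bumpSeq d n) f - f) 2 volume) atTop (𝓝 0) := by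
  let τ : C(Pt d, C(Pt d, Pt d)) := ContinuousMap.curry ⟨fun p => p.2 - p.1, by fun_prop⟩
  have hτ : ∀ y, MeasurePreserving (τ y) (volume : Measure (Pt d)) volume :=
    fun y => measurePreserving_sub_right volume y
  have hc := (continuous_const (y := hf.toLp f)).compMeasurePreservingLp τ.continuous hτ
    (by norm_num : (2:ℝ≥0∞) ≠ ⊤)
  have h0 : Lp.compMeasurePreserving (τ 0) (hτ 0) (hf.toLp f) = hf.toLp f := by
    refine Lp.ext ?_
    filter_upwards [Lp.coeFn_compMeasurePreserving (hf.toLp f) (hτ 0)] with x hx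
    rw [hx]
    simp [τ]
  rw [ENNReal.tendsto_atTop_zero]
  intro ε hε
  have h1 := (hc.tendsto 0)
  rw [h0, EMetric.tendsto_nhds] at h1
  obtain ⟨r, hr, hball⟩ := Metric.eventually_nhds_iff.1 (h1 ε hε)
  obtain ⟨N, hN⟩ := eventually_atTop.1
    ((tendsto_bumpSeq_rOut (d := d)).eventually (gt_mem_nhds hr))
  refine ⟨N, fun n hn => eLpNorm_two_le_of_lintegral ?_⟩
  refine lintegral_mollify_sub_le _ (hf.locallyIntegrable (by norm_num)) fun y hy => ?_
  have h2 := (hball ((Metric.mem_ball.1 hy).trans (hN n hn))).le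
  rw [Lp.toLp_compMeasurePreserving, Lp.edist_toLp_toLp] at h2
  have h3 := pow_le_pow_left' h2 2
  rw [eLpNorm_two_sq] at h3
  exact h3

/-! ### Smooth cutoffs and approximation by compactly supported smooth functions -/

/-- The fixed radial profile of the cutoff functions. -/
noncomputable def cutoffProfile (d : ℕ) : ContDiffBump (0 : Pt d) :=
  ⟨1, 2, one_pos, one_lt_two⟩

/-- Smooth cutoff functions `χ(x / (n + 1))`. -/
noncomputable def cutoff (d n : ℕ) (x : Pt d) : ℝ := cutoffProfile d (((n : ℝ) + 1)⁻¹ • x)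

theorem contDiff_cutoff (n : ℕ) : ContDiff ℝ ∞ (cutoff d n) :=
  (cutoffProfile d).contDiff.comp (contDiff_const_smul _)

theorem hasCompactSupport_cutoff (n : ℕ) : HasCompactSupport (cutoff d n) :=
  (cutoffProfile d).hasCompactSupport.comp_homeomorph
    (Homeomorph.smulOfNeZero (((n : ℝ) + 1)⁻¹) (by positivity))

theorem abs_cutoff_le (n : ℕ) (x : Pt d) : |cutoff d n x| ≤ 1 := by
  rw [cutoff, abs_of_nonneg (cutoffProfile d).nonneg]
  exact (cutoffProfile d).le_one

theorem tendsto_inv_smul (x : Pt d) :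
    Tendsto (fun n : ℕ => ((n : ℝ) + 1)⁻¹ • x) atTop (𝓝 0) := by
  have := (tendsto_one_div_add_atTop_nhds_zero_nat (𝕜 := ℝ)).smul_const x
  simpa using this

theorem tendsto_cutoff (x : Pt d) : Tendsto (fun n => cutoff d n x) atTop (𝓝 1) := by
  have h := (cutoffProfile d).continuous.tendsto 0
  rw [(cutoffProfile d).one_of_mem_closedBall (by simp [cutoffProfile])] at h
  exact h.comp (tendsto_inv_smul x)

theorem fderiv_cutoff (n : ℕ) (x y : Pt d) :
    fderiv ℝ (cutoff d n) x y
      = ((n : ℝ) + 1)⁻¹ * fderiv ℝ (cutoffProfile d) (((n : ℝ) + 1)⁻¹ • x) y := by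
  have h1 : HasFDerivAt (fun x : Pt d => ((n : ℝ) + 1)⁻¹ • x)
      (((n : ℝ) + 1)⁻¹ • ContinuousLinearMap.id ℝ (Pt d)) x :=
    (((n : ℝ) + 1)⁻¹ • ContinuousLinearMap.id ℝ (Pt d)).hasFDerivAt
  have h2 := (((cutoffProfile d).contDiff (n := 1)).differentiable (by simp)
    (((n : ℝ) + 1)⁻¹ • x)).hasFDerivAt.comp x h1
  rw [show fderiv ℝ (cutoff d n) x = _ from h2.fderiv]
  simp

/-- The derivatives of the cutoffs are `O(1 / (n + 1))`, and `O(1 / |x|)` uniformly in `n`. -/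
theorem exists_bound_fderiv_cutoff (i : Fin d) : ∃ M : ℝ, 0 ≤ M ∧
    (∀ n x, |fderiv ℝ (cutoff d n) x (EuclideanSpace.single i 1)| ≤ M * ((n : ℝ) + 1)⁻¹) ∧
    ∀ n x, ‖x‖ * |fderiv ℝ (cutoff d n) x (EuclideanSpace.single i 1)| ≤ M := by
  set D : Pt d → ℝ := fun z => fderiv ℝ (cutoffProfile d) z (EuclideanSpace.single i 1) with hD
  have hc : Continuous D :=
    (((cutoffProfile d).contDiff (n := 1)).continuous_fderiv (by simp)).clm_apply continuous_const
  have hs : HasCompactSupport D := (cutoffProfile d).hasCompactSupport.fderiv_apply (𝕜 := ℝ) _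
  obtain ⟨M₁, h₁⟩ := hs.exists_bound_of_continuous hc
  obtain ⟨M₂, h₂⟩ := (hs.mul_left (f := fun z : Pt d => ‖z‖)).exists_bound_of_continuous
    (by fun_prop)
  refine ⟨max (max M₁ M₂) 0, le_max_right _ _, fun n x => ?_, fun n x => ?_⟩
  · rw [fderiv_cutoff, abs_mul, abs_of_pos (by positivity : (0:ℝ) < ((n:ℝ) + 1)⁻¹), mul_comm]
    gcongr
    exact (h₁ _).trans ((le_max_left _ _).trans (le_max_left _ _))
  · rw [fderiv_cutoff, abs_mul, ← mul_assoc, abs_of_pos (by positivity : (0:ℝ) < ((n:ℝ) + 1)⁻¹)]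
    have := h₂ (((n : ℝ) + 1)⁻¹ • x)
    simp only [Pi.mul_apply, norm_mul, norm_norm, norm_smul, norm_inv] at this
    rw [Real.norm_of_nonneg (by positivity : (0:ℝ) ≤ (n:ℝ) + 1), mul_comm (_⁻¹)] at this
    exact this.trans ((le_max_right _ _).trans (le_max_left _ _))

theorem enorm_sq_clm_le (L : Pt d →L[ℝ] ℂ) :
    ‖L‖ₑ ^ 2 ≤ ∑ i, ‖L (EuclideanSpace.single i 1)‖ₑ ^ 2 := by
  have h : ‖L‖ ≤ √(∑ i, ‖L (EuclideanSpace.single i 1)‖ ^ 2) := by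
    refine L.opNorm_le_bound (by positivity) fun y => ?_
    rw [clm_apply_eq_sum L y, EuclideanSpace.norm_eq, ← Real.sqrt_mul (by positivity)]
    refine Real.le_sqrt_of_sq_le ?_
    calc ‖∑ i, (y i : ℝ) • L (EuclideanSpace.single i 1)‖ ^ 2
        ≤ (∑ i, ‖L (EuclideanSpace.single i 1)‖ * ‖y i‖) ^ 2 := by
          gcongr
          refine (norm_sum_le _ _).trans (Finset.sum_le_sum fun i _ => ?_)
          rw [norm_smul, mul_comm]
      _ ≤ _ := Finset.sum_mul_sq_le_sq_mul_sq _ _ _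
  have h' := ENNReal.ofReal_le_ofReal
    ((Real.le_sqrt (norm_nonneg _) (by positivity)).1 h)
  rw [ENNReal.ofReal_sum_of_nonneg (fun i _ => by positivity)] at h'
  simpa [ENNReal.ofReal_pow, ofReal_norm] using h'

theorem enorm_add_sq_le (a b : ℂ) : ‖a + b‖ₑ ^ 2 ≤ 2 * (‖a‖ₑ ^ 2 + ‖b‖ₑ ^ 2) := by
  have h : ‖a + b‖ ^ 2 ≤ 2 * (‖a‖ ^ 2 + ‖b‖ ^ 2) := by
    nlinarith [norm_add_le a b, norm_nonneg (a + b), sq_nonneg (‖a‖ - ‖b‖)]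
  have h' := ENNReal.ofReal_le_ofReal h
  rw [ENNReal.ofReal_mul (by norm_num), ENNReal.ofReal_add (by positivity) (by positivity)] at h'
  simpa [ENNReal.ofReal_pow, ofReal_norm] using h'

theorem lintegral_sq_lt_top {α : Type*} [MeasurableSpace α] {μ : Measure α} {f : α → ℂ}
    (hf : MemLp f 2 μ) : ∫⁻ x, ‖f x‖ₑ ^ 2 ∂μ < ⊤ := by
  rw [← eLpNorm_two_sq]
  exact ENNReal.pow_lt_top hf.eLpNorm_lt_top

theorem lintegral_sum_add_mul {α ι : Type*} [MeasurableSpace α] [Fintype ι] {μ : Measure α}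
    {f : ι → α → ℝ≥0∞} {g : α → ℝ≥0∞} (hf : ∀ i, Measurable (f i)) (hg : Measurable g)
    (c : ι → ℝ≥0∞) :
    ∫⁻ x, ∑ i, 2 * (f i x + c i * g x) ∂μ = ∑ i, 2 * ((∫⁻ x, f i x ∂μ) + c i * ∫⁻ x, g x ∂μ) := by
  rw [lintegral_finsetSum _ fun i _ => by have := hf i; fun_prop]
  refine Finset.sum_congr rfl fun i _ => ?_
  rw [lintegral_const_mul _ (by have := hf i; fun_prop), lintegral_add_left (hf i),
    lintegral_const_mul _ hg]

/-- A function with square-integrable weak gradient is an a.e. limit of compactly supported smooth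
functions that are bounded in `H¹`: mollify and cut off. -/
theorem exists_smooth_approx {u : Pt d → ℂ} {v : Fin d → Pt d → ℂ} (hu : MemLp u 2 volume)
    (h : ∀ i, IsWeakPartial i u (v i)) (hv : ∀ i, MemLp (v i) 2 volume) :
    ∃ (g : ℕ → Pt d → ℂ) (C : ℝ≥0∞), C ≠ ⊤ ∧ (∀ n, ContDiff ℝ 1 (g n)) ∧
      (∀ n, HasCompactSupport (g n)) ∧ (∀ᵐ x, Tendsto (fun n => g n x) atTop (𝓝 (u x))) ∧
      (∀ n, ∫⁻ x, ‖g n x‖ₑ ^ 2 ≤ C) ∧ ∀ n, ∫⁻ x, ‖fderiv ℝ (g n) x‖ₑ ^ 2 ≤ C := by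
  have hul : LocallyIntegrable u volume := hu.locallyIntegrable (by norm_num)
  choose M hM0 hM1 _ using exists_bound_fderiv_cutoff (d := d)
  set m : ℕ → Pt d → ℂ := fun n => mollify (bumpSeq d n) u with hm
  have hmc : ∀ n, ContDiff ℝ ∞ (m n) := fun n => contDiff_mollify _ hul
  set A := ∫⁻ x, ‖u x‖ₑ ^ 2 with hA
  set B : Fin d → ℝ≥0∞ := fun i => ∫⁻ x, ‖v i x‖ₑ ^ 2 with hB
  have hAt : A < ⊤ := lintegral_sq_lt_top hu
  have hBt : ∀ i, B i < ⊤ := fun i => lintegral_sq_lt_top (hv i)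
  set K : ℝ≥0∞ := ∑ i, 2 * (B i + ENNReal.ofReal (M i) ^ 2 * A) with hK
  have hKt : K < ⊤ := by
    refine ENNReal.sum_lt_top.2 fun i _ => ENNReal.mul_lt_top (by simp) ?_
    exact ENNReal.add_lt_top.2 ⟨hBt i, ENNReal.mul_lt_top (by simp) hAt⟩
  refine ⟨fun n x => cutoff d n x • m n x, A + K, (ENNReal.add_lt_top.2 ⟨hAt, hKt⟩).ne,
    fun n => ((contDiff_cutoff n).smul (hmc n)).of_le (by simp),
    fun n => (hasCompactSupport_cutoff n).smul_right, ?_, fun n => ?_, fun n => ?_⟩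
  · filter_upwards [ae_tendsto_mollify hul] with x hx
    simpa using (tendsto_cutoff x).smul hx
  · refine le_trans ?_ (le_self_add)
    refine le_trans (lintegral_mono fun x => ?_)
      (lintegral_mollify_le (bumpSeq d n) hu.aestronglyMeasurable)
    rw [enorm_smul]
    gcongr
    calc _ ≤ 1 * ‖m n x‖ₑ := by
          gcongr
          rw [← ofReal_norm, Real.norm_eq_abs]
          simpa using ENNReal.ofReal_le_ofReal (abs_cutoff_le n x)
      _ = _ := one_mul _
  · refine le_trans ?_ (le_add_self)
    have hd : ∀ x (i : Fin d), fderiv ℝ (fun x => cutoff d n x • m n x) x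
        (EuclideanSpace.single i 1) = cutoff d n x • mollify (bumpSeq d n) (v i) x
          + (fderiv ℝ (cutoff d n) x (EuclideanSpace.single i 1)) • m n x := by
      intro x i
      rw [fderiv_fun_smul ((contDiff_cutoff n).differentiable (by simp) x)
        ((hmc n).differentiable (by simp) x)]
      simp [hm, fderiv_mollify _ (h i)]
    have hmeas : ∀ i, Continuous (mollify (bumpSeq d n) (v i)) := fun i =>
      (contDiff_mollify _ (h i).locInt_deriv).continuous
    calc ∫⁻ x, ‖fderiv ℝ (fun x => cutoff d n x • m n x) x‖ₑ ^ 2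
        ≤ ∫⁻ x, ∑ i, 2 * (‖mollify (bumpSeq d n) (v i) x‖ₑ ^ 2
            + ENNReal.ofReal (M i) ^ 2 * ‖m n x‖ₑ ^ 2) := by
          refine lintegral_mono fun x => (enorm_sq_clm_le _).trans ?_
          refine Finset.sum_le_sum fun i _ => ?_
          rw [hd]
          refine (enorm_add_sq_le _ _).trans ?_
          simp only [enorm_smul, mul_pow]
          gcongr
          · calc _ ≤ 1 ^ 2 * ‖mollify (bumpSeq d n) (v i) x‖ₑ ^ 2 := by
                  gcongr
                  rw [← ofReal_norm, Real.norm_eq_abs]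
                  simpa using ENNReal.ofReal_le_ofReal (abs_cutoff_le n x)
              _ = _ := by simp
          · rw [← ofReal_norm, Real.norm_eq_abs]
            refine ENNReal.ofReal_le_ofReal ((hM1 i n x).trans (mul_le_of_le_one_right (hM0 i) ?_))
            exact inv_le_one_of_one_le₀ (by simp)
      _ = ∑ i, 2 * ((∫⁻ x, ‖mollify (bumpSeq d n) (v i) x‖ₑ ^ 2)
            + ENNReal.ofReal (M i) ^ 2 * ∫⁻ x, ‖m n x‖ₑ ^ 2) := by
          have h1 : ∀ i, Measurable fun x => ‖mollify (bumpSeq d n) (v i) x‖ₑ ^ 2 := fun i =>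
            (hmeas i).measurable.enorm.pow_const 2
          have h2 : Measurable fun x => ‖m n x‖ₑ ^ 2 :=
            (hmc n).continuous.measurable.enorm.pow_const 2
          exact lintegral_sum_add_mul h1 h2 _
      _ ≤ K := by
          refine Finset.sum_le_sum fun i _ => ?_
          gcongr
          · exact lintegral_mollify_le _ (hv i).aestronglyMeasurable
          · exact lintegral_mollify_le _ hu.aestronglyMeasurable

/-! ### Sobolev inequalities -/

theorem sq_lintegral_mul_le {α : Type*} [MeasurableSpace α] {μ : Measure α} {f g : α → ℝ≥0∞}
    (hf : AEMeasurable f μ) (hg : AEMeasurable g μ) :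
    (∫⁻ x, f x * g x ∂μ) ^ 2 ≤ (∫⁻ x, f x ^ 2 ∂μ) * ∫⁻ x, g x ^ 2 ∂μ := by
  have h := ENNReal.lintegral_mul_le_Lp_mul_Lq μ Real.HolderConjugate.two_two hf hg
  have h2 := pow_le_pow_left' h 2
  rw [mul_pow, ← ENNReal.rpow_natCast (_ ^ (1 / 2 : ℝ)), ← ENNReal.rpow_natCast (_ ^ (1 / 2 : ℝ)),
    ← ENNReal.rpow_mul, ← ENNReal.rpow_mul] at h2
  simpa using h2

/-- In dimension one a compactly supported function is bounded by the `L¹` norm of its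
derivative. -/
theorem enorm_le_lintegral_fderiv_dim_one {h : Pt 1 → ℂ} (hc : ContDiff ℝ 1 h)
    (hs : HasCompactSupport h) (x : Pt 1) : ‖h x‖ₑ ≤ ∫⁻ y, ‖fderiv ℝ h y‖ₑ := by
  let e : ℝ ≃ₗᵢ[ℝ] Pt 1 := (OrthonormalBasis.singleton (Fin 1) ℝ).repr
  have hd : ∀ t, HasDerivAt (h ∘ e) (fderiv ℝ h (e t) (e 1)) t := by
    intro t
    have h1 : HasDerivAt e (e 1) t :=
      (e.toContinuousLinearEquiv : ℝ →L[ℝ] Pt 1).hasDerivAt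
    exact ((hc.differentiable (by simp)) (e t)).hasFDerivAt.comp_hasDerivAt t h1
  have hn : ‖e 1‖ = 1 := by simp
  have h1 := (hs.comp_homeomorph e.toHomeomorph).enorm_le_lintegral_Ici_deriv
    (hc.comp e.toContinuousLinearEquiv.contDiff) (e.symm x)
  calc ‖h x‖ₑ = ‖h (e (e.symm x))‖ₑ := by simp
    _ ≤ ∫⁻ y in Iic (e.symm x), ‖deriv (h ∘ e) y‖ₑ := h1
    _ ≤ ∫⁻ y, ‖deriv (h ∘ e) y‖ₑ := setLIntegral_le_lintegral _ _
    _ ≤ ∫⁻ t, ‖fderiv ℝ h (e t)‖ₑ := by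
        refine lintegral_mono fun t => ?_
        rw [(hd t).deriv, ← ofReal_norm, ← ofReal_norm]
        refine ENNReal.ofReal_le_ofReal ?_
        simpa [hn] using (fderiv ℝ h (e t)).le_opNorm (e 1)
    _ = ∫⁻ y, ‖fderiv ℝ h y‖ₑ := by
        have hme : Measurable fun y => ‖fderiv ℝ h y‖ₑ :=
          (hc.continuous_fderiv (by simp)).measurable.enorm
        exact e.measurePreserving.lintegral_comp hme

theorem enorm_fderiv_pow_le {g : Pt d → ℂ} (hg : ContDiff ℝ 1 g) (k : ℕ) (x : Pt d) :
    ‖fderiv ℝ (fun x => g x ^ (k + 1)) x‖ₑ ≤ (k + 1 : ℝ≥0∞) * (‖g x‖ₑ ^ k * ‖fderiv ℝ g x‖ₑ) := by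
  have h := (hg.differentiable (by simp) x).hasFDerivAt.pow (k + 1)
  have e : fderiv ℝ (fun x => g x ^ (k + 1)) x = ((k + 1 : ℕ) * g x ^ k) • fderiv ℝ g x := by
    refine h.fderiv.trans ?_
    ext
    simp
  rw [e, enorm_smul, enorm_mul, enorm_pow, mul_assoc, ← ofReal_norm ((k + 1 : ℕ) : ℂ),
    Complex.norm_natCast, ENNReal.ofReal_natCast]
  simp

/-- In dimensions one and two, each even power of a function that is bounded in `H¹` is bounded
in `L¹`. The induction applies the one-dimensional sup bound to `g²`, respectively the
Gagliardo-Nirenberg inequality `‖h‖_{L²} ≤ c ‖∇h‖_{L¹}` in the plane to a power of `g`, and the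
Cauchy-Schwarz inequality to the gradient of the power. -/
theorem exists_bound_lintegral_even_pow (hd : d = 1 ∨ d = 2) {C : ℝ≥0∞} (hC : C ≠ ⊤) (k : ℕ) :
    ∃ K : ℝ≥0∞, K ≠ ⊤ ∧ ∀ g : Pt d → ℂ, ContDiff ℝ 1 g → HasCompactSupport g →
      ∫⁻ x, ‖g x‖ₑ ^ 2 ≤ C → ∫⁻ x, ‖fderiv ℝ g x‖ₑ ^ 2 ≤ C →
      ∫⁻ x, ‖g x‖ₑ ^ (2 * (k + 1)) ≤ K := by
  induction k with
  | zero => exact ⟨C, hC, fun g _ _ h _ => by simpa using h⟩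
  | succ k ih =>
    obtain ⟨K, hK, ih⟩ := ih
    have hme : ∀ g : Pt d → ℂ, ContDiff ℝ 1 g → Measurable fun x => ‖fderiv ℝ g x‖ₑ :=
      fun g hg => (hg.continuous_fderiv (by simp)).measurable.enorm
    -- Cauchy-Schwarz for the gradient of a power
    have hCS : ∀ g : Pt d → ℂ, ContDiff ℝ 1 g → ∀ j : ℕ,
        (∫⁻ x, ‖fderiv ℝ (fun x => g x ^ (j + 1)) x‖ₑ) ^ 2
          ≤ (j + 1) ^ 2 * ((∫⁻ x, ‖g x‖ₑ ^ (2 * j)) * ∫⁻ x, ‖fderiv ℝ g x‖ₑ ^ 2) := by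
      intro g hg j
      calc (∫⁻ x, ‖fderiv ℝ (fun x => g x ^ (j + 1)) x‖ₑ) ^ 2
          ≤ (∫⁻ x, (j + 1 : ℝ≥0∞) * (‖g x‖ₑ ^ j * ‖fderiv ℝ g x‖ₑ)) ^ 2 := by
            gcongr with x
            exact enorm_fderiv_pow_le hg j x
        _ = (j + 1) ^ 2 * (∫⁻ x, ‖g x‖ₑ ^ j * ‖fderiv ℝ g x‖ₑ) ^ 2 := by
            have h1 := hg.continuous.measurable.enorm
            have h2 := hme g hg
            rw [lintegral_const_mul _ (by fun_prop), mul_pow]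
        _ ≤ _ := by
            gcongr
            refine (sq_lintegral_mul_le (hg.continuous.measurable.enorm.pow_const _).aemeasurable
              (hme g hg).aemeasurable).trans_eq ?_
            simp_rw [← pow_mul, mul_comm j 2]
    rcases hd with rfl | rfl
    · refine ⟨2 * C * K, ENNReal.mul_ne_top (ENNReal.mul_ne_top (by simp) hC) hK,
        fun g hg hs h0 h1 => ?_⟩
      have hsup : ∀ x, ‖g x‖ₑ ^ 2 ≤ 2 * C := by
        intro x
        have h2 := enorm_le_lintegral_fderiv_dim_one (hg.pow 2)
          (hs.comp_left (g := fun z : ℂ => z ^ 2) (by simp)) x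
        have h3 := hCS g hg 1
        have h4 : (∫⁻ x, ‖fderiv ℝ (fun x => g x ^ 2) x‖ₑ) ^ 2 ≤ (2 * C) ^ 2 := by
          refine h3.trans ?_
          rw [mul_pow, sq C]
          gcongr
          · norm_num
        rw [enorm_pow] at h2
        exact h2.trans ((ENNReal.pow_right_strictMono two_ne_zero).le_iff_le.1 h4)
      calc ∫⁻ x, ‖g x‖ₑ ^ (2 * (k + 1 + 1)) ≤ ∫⁻ x, 2 * C * ‖g x‖ₑ ^ (2 * (k + 1)) := by
            refine lintegral_mono fun x => ?_
            rw [mul_add 2 (k + 1) 1, pow_add, mul_comm]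
            gcongr
            simpa using hsup x
        _ = 2 * C * ∫⁻ x, ‖g x‖ₑ ^ (2 * (k + 1)) :=
            lintegral_const_mul _ (hg.continuous.measurable.enorm.pow_const _)
        _ ≤ _ := by gcongr; exact ih g hg hs h0 h1
    · have hp : Real.HolderConjugate (Module.finrank ℝ (Pt 2)) (2:ℝ) := by
        simpa using Real.HolderConjugate.two_two
      set c : NNReal := lintegralPowLePowLIntegralFDerivConst (volume : Measure (Pt 2)) 2 with hc
      refine ⟨c * (((k + 1 : ℕ) + 1) ^ 2 * (K * C)), ENNReal.mul_ne_top (by simp [hc])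
        (ENNReal.mul_ne_top (by simp) (ENNReal.mul_ne_top hK hC)), fun g hg hs h0 h1 => ?_⟩
      have h2 := lintegral_pow_le_pow_lintegral_fderiv (volume : Measure (Pt 2)) (hg.pow (k + 2))
        (hs.comp_left (g := fun z : ℂ => z ^ (k + 2)) (by simp)) hp
      have h3 := hCS g hg (k + 1)
      calc ∫⁻ x, ‖g x‖ₑ ^ (2 * (k + 1 + 1)) = ∫⁻ x, ‖g x ^ (k + 2)‖ₑ ^ (2:ℝ) := by
            refine lintegral_congr fun x => ?_
            rw [enorm_pow, ENNReal.rpow_two, ← pow_mul]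
            congr 1
            ring
        _ ≤ c * (∫⁻ x, ‖fderiv ℝ (fun x => g x ^ (k + 2)) x‖ₑ) ^ (2:ℝ) := h2
        _ ≤ _ := by
            rw [ENNReal.rpow_two]
            gcongr
            refine h3.trans ?_
            gcongr
            exact ih g hg hs h0 h1

theorem enorm_rpow_le_add (z : ℂ) {q r : ℝ} (hq : 2 ≤ q) (hqr : q ≤ r) :
    ‖z‖ₑ ^ q ≤ ‖z‖ₑ ^ 2 + ‖z‖ₑ ^ r := by
  rcases le_total ‖z‖ₑ 1 with h | h
  · refine le_trans ?_ le_self_add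
    rw [← ENNReal.rpow_two]
    exact ENNReal.rpow_le_rpow_of_exponent_ge h hq
  · exact le_trans (ENNReal.rpow_le_rpow_of_exponent_le h hqr) le_add_self

/-- Every exponent `q` allowed by the Sobolev inequality lies below some `r` for which functions
bounded in `H¹` are bounded in `L^r`: an even integer if `d ≤ 2`, and `r = 2d/(d-2)` if `d ≥ 3`. -/
theorem exists_bound_lintegral_rpow (hd : 1 ≤ d) {q : ℝ}
    (hqd : 3 ≤ d → q ≤ 2 * (d : ℝ) / ((d : ℝ) - 2)) {C : ℝ≥0∞} (hC : C ≠ ⊤) :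
    ∃ r : ℝ, q ≤ r ∧ ∃ K : ℝ≥0∞, K ≠ ⊤ ∧ ∀ g : Pt d → ℂ, ContDiff ℝ 1 g → HasCompactSupport g →
      ∫⁻ x, ‖g x‖ₑ ^ 2 ≤ C → ∫⁻ x, ‖fderiv ℝ g x‖ₑ ^ 2 ≤ C → ∫⁻ x, ‖g x‖ₑ ^ r ≤ K := by
  rcases Nat.lt_or_ge d 3 with h3 | h3
  · have hd' : d = 1 ∨ d = 2 := by omega
    obtain ⟨k, hk⟩ := exists_nat_ge q
    obtain ⟨K, hK, h⟩ := exists_bound_lintegral_even_pow hd' hC k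
    refine ⟨(2 * (k + 1) : ℕ), ?_, K, hK, ?_⟩
    · push_cast; linarith [(Nat.cast_nonneg k : (0:ℝ) ≤ k)]
    · simpa only [ENNReal.rpow_natCast] using h
  · have hd3 : (3:ℝ) ≤ d := by exact_mod_cast h3
    set r : NNReal := ⟨2 * (d : ℝ) / ((d : ℝ) - 2), by
      apply div_nonneg <;> linarith⟩ with hr
    have hr0 : r ≠ 0 := by
      intro h0
      have h1 : 2 * (d : ℝ) / ((d : ℝ) - 2) = 0 := congrArg NNReal.toReal h0
      exact (div_pos (by linarith) (by linarith)).ne' h1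
    set c : NNReal := SNormLESNormFDerivOfEqConst ℂ (volume : Measure (Pt d)) 2 with hc
    refine ⟨r, hqd h3, (c * C ^ (1 / 2 : ℝ)) ^ (r : ℝ), ENNReal.rpow_ne_top_of_nonneg r.2
      (ENNReal.mul_ne_top (by simp) (ENNReal.rpow_ne_top_of_nonneg (by norm_num) hC)),
      fun g hg hs h0 h1 => ?_⟩
    have h2 := eLpNorm_le_eLpNorm_fderiv_of_eq (volume : Measure (Pt d)) hg hs (p := 2) (p' := r)
      (by norm_num) (by simpa using (by omega : 0 < d)) (by
        have h5 : (r : ℝ) = 2 * (d : ℝ) / ((d : ℝ) - 2) := rfl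
        have h6 : (d:ℝ) - 2 ≠ 0 := by linarith
        rw [h5, finrank_euclideanSpace_fin]
        push_cast
        field_simp)
    rw [← eLpNorm_nnreal_pow_eq_lintegral hr0]
    refine ENNReal.rpow_le_rpow (h2.trans (mul_le_mul_right ?_ _)) r.2
    have h4 := eLpNorm_nnreal_eq_lintegral (f := fderiv ℝ g) (μ := (volume : Measure (Pt d)))
      (p := 2) (by norm_num)
    refine h4.trans_le ?_
    simp only [NNReal.coe_ofNat, ENNReal.rpow_ofNat]
    gcongr

/-- **Sobolev embedding** `H¹ ⊂ L^q`, qualitatively. -/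
theorem lintegral_rpow_lt_top (hd : 1 ≤ d) {q : ℝ} (hq : 2 ≤ q)
    (hqd : 3 ≤ d → q ≤ 2 * (d : ℝ) / ((d : ℝ) - 2)) {u : Pt d → ℂ} {v : Fin d → Pt d → ℂ}
    (hu : MemLp u 2 volume) (h : ∀ i, IsWeakPartial i u (v i)) (hv : ∀ i, MemLp (v i) 2 volume) :
    ∫⁻ x, ‖u x‖ₑ ^ q < ⊤ := by
  obtain ⟨g, C, hC, hg, hs, hlim, h0, h1⟩ := exists_smooth_approx hu h hv
  obtain ⟨r, hqr, K, hK, hb⟩ := exists_bound_lintegral_rpow hd hqd hC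
  refine lt_of_le_of_lt (lintegral_le_of_ae_tendsto (F := fun n x => ‖g n x‖ₑ ^ q) (C := C + K)
    (fun n => ?_) ?_ fun n => ?_) (ENNReal.add_lt_top.2 ⟨hC.lt_top, hK.lt_top⟩)
  · exact ((hg n).continuous.measurable.enorm.pow_const _).aemeasurable
  · filter_upwards [hlim] with x hx
    exact (ENNReal.continuous_rpow_const.tendsto _).comp hx.enorm
  · calc ∫⁻ x, ‖g n x‖ₑ ^ q ≤ ∫⁻ x, (‖g n x‖ₑ ^ 2 + ‖g n x‖ₑ ^ r) :=
          lintegral_mono fun x => enorm_rpow_le_add _ hq hqr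
      _ = (∫⁻ x, ‖g n x‖ₑ ^ 2) + ∫⁻ x, ‖g n x‖ₑ ^ r :=
          lintegral_add_left ((hg n).continuous.measurable.enorm.pow_const _) _
      _ ≤ C + K := add_le_add (h0 n) (hb _ (hg n) (hs n) (h0 n) (h1 n))

theorem MemX.integrable_rpow {V : Pt d → ℝ} (hd : 1 ≤ d) {p : ℝ} (hp : 1 < p)
    (hp' : 3 ≤ d → p < ((d : ℝ) + 2) / ((d : ℝ) - 2)) {u : Pt d → ℂ} (hu : MemX V u) :
    Integrable (fun x => ‖u x‖ ^ (p + 1)) volume := by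
  refine ⟨(hu.memLp.aestronglyMeasurable.norm.aemeasurable.pow_const _).aestronglyMeasurable, ?_⟩
  have h := lintegral_rpow_lt_top hd (q := p + 1) (by linarith) (fun h3 => ?_) hu.memLp
    hu.hasWeakPartial hu.memLp_weakPartial
  · refine lt_of_le_of_lt (lintegral_mono fun x => ?_) h
    rw [← ofReal_norm, ← ofReal_norm, ENNReal.ofReal_rpow_of_nonneg (norm_nonneg _) (by linarith),
      Real.norm_of_nonneg (by positivity)]
  · have hd3 : (3:ℝ) ≤ d := by exact_mod_cast h3
    have h2 : (0:ℝ) < d - 2 := by linarith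
    have := hp' h3
    rw [lt_div_iff₀ h2] at this
    rw [le_div_iff₀ h2]
    nlinarith

/-! ### Compactness of the embedding of `X` into `L²` -/

theorem lintegral_enorm_sq_eq {α : Type*} [MeasurableSpace α] {μ : Measure α} {f : α → ℂ}
    (hf : MemLp f 2 μ) : ∫⁻ x, ‖f x‖ₑ ^ 2 ∂μ = ENNReal.ofReal (∫ x, ‖f x‖ ^ 2 ∂μ) := by
  rw [ofReal_integral_eq_lintegral_ofReal (by simpa using hf.integrable_norm_pow (by norm_num))
    (ae_of_all _ fun x => by positivity)]
  exact lintegral_congr fun x => by rw [ENNReal.ofReal_pow (norm_nonneg _), ofReal_norm]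

theorem lintegral_sub_sq_le {α : Type*} [MeasurableSpace α] {μ : Measure α} {f g h : α → ℂ}
    (hf : AEStronglyMeasurable f μ) (hg : AEStronglyMeasurable g μ) :
    ∫⁻ x, ‖f x - h x‖ₑ ^ 2 ∂μ
      ≤ 2 * ((∫⁻ x, ‖f x - g x‖ₑ ^ 2 ∂μ) + ∫⁻ x, ‖g x - h x‖ₑ ^ 2 ∂μ) := by
  have hm : AEMeasurable (fun x => ‖f x - g x‖ₑ ^ 2) μ := (hf.sub hg).enorm.pow_const 2
  rw [← lintegral_add_left' hm, ← lintegral_const_mul' _ _ (by simp)]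
  refine lintegral_mono fun x => ?_
  simpa using enorm_add_sq_le (f x - g x) (g x - h x)

/-- A Cauchy criterion in `L²`, for functions rather than classes. -/
theorem exists_tendsto_eLpNorm_of_cauchy {α : Type*} [MeasurableSpace α] {μ : Measure α}
    {F : ℕ → α → ℂ} (hF : ∀ n, MemLp (F n) 2 μ)
    (h : ∀ ε : ℝ≥0∞, 0 < ε → ∃ N, ∀ n ≥ N, ∀ m ≥ N, ∫⁻ x, ‖F n x - F m x‖ₑ ^ 2 ∂μ ≤ ε) :
    ∃ f : α → ℂ, MemLp f 2 μ ∧ Tendsto (fun n => eLpNorm (F n - f) 2 μ) atTop (𝓝 0) := by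
  have hc : CauchySeq fun n => (hF n).toLp (F n) := by
    rw [EMetric.cauchySeq_iff]
    intro ε hε
    obtain ⟨δ, hδ0, hδ⟩ := exists_between hε
    obtain ⟨N, hN⟩ := h (δ ^ 2) (by positivity)
    refine ⟨N, fun m hm n hn => ?_⟩
    rw [Lp.edist_toLp_toLp]
    exact (eLpNorm_two_le_of_lintegral (hN m hm n hn)).trans_lt hδ
  obtain ⟨f, hf⟩ := cauchySeq_tendsto_of_complete hc
  refine ⟨f, Lp.memLp f, ?_⟩
  refine (Lp.tendsto_Lp_iff_tendsto_eLpNorm'' F hF f (Lp.memLp f)).1 ?_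
  simpa using hf

/-- Bounded sequences in `L²(ℝ^d)` have weakly convergent subsequences. -/
theorem exists_subseq_tendsto_integral_mul {F : ℕ → Pt d → ℂ} (hF : ∀ n, MemLp (F n) 2 volume)
    {K : ℝ≥0∞} (hK : K ≠ ⊤) (h : ∀ n, ∫⁻ x, ‖F n x‖ₑ ^ 2 ≤ K) :
    ∃ φ : ℕ → ℕ, StrictMono φ ∧ ∀ g : Pt d → ℂ, MemLp g 2 volume →
      ∃ L, Tendsto (fun n => ∫ x, g x * F (φ n) x) atTop (𝓝 L) := by
  have : Fact ((2:ℝ≥0∞) ≠ ⊤) := ⟨by norm_num⟩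
  set ℓ : ℕ → WeakDual ℂ (Lp ℂ 2 (volume : Measure (Pt d))) := fun n =>
    StrongDual.toWeakDual (InnerProductSpace.toDual ℂ _ ((hF n).toLp (F n))) with hℓ
  obtain ⟨R, hR⟩ : ∃ R : ℝ, ∀ n, ‖(hF n).toLp (F n)‖ ≤ R := by
    refine ⟨(K ^ (1 / 2 : ℝ)).toReal, fun n => ?_⟩
    rw [Lp.norm_toLp]
    refine ENNReal.toReal_mono (ENNReal.rpow_ne_top_of_nonneg (by norm_num) hK) ?_
    refine eLpNorm_two_le_of_lintegral ((h n).trans_eq ?_)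
    rw [← ENNReal.rpow_natCast, ← ENNReal.rpow_mul]
    simp
  obtain ⟨a, -, φ, hφ, hlim⟩ := WeakDual.isSeqCompact_closedBall ℂ
    (Lp ℂ 2 (volume : Measure (Pt d))) 0 R (x := ℓ) fun n => by
      simp only [hℓ, mem_preimage, mem_closedBall_zero_iff]
      refine le_trans (le_of_eq ?_) (hR n)
      exact (InnerProductSpace.toDual ℂ _).norm_map _
  refine ⟨φ, hφ, fun g hg => ?_⟩
  have h1 := ((WeakDual.eval_continuous (hg.star.toLp _)).tendsto a).comp hlim
  refine ⟨_, (((Complex.continuous_conj.tendsto _).comp h1).congr fun n => ?_)⟩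
  have h2 : ℓ (φ n) (hg.star.toLp _) = inner ℂ ((hF (φ n)).toLp (F (φ n))) (hg.star.toLp _) := rfl
  simp only [Function.comp_apply]
  rw [h2, inner_conj_symm, L2.inner_def]
  refine integral_congr_ae ?_
  filter_upwards [hg.star.coeFn_toLp, (hF (φ n)).coeFn_toLp] with x h1 h2
  rw [h1, h2]
  simp [mul_comm]

theorem memLp_bump_translate (φ : ContDiffBump (0 : Pt d)) (x : Pt d) :
    MemLp (fun y => (φ.normed volume (x - y) : ℂ)) 2 volume :=
  memLp_two_ofReal (η := fun y => φ.normed volume (x - y))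
    (φ.continuous_normed.comp (by fun_prop))
    (φ.hasCompactSupport_normed.comp_homeomorph (Homeomorph.subLeft x))

theorem enorm_mollify_sq_le (φ : ContDiffBump (0 : Pt d)) {f : Pt d → ℂ}
    (hf : AEStronglyMeasurable f volume) (x : Pt d) :
    ‖mollify φ f x‖ₑ ^ 2 ≤ (∫⁻ y, ‖φ.normed volume y‖ₑ ^ 2) * ∫⁻ y, ‖f y‖ₑ ^ 2 := by
  have hm : Measurable fun y => ‖φ.normed (volume : Measure (Pt d)) (x - y)‖ₑ :=
    (φ.continuous_normed.comp (by fun_prop : Continuous fun y => x - y)).measurable.enorm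
  rw [mollify_eq_integral_swap,
    ← lintegral_sub_left_eq_self (fun y => ‖φ.normed (volume : Measure (Pt d)) y‖ₑ ^ 2) x]
  refine le_trans ?_ (sq_lintegral_mul_le hm.aemeasurable hf.enorm)
  gcongr
  refine (enorm_integral_le_lintegral_enorm _).trans_eq ?_
  simp_rw [enorm_smul]

/-- Local compactness: mollifications of a weakly convergent sequence converge in `L²(B)`. -/
theorem tendsto_lintegral_mollify_sub {F : ℕ → Pt d → ℂ} (hF : ∀ n, MemLp (F n) 2 volume)
    {K : ℝ≥0∞} (hK : K ≠ ⊤) (h : ∀ n, ∫⁻ x, ‖F n x‖ₑ ^ 2 ≤ K)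
    (hw : ∀ g : Pt d → ℂ, MemLp g 2 volume →
      ∃ L, Tendsto (fun n => ∫ x, g x * F n x) atTop (𝓝 L))
    (φ : ContDiffBump (0 : Pt d)) {B : Set (Pt d)} (hB : volume B ≠ ⊤) :
    ∃ g : Pt d → ℂ, Measurable g ∧
      Tendsto (fun n => ∫⁻ x in B, ‖mollify φ (F n) x - g x‖ₑ ^ 2) atTop (𝓝 0) := by
  have hlim : ∀ x, ∃ L, Tendsto (fun n => mollify φ (F n) x) atTop (𝓝 L) := by
    intro x
    obtain ⟨L, hL⟩ := hw _ (memLp_bump_translate φ x)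
    refine ⟨L, hL.congr fun n => ?_⟩
    rw [mollify_eq_integral_swap]
    simp
  choose g hg using hlim
  set c : ℝ≥0∞ := (∫⁻ y, ‖φ.normed (volume : Measure (Pt d)) y‖ₑ ^ 2) * K with hc
  have hct : c ≠ ⊤ := by
    refine ENNReal.mul_ne_top ?_ hK
    have := lintegral_sq_lt_top (memLp_bump_translate φ 0)
    rw [lintegral_sub_left_eq_self (fun y => ‖(φ.normed (volume : Measure (Pt d)) y : ℂ)‖ₑ ^ 2) 0]
      at this
    refine ne_of_lt (lt_of_le_of_lt (lintegral_mono fun y => ?_) this)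
    rw [← ofReal_norm, ← ofReal_norm, Complex.norm_real]
  have hmc : ∀ n, Continuous (mollify φ (F n)) := fun n =>
    (contDiff_mollify φ ((hF n).locallyIntegrable (by norm_num))).continuous
  have hgm : Measurable g := measurable_of_tendsto_metrizable (fun n => (hmc n).measurable)
    (tendsto_pi_nhds.2 hg)
  have hb : ∀ n x, ‖mollify φ (F n) x‖ₑ ^ 2 ≤ c := fun n x =>
    (enorm_mollify_sq_le φ (hF n).aestronglyMeasurable x).trans (mul_le_mul_right (h n) _)
  have hbg : ∀ x, ‖g x‖ₑ ^ 2 ≤ c := fun x =>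
    le_of_tendsto (((ENNReal.continuous_pow 2).tendsto _).comp (hg x).enorm)
      (Eventually.of_forall fun n => hb n x)
  refine ⟨g, hgm, ?_⟩
  have := tendsto_lintegral_of_dominated_convergence (μ := volume.restrict B)
    (F := fun n x => ‖mollify φ (F n) x - g x‖ₑ ^ 2) (f := fun _ => 0) (fun _ => 2 * (c + c))
    (fun n => ((hmc n).measurable.sub hgm).enorm.pow_const 2) (fun n => ae_of_all _ fun x => ?_)
    (by
      rw [setLIntegral_const]
      exact ENNReal.mul_ne_top (ENNReal.mul_ne_top (by simp) (by simp [hct])) hB)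
    (ae_of_all _ fun x => ?_)
  · simpa using this
  · change ‖mollify φ (F n) x - g x‖ₑ ^ 2 ≤ 2 * (c + c)
    rw [sub_eq_add_neg]
    refine (enorm_add_sq_le _ _).trans ?_
    rw [enorm_neg]
    gcongr
    exacts [hb n x, hbg x]
  · have h1 := ((hg x).sub_const (g x)).enorm
    have h2 := ((ENNReal.continuous_pow 2).tendsto _).comp h1
    simpa [Function.comp_def] using h2

/-- **Rellich compactness** for a confining potential: a sequence that is bounded in `X` has a
subsequence that converges in `L²`. -/
theorem exists_subseq_tendsto_eLpNorm {V : Pt d → ℝ} (hV0 : ∀ x, 0 ≤ V x)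
    (hV : Tendsto V (cocompact (Pt d)) atTop) {u : ℕ → Pt d → ℂ} (hu : ∀ n, MemX V (u n))
    {K : ℝ} (hm : ∀ n, mass (u n) ≤ K)
    (hD : ∀ n, ∫ x, ∑ i, ‖weakPartial i (u n) x‖ ^ 2 ≤ K)
    (hP : ∀ n, ∫ x, V x * ‖u n x‖ ^ 2 ≤ K) :
    ∃ φ : ℕ → ℕ, StrictMono φ ∧ ∃ f : Pt d → ℂ, MemLp f 2 volume ∧
      Tendsto (fun n => eLpNorm (u (φ n) - f) 2 volume) atTop (𝓝 0) := by
  set k : ℝ≥0∞ := ENNReal.ofReal K with hk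
  have hkt : k ≠ ⊤ := by simp [hk]
  have hm' : ∀ n, ∫⁻ x, ‖u n x‖ₑ ^ 2 ≤ k := fun n => by
    rw [lintegral_enorm_sq_eq (hu n).memLp]; exact ENNReal.ofReal_le_ofReal (hm n)
  have hD' : ∀ n, ∑ i, ∫⁻ x, ‖weakPartial i (u n) x‖ₑ ^ 2 ≤ k := fun n => by
    simp_rw [lintegral_enorm_sq_eq ((hu n).memLp_weakPartial _)]
    rw [← ENNReal.ofReal_sum_of_nonneg fun i _ => by positivity,
      ← integral_finsetSum _ fun i _ => by
        simpa using ((hu n).memLp_weakPartial i).integrable_norm_pow (by norm_num)]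
    exact ENNReal.ofReal_le_ofReal (hD n)
  obtain ⟨φ, hφ, hw⟩ := exists_subseq_tendsto_integral_mul (fun n => (hu n).memLp) hkt hm'
  refine ⟨φ, hφ, exists_tendsto_eLpNorm_of_cauchy (fun n => (hu (φ n)).memLp) ?_⟩
  -- it suffices to approximate the tail of the sequence by a fixed function
  suffices H : ∀ ε : ℝ≥0∞, 0 < ε → ∃ g : Pt d → ℂ, AEStronglyMeasurable g volume ∧
      ∃ N, ∀ n ≥ N, ∫⁻ x, ‖u (φ n) x - g x‖ₑ ^ 2 ≤ ε by
    intro ε hε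
    obtain ⟨g, hg, N, hN⟩ := H (ε / 4) (ENNReal.div_pos hε.ne' (by simp))
    refine ⟨N, fun n hn m hm => ?_⟩
    refine (lintegral_sub_sq_le (hu _).memLp.aestronglyMeasurable hg).trans ?_
    have h1 : ∫⁻ x, ‖g x - u (φ m) x‖ₑ ^ 2 ≤ ε / 4 := by
      simp_rw [fun x => enorm_sub_rev (g x) (u (φ m) x)]
      exact hN m hm
    calc _ ≤ 2 * (ε / 4 + ε / 4) := by gcongr; exact hN n hn
      _ = 4 * (ε / 4) := by ring
      _ = ε := ENNReal.mul_div_cancel (by simp) (by simp)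
  intro ε hε
  obtain ⟨δ, hδ0, hδ⟩ : ∃ δ : ℝ≥0∞, 0 < δ ∧ 5 * δ ≤ ε :=
    ⟨ε / 5, ENNReal.div_pos hε.ne' (by simp), ENNReal.mul_div_le⟩
  -- the mass outside a large compact set `B` is small because `V` is large there
  obtain ⟨M, hM⟩ := ENNReal.exists_nat_gt (ENNReal.div_ne_top hkt hδ0.ne')
  have hM0 : (M : ℝ≥0∞) ≠ 0 := (lt_of_le_of_lt zero_le hM).ne'
  obtain ⟨B, hBc, hB⟩ := mem_cocompact.1 (hV.eventually_ge_atTop (M : ℝ))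
  have hBm : MeasurableSet B := hBc.isClosed.measurableSet
  have htail : ∀ n, ∫⁻ x in Bᶜ, ‖u (φ n) x‖ₑ ^ 2 ≤ δ := by
    intro n
    have h1 : (M : ℝ≥0∞) * ∫⁻ x in Bᶜ, ‖u (φ n) x‖ₑ ^ 2 ≤ k := by
      rw [← lintegral_const_mul' _ _ (by simp)]
      calc ∫⁻ x in Bᶜ, (M : ℝ≥0∞) * ‖u (φ n) x‖ₑ ^ 2
          ≤ ∫⁻ x in Bᶜ, ENNReal.ofReal (V x * ‖u (φ n) x‖ ^ 2) := by
            refine setLIntegral_mono' hBm.compl fun x hx => ?_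
            rw [ENNReal.ofReal_mul (hV0 x), ENNReal.ofReal_pow (norm_nonneg _), ofReal_norm]
            gcongr
            rw [← ENNReal.ofReal_natCast]
            exact ENNReal.ofReal_le_ofReal (hB hx)
        _ ≤ ∫⁻ x, ENNReal.ofReal (V x * ‖u (φ n) x‖ ^ 2) := setLIntegral_le_lintegral _ _
        _ = ENNReal.ofReal (∫ x, V x * ‖u (φ n) x‖ ^ 2) :=
            (ofReal_integral_eq_lintegral_ofReal (hu _).integrable_potential
              (ae_of_all _ fun x => mul_nonneg (hV0 x) (by positivity))).symm
        _ ≤ k := ENNReal.ofReal_le_ofReal (hP _)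
    have h2 : k ≤ M * δ := by
      exact (ENNReal.div_le_iff_le_mul (Or.inl hδ0.ne') (Or.inr hM0)).1 hM.le
    exact (ENNReal.mul_le_mul_iff_right hM0 (by simp)).1 (h1.trans h2)
  -- inside `B`, mollify at a scale on which all the functions are uniformly close to their averages
  have hsc : Tendsto (fun n => ENNReal.ofReal ((bumpSeq d n).rOut) ^ 2 * k) atTop (𝓝 0) := by
    have h1 := (ENNReal.continuous_pow 2).tendsto _ |>.comp
      (ENNReal.tendsto_ofReal (tendsto_bumpSeq_rOut (d := d)))
    have h2 := ENNReal.Tendsto.mul_const (b := k) h1 (Or.inr hkt)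
    simpa [Function.comp_def] using h2
  obtain ⟨j, hj⟩ := ((ENNReal.tendsto_atTop_zero.1 hsc) δ hδ0)
  set ψ := bumpSeq d j with hψ
  obtain ⟨g, hgm, hg⟩ := tendsto_lintegral_mollify_sub (fun n => (hu (φ n)).memLp) hkt
    (fun n => hm' (φ n)) hw ψ hBc.measure_lt_top.ne
  obtain ⟨N, hN⟩ := (ENNReal.tendsto_atTop_zero.1 hg) δ hδ0
  refine ⟨B.indicator g, (hgm.indicator hBm).aestronglyMeasurable, N, fun n hn => ?_⟩
  rw [← lintegral_add_compl _ hBm]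
  have hin : ∫⁻ x in B, ‖u (φ n) x - B.indicator g x‖ₑ ^ 2 ≤ 2 * (δ + δ) := by
    rw [setLIntegral_congr_fun hBm (g := fun x => ‖u (φ n) x - g x‖ₑ ^ 2)
      fun x hx => by simp only [indicator_of_mem hx]]
    have hul := (hu (φ n)).memLp.locallyIntegrable (by norm_num)
    refine (lintegral_sub_sq_le (g := mollify ψ (u (φ n)))
      (hu _).memLp.aestronglyMeasurable.restrict
      (contDiff_mollify ψ hul).continuous.aestronglyMeasurable).trans ?_
    gcongr
    · refine (setLIntegral_le_lintegral _ _).trans ?_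
      simp_rw [fun x => enorm_sub_rev (u (φ n) x) (mollify ψ (u (φ n)) x)]
      refine (lintegral_mollify_sub_le_gradient ψ hul (hu (φ n)).hasWeakPartial).trans ?_
      exact (mul_le_mul_right (hD' _) _).trans (hj j le_rfl)
    · exact hN n hn
  have hout : ∫⁻ x in Bᶜ, ‖u (φ n) x - B.indicator g x‖ₑ ^ 2 ≤ δ := by
    rw [setLIntegral_congr_fun hBm.compl (g := fun x => ‖u (φ n) x‖ₑ ^ 2)
      fun x hx => by simp only [indicator_of_notMem hx, sub_zero]]
    exact htail n
  calc _ ≤ 2 * (δ + δ) + δ := add_le_add hin hout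
    _ = 5 * δ := by ring
    _ ≤ ε := hδ

/-! ### Integration by parts and the symmetry of the angular momentum -/

/-- Weak derivatives may be tested with complex-valued test functions. -/
theorem IsWeakPartial.integral_complex {i : Fin d} {u v : Pt d → ℂ} (h : IsWeakPartial i u v)
    {ζ : Pt d → ℂ} (hζ : ContDiff ℝ ∞ ζ) (hc : HasCompactSupport ζ) :
    ∫ x, fderiv ℝ ζ x (EuclideanSpace.single i 1) * u x = - ∫ x, ζ x * v x := by
  have hr : ContDiff ℝ ∞ fun x => (ζ x).re := Complex.reCLM.contDiff.comp hζ
  have hi : ContDiff ℝ ∞ fun x => (ζ x).im := Complex.imCLM.contDiff.comp hζ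
  have hrc : HasCompactSupport fun x => (ζ x).re := hc.comp_left (g := Complex.re) rfl
  have hic : HasCompactSupport fun x => (ζ x).im := hc.comp_left (g := Complex.im) rfl
  have hd : ∀ x, DifferentiableAt ℝ ζ x := fun x => hζ.differentiable (by simp) x
  have er : ∀ x y, fderiv ℝ (fun x => (ζ x).re) x y = (fderiv ℝ ζ x y).re := fun x y => by
    rw [show fderiv ℝ (fun x => (ζ x).re) x = _ from
      (Complex.reCLM.hasFDerivAt.comp x (hd x).hasFDerivAt).fderiv]
    simp
  have ei : ∀ x y, fderiv ℝ (fun x => (ζ x).im) x y = (fderiv ℝ ζ x y).im := fun x y => by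
    rw [show fderiv ℝ (fun x => (ζ x).im) x = _ from
      (Complex.imCLM.hasFDerivAt.comp x (hd x).hasFDerivAt).fderiv]
    simp
  have a := h.integral_eq _ hr hrc
  have b := h.integral_eq _ hi hic
  have ai := h.integrable_smul_fun hr hrc
  have bi := h.integrable_smul_fun hi hic
  have ai' := h.integrable_smul_deriv hr hrc
  have bi' := h.integrable_smul_deriv hi hic
  simp only [er, ei] at a b ai bi
  calc ∫ x, fderiv ℝ ζ x (EuclideanSpace.single i 1) * u x
      = ∫ x, ((fderiv ℝ ζ x (EuclideanSpace.single i 1)).re • u x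
          + Complex.I * ((fderiv ℝ ζ x (EuclideanSpace.single i 1)).im • u x)) := by
        refine integral_congr_ae (ae_of_all _ fun x => ?_)
        simp only [Complex.real_smul]
        conv_lhs => rw [← Complex.re_add_im (fderiv ℝ ζ x (EuclideanSpace.single i 1))]
        ring
    _ = - ∫ x, ((ζ x).re • v x + Complex.I * ((ζ x).im • v x)) := by
        rw [integral_add ai (bi.const_mul _), integral_add ai' (bi'.const_mul _),
          integral_const_mul, integral_const_mul, a, b]
        ring
    _ = - ∫ x, ζ x * v x := by
        congr 1
        refine integral_congr_ae (ae_of_all _ fun x => ?_)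
        simp only [Complex.real_smul]
        conv_rhs => rw [← Complex.re_add_im (ζ x)]
        ring

theorem tendsto_eLpNorm_conj_mollify_sub {f : Pt d → ℂ} (hf : MemLp f 2 volume) :
    Tendsto (fun n => eLpNorm ((fun x => conj (mollify (bumpSeq d n) f x)) - fun x => conj (f x))
      2 volume) atTop (𝓝 0) := by
  refine (tendsto_eLpNorm_mollify_sub hf).congr fun n => eLpNorm_congr_norm_ae
    (ae_of_all _ fun x => ?_)
  simp only [Pi.sub_apply]
  rw [← map_sub, RCLike.norm_conj]

theorem memLp_mollify (φ : ContDiffBump (0 : Pt d)) {f : Pt d → ℂ} (hf : MemLp f 2 volume) :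
    MemLp (mollify φ f) 2 volume := by
  refine ⟨(contDiff_mollify φ (hf.locallyIntegrable (by norm_num))).continuous.aestronglyMeasurable,
    ?_⟩
  refine (eLpNorm_two_le_of_lintegral (C := eLpNorm f 2 volume) ?_).trans_lt hf.eLpNorm_lt_top
  rw [eLpNorm_two_sq]
  exact lintegral_mollify_le φ hf.aestronglyMeasurable

/-- The product rule for weak derivatives, tested with `η ∈ C_c^∞`. -/
theorem IsWeakPartial.integral_conj_mul {i : Fin d} {u v u' v' : Pt d → ℂ}
    (hu : IsWeakPartial i u u') (hv : IsWeakPartial i v v') (u2 : MemLp u 2 volume)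
    (u2' : MemLp u' 2 volume) (v2 : MemLp v 2 volume) (v2' : MemLp v' 2 volume)
    {η : Pt d → ℝ} (hη : ContDiff ℝ ∞ η) (hc : HasCompactSupport η) :
    ∫ x, (η x : ℂ) * (v' x * conj (u x) + v x * conj (u' x))
      = - ∫ x, (fderiv ℝ η x (EuclideanSpace.single i 1) : ℂ) * (v x * conj (u x)) := by
  have hbd : ∀ {ρ : Pt d → ℝ}, Continuous ρ → HasCompactSupport ρ → ∀ {w : Pt d → ℂ},
      MemLp w 2 volume → MemLp (fun x => (ρ x : ℂ) * w x) 2 volume := by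
    intro ρ hρ hρc w hw
    obtain ⟨M, hM⟩ := hρc.exists_bound_of_continuous hρ
    refine hw.of_le_mul (c := M) ((Complex.continuous_ofReal.comp hρ).aestronglyMeasurable.mul
      hw.aestronglyMeasurable) (ae_of_all _ fun x => ?_)
    rw [norm_mul, Complex.norm_real]
    exact mul_le_mul_of_nonneg_right (hM x) (norm_nonneg _)
  have hηd : Continuous fun x => fderiv ℝ η x (EuclideanSpace.single i 1) :=
    (hη.continuous_fderiv (by simp)).clm_apply continuous_const
  have hηc : HasCompactSupport fun x => fderiv ℝ η x (EuclideanSpace.single i 1) :=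
    hc.fderiv_apply (𝕜 := ℝ) _
  set m : ℕ → Pt d → ℂ := fun n => mollify (bumpSeq d n) u with hm
  set m' : ℕ → Pt d → ℂ := fun n => mollify (bumpSeq d n) u' with hm'
  have hmc : ∀ n, ContDiff ℝ ∞ (m n) := fun n => contDiff_mollify _ hu.locInt_fun
  have hms : ∀ n, MemLp (fun x => conj (m n x)) 2 volume := fun n => (memLp_mollify _ u2).star
  have hms' : ∀ n, MemLp (fun x => conj (m' n x)) 2 volume := fun n => (memLp_mollify _ u2').star
  have u2c : MemLp (fun x => conj (u x)) 2 volume := u2.star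
  have u2c' : MemLp (fun x => conj (u' x)) 2 volume := u2'.star
  have t1 := tendsto_integral_mul_of_tendsto_eLpNorm (hbd hη.continuous hc v2') u2c hms
    (tendsto_eLpNorm_conj_mollify_sub u2)
  have t2 := tendsto_integral_mul_of_tendsto_eLpNorm (hbd hη.continuous hc v2) u2c' hms'
    (tendsto_eLpNorm_conj_mollify_sub u2')
  have t3 := tendsto_integral_mul_of_tendsto_eLpNorm (hbd hηd hηc v2) u2c hms
    (tendsto_eLpNorm_conj_mollify_sub u2)
  have hint : ∀ {f g : Pt d → ℂ}, MemLp f 2 volume → MemLp g 2 volume →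
      Integrable (fun x => f x * g x) volume := fun hf hg => hf.integrable_mul hg
  have key : ∀ n, (∫ x, (η x : ℂ) * v' x * conj (m n x)) + (∫ x, (η x : ℂ) * v x * conj (m' n x))
      = - ∫ x, (fderiv ℝ η x (EuclideanSpace.single i 1) : ℂ) * v x * conj (m n x) := by
    intro n
    have hζ : ContDiff ℝ ∞ fun x => (η x : ℂ) * conj (m n x) :=
      (Complex.ofRealCLM.contDiff.comp hη).mul (Complex.conjCLE.contDiff.comp (hmc n))
    have hζc : HasCompactSupport fun x => (η x : ℂ) * conj (m n x) :=
      (hc.comp_left (g := fun t : ℝ => (t : ℂ)) (by simp)).mul_right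
    have hd : ∀ x, fderiv ℝ (fun x => (η x : ℂ) * conj (m n x)) x (EuclideanSpace.single i 1)
        = (fderiv ℝ η x (EuclideanSpace.single i 1) : ℂ) * conj (m n x)
          + (η x : ℂ) * conj (m' n x) := by
      intro x
      have h1 : HasFDerivAt (fun x => (η x : ℂ)) (Complex.ofRealCLM ∘L fderiv ℝ η x) x :=
        Complex.ofRealCLM.hasFDerivAt.comp x (hη.differentiable (by simp) x).hasFDerivAt
      have h2 : HasFDerivAt (fun x => conj (m n x))
          ((Complex.conjCLE : ℂ →L[ℝ] ℂ) ∘L fderiv ℝ (m n) x) x :=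
        (Complex.conjCLE : ℂ →L[ℝ] ℂ).hasFDerivAt.comp x
          ((hmc n).differentiable (by simp) x).hasFDerivAt
      rw [show fderiv ℝ (fun x => (η x : ℂ) * conj (m n x)) x = _ from (h1.mul h2).fderiv]
      simp [hm, hm', fderiv_mollify _ hu]
      ring
    have h3 := hv.integral_complex hζ hζc
    simp only [hd] at h3
    have h4 : ∫ x, ((fderiv ℝ η x (EuclideanSpace.single i 1) : ℂ) * conj (m n x)
          + (η x : ℂ) * conj (m' n x)) * v x
        = (∫ x, (fderiv ℝ η x (EuclideanSpace.single i 1) : ℂ) * v x * conj (m n x))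
          + ∫ x, (η x : ℂ) * v x * conj (m' n x) := by
      rw [← integral_add (hint (hbd hηd hηc v2) (hms n)) (hint (hbd hη.continuous hc v2) (hms' n))]
      exact integral_congr_ae (ae_of_all _ fun x => by ring)
    have h5 : ∫ x, (η x : ℂ) * conj (m n x) * v' x = ∫ x, (η x : ℂ) * v' x * conj (m n x) :=
      integral_congr_ae (ae_of_all _ fun x => by ring)
    rw [h4, h5] at h3
    linear_combination h3
  have lim := tendsto_nhds_unique ((t1.add t2).congr key) t3.neg
  calc _ = (∫ x, (η x : ℂ) * v' x * conj (u x)) + ∫ x, (η x : ℂ) * v x * conj (u' x) := by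
        rw [← integral_add (hint (hbd hη.continuous hc v2') u2c)
          (hint (hbd hη.continuous hc v2) u2c')]
        exact integral_congr_ae (ae_of_all _ fun x => by ring)
    _ = _ := lim.trans (by simp_rw [mul_assoc])

/-- Integration by parts in direction `i` against the coordinate weight `x_j`, `j ≠ i`. -/
theorem IsWeakPartial.integral_coord_mul_eq_zero {i j : Fin d} (hij : i ≠ j)
    {u v u' v' : Pt d → ℂ}
    (hu : IsWeakPartial i u u') (hv : IsWeakPartial i v v') (u2 : MemLp u 2 volume)
    (u2' : MemLp u' 2 volume) (v2 : MemLp v 2 volume) (v2' : MemLp v' 2 volume)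
    (h1 : Integrable (fun x => (x j : ℂ) * (v' x * conj (u x))) volume)
    (h2 : Integrable (fun x => (x j : ℂ) * (v x * conj (u' x))) volume) :
    ∫ x, ((x j : ℂ) * (v' x * conj (u x)) + (x j : ℂ) * (v x * conj (u' x))) = 0 := by
  obtain ⟨M, -, hM', hM⟩ := exists_bound_fderiv_cutoff (d := d) i
  set η : ℕ → Pt d → ℝ := fun n x => x j * cutoff d n x with hη
  have hηs : ∀ n, ContDiff ℝ ∞ (η n) := fun n =>
    (EuclideanSpace.proj (𝕜 := ℝ) j : Pt d →L[ℝ] ℝ).contDiff.mul (contDiff_cutoff n)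
  have hηc : ∀ n, HasCompactSupport (η n) := fun n => (hasCompactSupport_cutoff n).mul_left
  have hd : ∀ n x, fderiv ℝ (η n) x (EuclideanSpace.single i 1)
      = x j * fderiv ℝ (cutoff d n) x (EuclideanSpace.single i 1) := by
    intro n x
    have h1 : HasFDerivAt (fun x : Pt d => x j) (EuclideanSpace.proj (𝕜 := ℝ) j : Pt d →L[ℝ] ℝ) x :=
      (EuclideanSpace.proj (𝕜 := ℝ) j : Pt d →L[ℝ] ℝ).hasFDerivAt
    have h2 := ((contDiff_cutoff (d := d) n).differentiable (by simp) x).hasFDerivAt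
    rw [show fderiv ℝ (η n) x = _ from (h1.mul h2).fderiv]
    simp [hij.symm]
  have key := fun n => hu.integral_conj_mul hv u2 u2' v2 v2' (hηs n) (hηc n)
  have huv : Integrable (fun x => v x * conj (u x)) volume := v2.integrable_mul u2.star
  have hvm := v2.aestronglyMeasurable
  have hum := u2.aestronglyMeasurable
  have hvm' := v2'.aestronglyMeasurable
  have hum' := u2'.aestronglyMeasurable
  have L : Tendsto (fun n => ∫ x, (η n x : ℂ) * (v' x * conj (u x) + v x * conj (u' x))) atTop
      (𝓝 (∫ x, ((x j : ℂ) * (v' x * conj (u x)) + (x j : ℂ) * (v x * conj (u' x))))) := by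
    refine tendsto_integral_of_dominated_convergence _ (fun n => ?_) (h1.add h2).norm (fun n => ?_)
      (ae_of_all _ fun x => ?_)
    · exact (Complex.continuous_ofReal.comp (hηs n).continuous).aestronglyMeasurable.mul
        ((hvm'.mul u2.star.aestronglyMeasurable).add (hvm.mul u2'.star.aestronglyMeasurable))
    · refine ae_of_all _ fun x => ?_
      rw [Pi.add_apply, ← mul_add, norm_mul, norm_mul]
      gcongr
      simp only [hη, Complex.norm_real, Real.norm_eq_abs, abs_mul]
      exact mul_le_of_le_one_right (abs_nonneg _) (abs_cutoff_le n x)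
    · rw [← mul_add]
      refine Tendsto.mul_const _ ?_
      refine (Complex.continuous_ofReal.tendsto _).comp ?_
      simpa using (tendsto_cutoff x).const_mul (x j)
  have R : Tendsto (fun n => - ∫ x, (fderiv ℝ (η n) x (EuclideanSpace.single i 1) : ℂ)
      * (v x * conj (u x))) atTop (𝓝 (- ∫ _ : Pt d, (0:ℂ))) := by
    refine Tendsto.neg ?_
    refine tendsto_integral_of_dominated_convergence (fun x => M * ‖v x * conj (u x)‖) (fun n => ?_)
      (huv.norm.const_mul M) (fun n => ?_) (ae_of_all _ fun x => ?_)
    · exact (Complex.continuous_ofReal.comp (((hηs n).continuous_fderiv (by simp)).clm_apply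
        continuous_const)).aestronglyMeasurable.mul (hvm.mul u2.star.aestronglyMeasurable)
    · refine ae_of_all _ fun x => ?_
      rw [norm_mul, Complex.norm_real, hd, Real.norm_eq_abs, abs_mul]
      gcongr
      refine le_trans ?_ (hM n x)
      gcongr
      exact PiLp.norm_apply_le x j
    · have hz : Tendsto (fun n => fderiv ℝ (cutoff d n) x (EuclideanSpace.single i 1)) atTop
          (𝓝 0) := by
        refine squeeze_zero_norm (fun n => hM' n x) ?_
        simpa using (tendsto_one_div_add_atTop_nhds_zero_nat (𝕜 := ℝ)).const_mul M
      have hz2 := ((Complex.continuous_ofReal.tendsto _).comp (hz.const_mul (x j))).mul_const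
        (v x * conj (u x))
      simpa [hd, Function.comp_def] using hz2
  have := tendsto_nhds_unique (L.congr key) R
  simpa using this

/-! ### The rotation term -/

/-- The angular momentum as a function of the position `x` and the gradient `g` at `x`. -/
noncomputable def angJet (x : Pt d) (g : Fin d → ℂ) : ℂ :=
  if h : 2 ≤ d then
    Complex.I * ((x ⟨1, by omega⟩ : ℂ) * g ⟨0, by omega⟩ - (x ⟨0, by omega⟩ : ℂ) * g ⟨1, by omega⟩)
  else 0

theorem Lz_eq_angJet (u : Pt d → ℂ) (x : Pt d) : Lz u x = angJet x fun i => weakPartial i u x := rfl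

theorem angJet_add (x : Pt d) (g h : Fin d → ℂ) : angJet x (g + h) = angJet x g + angJet x h := by
  unfold angJet
  split_ifs
  · simp only [Pi.add_apply]; ring
  · simp

theorem angJet_smul (x : Pt d) (c : ℂ) (g : Fin d → ℂ) : angJet x (c • g) = c * angJet x g := by
  unfold angJet
  split_ifs
  · simp only [Pi.smul_apply, smul_eq_mul]; ring
  · simp

theorem planarSq_nonneg (x : Pt d) : 0 ≤ planarSq x := by
  unfold planarSq
  split_ifs <;> positivity

theorem continuous_angJet (x : Pt d) : Continuous (angJet x) := by
  unfold angJet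
  split_ifs <;> fun_prop

theorem continuous_planarSq : Continuous (planarSq (d := d)) := by
  unfold planarSq
  split_ifs <;> fun_prop

theorem norm_angJet_le (x : Pt d) (g : Fin d → ℂ) :
    ‖angJet x g‖ ≤ √(planarSq x) * √(∑ i, ‖g i‖ ^ 2) := by
  unfold angJet planarSq
  split_ifs with h
  · set i₀ : Fin d := ⟨0, by omega⟩
    set i₁ : Fin d := ⟨1, by omega⟩
    have hne : i₀ ≠ i₁ := by simp [i₀, i₁]
    have hs : ‖g i₀‖ ^ 2 + ‖g i₁‖ ^ 2 ≤ ∑ i, ‖g i‖ ^ 2 := by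
      rw [← Finset.sum_pair (f := fun i => ‖g i‖ ^ 2) hne]
      exact Finset.sum_le_sum_of_subset_of_nonneg (Finset.subset_univ _)
        fun i _ _ => by positivity
    rw [← Real.sqrt_mul (by positivity), norm_mul, Complex.norm_I, one_mul]
    refine Real.le_sqrt_of_sq_le ?_
    have h1 : ‖(x i₁ : ℂ) * g i₀ - (x i₀ : ℂ) * g i₁‖ ≤ |x i₁| * ‖g i₀‖ + |x i₀| * ‖g i₁‖ := by
      refine (norm_sub_le _ _).trans (le_of_eq ?_)
      simp
    calc ‖(x i₁ : ℂ) * g i₀ - (x i₀ : ℂ) * g i₁‖ ^ 2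
        ≤ (|x i₁| * ‖g i₀‖ + |x i₀| * ‖g i₁‖) ^ 2 := by gcongr
      _ ≤ (x i₀ ^ 2 + x i₁ ^ 2) * (‖g i₀‖ ^ 2 + ‖g i₁‖ ^ 2) := by
          rw [← sq_abs (x i₀), ← sq_abs (x i₁)]
          nlinarith [sq_nonneg (|x i₁| * ‖g i₁‖ - |x i₀| * ‖g i₀‖)]
      _ ≤ _ := by gcongr
  · simp

/-- Admissible rotation speeds are subordinate to the potential: the rotation term is dominated,
with a factor `θ < 1`, by the kinetic and potential energy up to a multiple `C` of the mass. -/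
structure Subordinate (V : Pt d → ℝ) (Ω θ C : ℝ) : Prop where
  theta_nonneg : 0 ≤ θ
  theta_lt_one : θ < 1
  const_nonneg : 0 ≤ C
  bound : ∀ x, ∀ s t : ℝ, 0 ≤ s → 0 ≤ t →
    |Ω| * (√(planarSq x) * t) * s ≤ θ * (1 / 2 * t ^ 2 + (V x + C) * s ^ 2)

/-- Any speed `|Ω| < Ω_max` lies below some admissible `γ`, for which Young's inequality gives the
domination with `θ = |Ω| / γ`. -/
theorem exists_subordinate {V : Pt d → ℝ} (hV0 : ∀ x, 0 ≤ V x) {Ω : ℝ}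
    (hΩ : Ω = 0 ∨ (0 < |Ω| ∧ ((|Ω| : ℝ) : EReal) < rotMax V)) :
    ∃ θ C : ℝ, Subordinate V Ω θ C := by
  rcases hΩ with rfl | ⟨hpos, hlt⟩
  · exact ⟨0, 0, le_rfl, one_pos, le_rfl, fun x s t _ _ => by simp⟩
  · unfold rotMax at hlt
    obtain ⟨γ, hγ⟩ := lt_iSup_iff.1 hlt
    obtain ⟨⟨hγ0, hγV⟩, hγΩ⟩ := lt_iSup_iff.1 hγ
    replace hγΩ : |Ω| < γ := by exact_mod_cast hγΩ
    obtain ⟨B, hBc, hB⟩ := mem_cocompact.1 (hγV.eventually_ge_atTop 0)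
    obtain ⟨C, hC⟩ := hBc.exists_bound_of_continuousOn (f := fun x => γ ^ 2 / 2 * planarSq x)
      (by have := continuous_planarSq (d := d); fun_prop)
    -- off a compact set `B` the centrifugal potential is below `V`, on `B` it is bounded
    have hbd : ∀ x, γ ^ 2 / 2 * planarSq x ≤ V x + max C 0 := by
      intro x
      by_cases hx : x ∈ B
      · have := (le_abs_self _).trans (hC x hx)
        linarith [hV0 x, le_max_left C 0]
      · have : 0 ≤ V x - γ ^ 2 / 2 * planarSq x := hB hx
        linarith [le_max_right C 0]
    refine ⟨|Ω| / γ, max C 0, by positivity, (div_lt_one hγ0).2 hγΩ, le_max_right _ _,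
      fun x s t hs ht => ?_⟩
    have h1 : γ * √(planarSq x) * s * t ≤ 1 / 2 * t ^ 2 + (V x + max C 0) * s ^ 2 := by
      have h2 : (γ * √(planarSq x)) ^ 2 = γ ^ 2 * planarSq x := by
        rw [mul_pow, Real.sq_sqrt (planarSq_nonneg x)]
      nlinarith [sq_nonneg (γ * √(planarSq x) * s - t), mul_le_mul_of_nonneg_right (hbd x)
        (sq_nonneg s)]
    calc |Ω| * (√(planarSq x) * t) * s = |Ω| / γ * (γ * √(planarSq x) * s * t) := by
          field_simp
      _ ≤ _ := by gcongr

theorem Subordinate.norm_angJet_mul_le {V : Pt d → ℝ} {Ω θ C : ℝ} (h : Subordinate V Ω θ C)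
    (x : Pt d) (g : Fin d → ℂ) (z : ℂ) :
    |Ω| * ‖angJet x g‖ * ‖z‖ ≤ θ * (1 / 2 * ∑ i, ‖g i‖ ^ 2 + (V x + C) * ‖z‖ ^ 2) := by
  have h1 := h.bound x ‖z‖ (√(∑ i, ‖g i‖ ^ 2)) (norm_nonneg _) (Real.sqrt_nonneg _)
  rw [Real.sq_sqrt (by positivity)] at h1
  refine le_trans ?_ h1
  gcongr
  exact norm_angJet_le x g

theorem MemX.integrable_gradient {V : Pt d → ℝ} {u : Pt d → ℂ} (hu : MemX V u) :
    Integrable (fun x => ∑ i, ‖weakPartial i u x‖ ^ 2) volume :=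
  integrable_finsetSum _ fun i _ => by
    simpa using (hu.memLp_weakPartial i).integrable_norm_pow (by norm_num)

theorem MemX.integrable_sq {V : Pt d → ℝ} {u : Pt d → ℂ} (hu : MemX V u) :
    Integrable (fun x => ‖u x‖ ^ 2) volume := by
  simpa using hu.memLp.integrable_norm_pow (by norm_num)

theorem MemX.aestronglyMeasurable_Lz {V : Pt d → ℝ} {u : Pt d → ℂ} (hu : MemX V u) :
    AEStronglyMeasurable (Lz u) volume := by
  unfold Lz
  split_ifs with h
  · have hc : ∀ j : Fin d, AEStronglyMeasurable (fun x : Pt d => (x j : ℂ)) volume := fun j =>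
      Continuous.aestronglyMeasurable (by fun_prop)
    exact (((hc _).mul (hu.memLp_weakPartial _).aestronglyMeasurable).sub
      ((hc _).mul (hu.memLp_weakPartial _).aestronglyMeasurable)).const_mul _
  · exact aestronglyMeasurable_const

section

variable {V : Pt d → ℝ} {Ω θ C : ℝ} {u v : Pt d → ℂ}

/-- The dominating function for all rotation terms. -/
theorem integrable_subordinate_bound (hu : MemX V u) (hv : MemX V v) :
    Integrable (fun x => θ * (1 / 2 * ∑ i, ‖weakPartial i u x‖ ^ 2 + (V x + C) * ‖v x‖ ^ 2))
      volume := by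
  refine ((hu.integrable_gradient.const_mul _).add ?_).const_mul _
  simp_rw [add_mul]
  exact hv.integrable_potential.add (hv.integrable_sq.const_mul _)

theorem Subordinate.integrable_rot (h : Subordinate V Ω θ C) (hu : MemX V u) (hv : MemX V v) :
    Integrable (fun x => (Ω : ℂ) * (Lz u x * conj (v x))) volume := by
  have hm : AEStronglyMeasurable (fun x => (Ω : ℂ) * (Lz u x * conj (v x))) volume :=
    (hu.aestronglyMeasurable_Lz.mul hv.memLp.star.aestronglyMeasurable).const_mul (Ω : ℂ)
  refine (integrable_subordinate_bound (θ := θ) (C := C) hu hv).mono' hm (ae_of_all _ fun x => ?_)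
  have h1 := h.norm_angJet_mul_le x (fun i => weakPartial i u x) (v x)
  rw [← Lz_eq_angJet, mul_assoc] at h1
  rwa [norm_mul, norm_mul, RCLike.norm_conj, Complex.norm_real, Real.norm_eq_abs]

/-- `L_z` is symmetric on `X`. The factor `Ω` stays in the statement because for `Ω = 0` nothing
controls `x_j ∂_i u` and the integrals may diverge. -/
theorem Subordinate.integral_Lz_symm (h : Subordinate V Ω θ C) (hu : MemX V u) (hv : MemX V v) :
    (Ω : ℂ) * ∫ x, Lz u x * conj (v x) = (Ω : ℂ) * conj (∫ x, Lz v x * conj (u x)) := by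
  rcases eq_or_ne Ω 0 with rfl | hΩ
  · simp
  by_cases hd : 2 ≤ d
  swap
  · simp [Lz, hd]
  have hΩ' : (Ω : ℂ) ≠ 0 := by exact_mod_cast hΩ
  congr 1
  set i₀ : Fin d := ⟨0, by omega⟩
  set i₁ : Fin d := ⟨1, by omega⟩
  have hne : i₀ ≠ i₁ := by simp [i₀, i₁]
  have hint : ∀ {u v : Pt d → ℂ}, MemX V u → MemX V v → ∀ i j : Fin d, (j = i₀ ∨ j = i₁) →
      Integrable (fun x => (x j : ℂ) * (weakPartial i u x * conj (v x))) volume := by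
    intro u v hu hv i j hj
    refine ((integrable_subordinate_bound (θ := θ) (C := C) hu hv).const_mul (|Ω|⁻¹)).mono'
      ((Continuous.aestronglyMeasurable (by fun_prop)).mul
        ((hu.memLp_weakPartial i).aestronglyMeasurable.mul hv.memLp.star.aestronglyMeasurable))
      (ae_of_all _ fun x => ?_)
    have h1 := h.bound x ‖v x‖ (√(∑ i, ‖weakPartial i u x‖ ^ 2)) (norm_nonneg _)
      (Real.sqrt_nonneg _)
    rw [Real.sq_sqrt (by positivity)] at h1
    have hpos : 0 < |Ω| := abs_pos.2 hΩ
    rw [← div_eq_inv_mul, le_div_iff₀ hpos]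
    refine le_trans ?_ h1
    have h2 : ‖(x j : ℂ)‖ ≤ √(planarSq x) := by
      rw [Complex.norm_real, Real.norm_eq_abs]
      refine Real.abs_le_sqrt ?_
      simp only [planarSq, hd, dif_pos]
      rcases hj with rfl | rfl
      · exact le_add_of_nonneg_right (sq_nonneg _)
      · exact le_add_of_nonneg_left (sq_nonneg _)
    have h3 : ‖weakPartial i u x‖ ≤ √(∑ i, ‖weakPartial i u x‖ ^ 2) := by
      refine Real.le_sqrt_of_sq_le ?_
      exact Finset.single_le_sum (f := fun i => ‖weakPartial i u x‖ ^ 2)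
        (fun i _ => by positivity) (Finset.mem_univ i)
    rw [norm_mul, norm_mul, RCLike.norm_conj]
    calc ‖(x j : ℂ)‖ * (‖weakPartial i u x‖ * ‖v x‖) * |Ω|
        ≤ √(planarSq x) * (√(∑ i, ‖weakPartial i u x‖ ^ 2) * ‖v x‖) * |Ω| := by gcongr
      _ = _ := by ring
  have hint' : ∀ {u v : Pt d → ℂ}, MemX V u → MemX V v → ∀ i j : Fin d, (j = i₀ ∨ j = i₁) →
      Integrable (fun x => (x j : ℂ) * (u x * conj (weakPartial i v x))) volume := by
    intro u v hu hv i j hj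
    refine (Complex.conjLIE.toContinuousLinearEquiv.integrable_comp_iff.2
      (hint hv hu i j hj)).congr (ae_of_all _ fun x => ?_)
    simp [mul_comm]
  have e0 := (hv.hasWeakPartial i₀).integral_coord_mul_eq_zero hne (hu.hasWeakPartial i₀) hv.memLp
    (hv.memLp_weakPartial _) hu.memLp (hu.memLp_weakPartial _) (hint hu hv i₀ i₁ (Or.inr rfl))
    (hint' hu hv i₀ i₁ (Or.inr rfl))
  have e1 := (hv.hasWeakPartial i₁).integral_coord_mul_eq_zero hne.symm (hu.hasWeakPartial i₁)
    hv.memLp (hv.memLp_weakPartial _) hu.memLp (hu.memLp_weakPartial _)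
    (hint hu hv i₁ i₀ (Or.inl rfl)) (hint' hu hv i₁ i₀ (Or.inl rfl))
  rw [← integral_conj, ← sub_eq_zero, ← integral_sub]
  · have e : ∀ x, Lz u x * conj (v x) - conj (Lz v x * conj (u x))
        = Complex.I * ((x i₁ : ℂ) * (weakPartial i₀ u x * conj (v x))
            + (x i₁ : ℂ) * (u x * conj (weakPartial i₀ v x)))
          - Complex.I * ((x i₀ : ℂ) * (weakPartial i₁ u x * conj (v x))
            + (x i₀ : ℂ) * (u x * conj (weakPartial i₁ v x))) := by
      intro x
      simp only [Lz, hd, dif_pos, map_mul, map_sub, Complex.conj_I, Complex.conj_ofReal,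
        Complex.conj_conj]
      ring
    simp_rw [e]
    rw [integral_sub, integral_const_mul, integral_const_mul, e0, e1]
    · simp
    · exact ((hint hu hv i₀ i₁ (Or.inr rfl)).add (hint' hu hv i₀ i₁ (Or.inr rfl))).const_mul _
    · exact ((hint hu hv i₁ i₀ (Or.inl rfl)).add (hint' hu hv i₁ i₀ (Or.inl rfl))).const_mul _
  · simpa [hΩ'] using (h.integrable_rot hu hv).const_mul (Ω : ℂ)⁻¹
  · refine Complex.conjLIE.toContinuousLinearEquiv.integrable_comp_iff.2 ?_
    simpa [hΩ'] using (h.integrable_rot hv hu).const_mul (Ω : ℂ)⁻¹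

end

/-! ### The quadratic form -/

/-- The integrand of the quadratic form of `-½ Δ + V - Ω L_z + c`, as a function of the position
`x`, the gradient `g` and the value `z`. -/
noncomputable def jetForm (V : Pt d → ℝ) (Ω c : ℝ) (x : Pt d) (g : Fin d → ℂ) (z : ℂ) : ℝ :=
  1 / 2 * ∑ i, ‖g i‖ ^ 2 + V x * ‖z‖ ^ 2 - ((Ω : ℂ) * (angJet x g * conj z)).re + c * ‖z‖ ^ 2

/-- The real polarization of `jetForm`. -/
noncomputable def jetCross (V : Pt d → ℝ) (Ω c : ℝ) (x : Pt d) (g : Fin d → ℂ) (z : ℂ)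
    (h : Fin d → ℂ) (w : ℂ) : ℝ :=
  (1 / 2 * ∑ i, g i * conj (h i)).re + ((V x : ℂ) * z * conj w).re
    - 1 / 2 * (((Ω : ℂ) * (angJet x g * conj w)).re + ((Ω : ℂ) * (angJet x h * conj z)).re)
    + ((c : ℂ) * (z * conj w)).re

theorem norm_add_smul_sq (a b : ℂ) (t : ℝ) :
    ‖a + t * b‖ ^ 2 = ‖a‖ ^ 2 + 2 * t * (a * conj b).re + t ^ 2 * ‖b‖ ^ 2 := by
  simp only [← Complex.normSq_eq_norm_sq, Complex.normSq_apply, Complex.add_re, Complex.add_im,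
    Complex.mul_re, Complex.mul_im, Complex.conj_re, Complex.conj_im, Complex.ofReal_re,
    Complex.ofReal_im]
  ring

/-- `jetForm` is a real quadratic form with polarization `jetCross`. -/
theorem jetForm_add_smul (V : Pt d → ℝ) (Ω c : ℝ) (x : Pt d) (g h : Fin d → ℂ) (z w : ℂ) (t : ℝ) :
    jetForm V Ω c x (g + (t : ℂ) • h) (z + t * w)
      = jetForm V Ω c x g z + 2 * t * jetCross V Ω c x g z h w + t ^ 2 * jetForm V Ω c x h w := by
  have h1 : ∑ i, ‖(g + (t : ℂ) • h) i‖ ^ 2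
      = ∑ i, ‖g i‖ ^ 2 + 2 * t * (∑ i, g i * conj (h i)).re + t ^ 2 * ∑ i, ‖h i‖ ^ 2 := by
    simp only [Pi.add_apply, Pi.smul_apply, smul_eq_mul, norm_add_smul_sq, Complex.re_sum,
      Finset.sum_add_distrib, Finset.mul_sum]
  have h2 : ((Ω : ℂ) * (angJet x (g + (t : ℂ) • h) * conj (z + t * w))).re
      = ((Ω : ℂ) * (angJet x g * conj z)).re
        + t * (((Ω : ℂ) * (angJet x g * conj w)).re + ((Ω : ℂ) * (angJet x h * conj z)).re)
        + t ^ 2 * ((Ω : ℂ) * (angJet x h * conj w)).re := by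
    rw [angJet_add, angJet_smul, map_add, map_mul, Complex.conj_ofReal]
    simp only [← Complex.re_ofReal_mul, ← Complex.add_re]
    congr 1
    push_cast
    ring
  have h3 : ((V x : ℂ) * z * conj w).re = V x * (z * conj w).re := by
    rw [mul_assoc, Complex.re_ofReal_mul]
  have h4 : (1 / 2 * ∑ i, g i * conj (h i)).re = 1 / 2 * (∑ i, g i * conj (h i)).re := by
    rw [← Complex.re_ofReal_mul]; norm_num
  rw [jetForm, jetForm, jetForm, jetCross, h1, h2, h3, h4, norm_add_smul_sq,
    Complex.re_ofReal_mul c]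
  ring

/-- With the shift `C`, the form density controls the kinetic and potential energy densities. -/
theorem Subordinate.le_jetForm {V : Pt d → ℝ} {Ω θ C : ℝ} (h : Subordinate V Ω θ C) (x : Pt d)
    (g : Fin d → ℂ) (z : ℂ) :
    (1 - θ) * (1 / 2 * ∑ i, ‖g i‖ ^ 2 + V x * ‖z‖ ^ 2) ≤ jetForm V Ω C x g z := by
  have h1 := h.norm_angJet_mul_le x g z
  have h2 : ((Ω : ℂ) * (angJet x g * conj z)).re ≤ |Ω| * ‖angJet x g‖ * ‖z‖ := by
    refine (Complex.re_le_norm _).trans (le_of_eq ?_)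
    rw [norm_mul, norm_mul, RCLike.norm_conj, Complex.norm_real, Real.norm_eq_abs, mul_assoc]
  have h3 : θ * (C * ‖z‖ ^ 2) ≤ C * ‖z‖ ^ 2 :=
    mul_le_of_le_one_left (mul_nonneg h.const_nonneg (by positivity)) h.theta_lt_one.le
  unfold jetForm
  nlinarith

section

variable {V : Pt d → ℝ} {Ω θ C : ℝ} {u v : Pt d → ℂ}

theorem MemX.integrable_gradient_mul (hu : MemX V u) (hv : MemX V v) :
    Integrable (fun x => ∑ i, weakPartial i u x * conj (weakPartial i v x)) volume :=
  integrable_finsetSum _ fun i _ =>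
    (hu.memLp_weakPartial i).integrable_mul (hv.memLp_weakPartial i).star

theorem MemX.integrable_mul (hu : MemX V u) (hv : MemX V v) :
    Integrable (fun x => u x * conj (v x)) volume :=
  hu.memLp.integrable_mul hv.memLp.star

theorem MemX.integrable_potential_mul (hVm : AEMeasurable V volume) (hV0 : ∀ x, 0 ≤ V x)
    (hu : MemX V u) (hv : MemX V v) :
    Integrable (fun x => (V x : ℂ) * u x * conj (v x)) volume := by
  have hm : AEStronglyMeasurable (fun x => (V x : ℂ) * u x * conj (v x)) volume :=
    ((Complex.measurable_ofReal.comp_aemeasurable hVm).aestronglyMeasurable.mul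
      hu.memLp.aestronglyMeasurable).mul hv.memLp.star.aestronglyMeasurable
  refine (hu.integrable_potential.add hv.integrable_potential).mono' hm (ae_of_all _ fun x => ?_)
  rw [norm_mul, norm_mul, RCLike.norm_conj, Complex.norm_real, Real.norm_of_nonneg (hV0 x)]
  simp only [Pi.add_apply]
  have h1 : ‖u x‖ * ‖v x‖ ≤ ‖u x‖ ^ 2 + ‖v x‖ ^ 2 := by
    nlinarith [sq_nonneg (‖u x‖ - ‖v x‖), sq_nonneg (‖u x‖), sq_nonneg (‖v x‖)]
  nlinarith [mul_le_mul_of_nonneg_left h1 (hV0 x)]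

theorem Subordinate.integrable_jetForm (h : Subordinate V Ω θ C) (hu : MemX V u) (c : ℝ) :
    Integrable (fun x => jetForm V Ω c x (fun i => weakPartial i u x) (u x)) volume :=
  (((hu.integrable_gradient.const_mul _).add hu.integrable_potential).sub
    (h.integrable_rot hu hu).re).add (hu.integrable_sq.const_mul c)

theorem Subordinate.integral_jetForm (h : Subordinate V Ω θ C) (hu : MemX V u) (c : ℝ) :
    ∫ x, jetForm V Ω c x (fun i => weakPartial i u x) (u x) = quadForm V Ω u + c * mass u := by
  have e : (∫ x, ((Ω : ℂ) * (Lz u x * conj (u x))).re) = - rotTerm Ω u := by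
    rw [← RCLike.re_eq_complex_re, integral_re (h.integrable_rot hu hu), integral_const_mul,
      RCLike.re_eq_complex_re, Complex.re_ofReal_mul, rotTerm]
    simp_rw [mul_comm (conj (u _))]
    ring
  have h1 := hu.integrable_gradient.const_mul (1 / 2)
  have h2 := hu.integrable_potential
  have h3 : Integrable (fun x => ((Ω : ℂ) * (Lz u x * conj (u x))).re) volume :=
    (h.integrable_rot hu hu).re
  have h4 := hu.integrable_sq.const_mul c
  have h5 : Integrable (fun x => 1 / 2 * ∑ i, ‖weakPartial i u x‖ ^ 2 + V x * ‖u x‖ ^ 2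
    - ((Ω : ℂ) * (Lz u x * conj (u x))).re) volume := (h1.add h2).sub h3
  calc ∫ x, jetForm V Ω c x (fun i => weakPartial i u x) (u x)
      = ∫ x, (1 / 2 * ∑ i, ‖weakPartial i u x‖ ^ 2 + V x * ‖u x‖ ^ 2
          - ((Ω : ℂ) * (Lz u x * conj (u x))).re + c * ‖u x‖ ^ 2) := rfl
    _ = _ := by
      rw [integral_add h5 h4, integral_sub (h1.fun_add h2) h3, integral_add h1 h2, e,
        integral_const_mul, integral_const_mul, quadForm, mass]
      ring

/-- The sesquilinear form of `-½ Δ + V - Ω L_z + c`. -/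
noncomputable def sesqForm (V : Pt d → ℝ) (Ω c : ℝ) (u v : Pt d → ℂ) : ℂ :=
  1 / 2 * (∫ x, ∑ i, weakPartial i u x * conj (weakPartial i v x))
    + (∫ x, (V x : ℂ) * u x * conj (v x)) - (Ω : ℂ) * (∫ x, Lz u x * conj (v x))
    + (c : ℂ) * (∫ x, u x * conj (v x))

theorem Subordinate.integrable_jetCross (h : Subordinate V Ω θ C) (hVm : AEMeasurable V volume)
    (hV0 : ∀ x, 0 ≤ V x) (hu : MemX V u) (hv : MemX V v) (c : ℝ) :
    Integrable (fun x => jetCross V Ω c x (fun i => weakPartial i u x) (u x)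
      (fun i => weakPartial i v x) (v x)) volume :=
  ((((hu.integrable_gradient_mul hv).const_mul (1 / 2)).re.add
    (hu.integrable_potential_mul hVm hV0 hv).re).sub
      (((h.integrable_rot hu hv).re.add (h.integrable_rot hv hu).re).const_mul (1 / 2))).add
    ((hu.integrable_mul hv).const_mul (c : ℂ)).re

theorem Subordinate.integral_jetCross (h : Subordinate V Ω θ C) (hVm : AEMeasurable V volume)
    (hV0 : ∀ x, 0 ≤ V x) (hu : MemX V u) (hv : MemX V v) (c : ℝ) :
    ∫ x, jetCross V Ω c x (fun i => weakPartial i u x) (u x) (fun i => weakPartial i v x) (v x)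
      = (sesqForm V Ω c u v).re := by
  have h1 := (hu.integrable_gradient_mul hv).const_mul (1 / 2)
  have h2 := hu.integrable_potential_mul hVm hV0 hv
  have h3 := h.integrable_rot hu hv
  have h4 := h.integrable_rot hv hu
  have h5 := (hu.integrable_mul hv).const_mul (c : ℂ)
  have r1 : Integrable (fun x => (1 / 2 * ∑ i, weakPartial i u x
    * conj (weakPartial i v x)).re) volume := h1.re
  have r2 : Integrable (fun x => ((V x : ℂ) * u x * conj (v x)).re) volume := h2.re
  have r3 : Integrable (fun x => ((Ω : ℂ) * (Lz u x * conj (v x))).re) volume := h3.re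
  have r4 : Integrable (fun x => ((Ω : ℂ) * (Lz v x * conj (u x))).re) volume := h4.re
  have r5 : Integrable (fun x => ((c : ℂ) * (u x * conj (v x))).re) volume := h5.re
  have r6 : Integrable (fun x => (1 / 2 * ∑ i, weakPartial i u x * conj (weakPartial i v x)).re
      + ((V x : ℂ) * u x * conj (v x)).re
      - 1 / 2 * (((Ω : ℂ) * (Lz u x * conj (v x))).re + ((Ω : ℂ) * (Lz v x * conj (u x))).re))
      volume := (r1.add r2).sub ((r3.add r4).const_mul _)
  have hre : ∀ {f : Pt d → ℂ}, Integrable f volume → ∫ x, (f x).re = (∫ x, f x).re :=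
    fun hf => integral_re hf
  have hs : ((Ω : ℂ) * ∫ x, Lz v x * conj (u x)).re = ((Ω : ℂ) * ∫ x, Lz u x * conj (v x)).re := by
    rw [h.integral_Lz_symm hv hu, Complex.re_ofReal_mul, Complex.re_ofReal_mul, Complex.conj_re]
  calc _ = ∫ x, ((1 / 2 * ∑ i, weakPartial i u x * conj (weakPartial i v x)).re
          + ((V x : ℂ) * u x * conj (v x)).re
          - 1 / 2 * (((Ω : ℂ) * (Lz u x * conj (v x))).re + ((Ω : ℂ) * (Lz v x * conj (u x))).re)
          + ((c : ℂ) * (u x * conj (v x))).re) := rfl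
    _ = _ := by
      rw [integral_add r6 r5,
        integral_sub (r1.fun_add r2) ((r3.fun_add r4).const_mul _), integral_add r1 r2,
        integral_const_mul, integral_add r3 r4, hre h1, hre h2, hre h3, hre h4, hre h5,
        integral_const_mul, integral_const_mul, integral_const_mul, integral_const_mul, hs,
        sesqForm, Complex.add_re, Complex.sub_re, Complex.add_re]
      ring

/-- The jets of `u + t v`. -/
theorem MemX.ae_jet_add_smul (hu : MemX V u) (hv : MemX V v) (t : ℝ) :
    ∀ᵐ x, (fun i => weakPartial i (u + (t : ℂ) • v) x)
      = (fun i => weakPartial i u x) + (t : ℂ) • fun i => weakPartial i v x := by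
  have h1 : ∀ i, ∀ᵐ x, weakPartial i (u + (t : ℂ) • v) x
      = weakPartial i u x + (t : ℂ) * weakPartial i v x := fun i => by
    filter_upwards [hu.weakPartial_add (hv.smul (t : ℂ)) i, hv.weakPartial_smul (t : ℂ) i]
      with x h1 h2
    rw [h1, Pi.add_apply, h2]
    rfl
  filter_upwards [ae_all_iff.2 h1] with x hx
  funext i
  exact hx i

/-- The quadratic part of the action along a line; the symmetry of `L_z` turns the linear term into
the real part of the sesquilinear form. -/
theorem Subordinate.quadForm_add_smul (h : Subordinate V Ω θ C) (hVm : AEMeasurable V volume)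
    (hV0 : ∀ x, 0 ≤ V x) (hu : MemX V u) (hv : MemX V v) (c t : ℝ) :
    quadForm V Ω (u + (t : ℂ) • v) + c * mass (u + (t : ℂ) • v)
      = (quadForm V Ω u + c * mass u) + 2 * t * (sesqForm V Ω c u v).re
        + t ^ 2 * (quadForm V Ω v + c * mass v) := by
  rw [← h.integral_jetForm (hu.add hVm hV0 (hv.smul _)), ← h.integral_jetForm hu,
    ← h.integral_jetForm hv, ← h.integral_jetCross hVm hV0 hu hv]
  have i1 := h.integrable_jetForm hu c
  have i2 := h.integrable_jetForm hv c
  have i3 := h.integrable_jetCross hVm hV0 hu hv c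
  rw [← integral_const_mul, ← integral_const_mul, ← integral_add i1 (i3.const_mul _),
    ← integral_add (i1.fun_add (i3.const_mul _)) (i2.const_mul _)]
  refine integral_congr_ae ?_
  filter_upwards [hu.ae_jet_add_smul hv t] with x hx
  rw [hx]
  exact jetForm_add_smul V Ω c x _ _ (u x) (v x) t

theorem Subordinate.le_quadForm (h : Subordinate V Ω θ C) (hu : MemX V u) :
    (1 - θ) * (1 / 2 * (∫ x, ∑ i, ‖weakPartial i u x‖ ^ 2) + ∫ x, V x * ‖u x‖ ^ 2)
      ≤ quadForm V Ω u + C * mass u := by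
  have i1 := hu.integrable_gradient.const_mul (1 / 2)
  rw [← h.integral_jetForm hu, ← integral_const_mul, ← integral_add i1 hu.integrable_potential,
    ← integral_const_mul]
  exact integral_mono ((i1.add hu.integrable_potential).const_mul _) (h.integrable_jetForm hu C)
    fun x => h.le_jetForm x _ _

end

end

/-! ### Compactness of minimizing sequences -/

/-- The standing assumptions on the dimension, the nonlinearity, the potential and the rotation,
the latter through constants `θ` and `C` of subordination. -/
structure Admissible (V : Pt d → ℝ) (p β Ω θ C : ℝ) : Prop where
  one_le_dim : 1 ≤ d
  one_lt : 1 < p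
  subcritical : 3 ≤ d → p < ((d : ℝ) + 2) / ((d : ℝ) - 2)
  beta_pos : 0 < β
  aemeasurable : AEMeasurable V volume
  nonneg : ∀ x, 0 ≤ V x
  confining : Tendsto V (cocompact (Pt d)) atTop
  subordinate : Subordinate V Ω θ C

theorem integral_norm_sq_eq {α : Type*} [MeasurableSpace α] {μ : Measure α} {f : α → ℂ}
    (hf : MemLp f 2 μ) : ∫ x, ‖f x‖ ^ 2 ∂μ = (eLpNorm f 2 μ).toReal ^ 2 := by
  rw [← ENNReal.toReal_pow, eLpNorm_two_sq, lintegral_enorm_sq_eq hf,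
    ENNReal.toReal_ofReal (by positivity)]

theorem tendsto_integral_norm_sq {α : Type*} [MeasurableSpace α] {μ : Measure α}
    {F : ℕ → α → ℂ} {f : α → ℂ} (hF : ∀ n, MemLp (F n) 2 μ) (hf : MemLp f 2 μ)
    (h : Tendsto (fun n => eLpNorm (F n - f) 2 μ) atTop (𝓝 0)) :
    Tendsto (fun n => ∫ x, ‖F n x‖ ^ 2 ∂μ) atTop (𝓝 (∫ x, ‖f x‖ ^ 2 ∂μ)) := by
  have hT : Tendsto (fun n => (hF n).toLp (F n)) atTop (𝓝 (hf.toLp f)) :=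
    (Lp.tendsto_Lp_iff_tendsto_eLpNorm'' F hF f hf).2 h
  have := (hT.norm).pow 2
  simpa only [Lp.norm_toLp, ← integral_norm_sq_eq hf, ← integral_norm_sq_eq (hF _)] using this

theorem tendsto_integral_norm_sub_sq {α : Type*} [MeasurableSpace α] {μ : Measure α}
    {F : ℕ → α → ℂ} {f : α → ℂ} (hF : ∀ n, MemLp (F n) 2 μ) (hf : MemLp f 2 μ)
    (h : Tendsto (fun n => eLpNorm (F n - f) 2 μ) atTop (𝓝 0)) :
    Tendsto (fun n => ∫ x, ‖F n x - f x‖ ^ 2 ∂μ) atTop (𝓝 0) := by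
  have h1 := ((ENNReal.tendsto_toReal ENNReal.zero_ne_top).comp h).pow 2
  have h2 : ∀ n, ∫ x, ‖F n x - f x‖ ^ 2 ∂μ = (eLpNorm (F n - f) 2 μ).toReal ^ 2 :=
    fun n => integral_norm_sq_eq ((hF n).sub hf)
  simpa [h2, Function.comp_def] using h1

/-- Fatou's lemma for convergent Bochner integrals of nonnegative functions. -/
theorem integrable_and_integral_le_of_ae_tendsto {α : Type*} [MeasurableSpace α] {μ : Measure α}
    {F : ℕ → α → ℝ} {f : α → ℝ} {L : ℝ} (hF : ∀ n, Integrable (F n) μ)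
    (hF0 : ∀ n x, 0 ≤ F n x) (h : ∀ᵐ x ∂μ, Tendsto (fun n => F n x) atTop (𝓝 (f x)))
    (hL : Tendsto (fun n => ∫ x, F n x ∂μ) atTop (𝓝 L)) : Integrable f μ ∧ ∫ x, f x ∂μ ≤ L := by
  have hm : AEStronglyMeasurable f μ :=
    aestronglyMeasurable_of_tendsto_ae atTop (fun n => (hF n).aestronglyMeasurable) h
  have hf0 : 0 ≤ᵐ[μ] f := h.mono fun x hx => ge_of_tendsto' hx fun n => hF0 n x
  have hL0 : 0 ≤ L := ge_of_tendsto' hL fun n => integral_nonneg (hF0 n)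
  have key : ∫⁻ x, ENNReal.ofReal (f x) ∂μ ≤ ENNReal.ofReal L := by
    calc ∫⁻ x, ENNReal.ofReal (f x) ∂μ
        = ∫⁻ x, liminf (fun n => ENNReal.ofReal (F n x)) atTop ∂μ :=
          lintegral_congr_ae (h.mono fun x hx => ((ENNReal.tendsto_ofReal hx).liminf_eq).symm)
      _ ≤ liminf (fun n => ∫⁻ x, ENNReal.ofReal (F n x) ∂μ) atTop :=
          lintegral_liminf_le' fun n => (hF n).aestronglyMeasurable.aemeasurable.ennreal_ofReal
      _ = liminf (fun n => ENNReal.ofReal (∫ x, F n x ∂μ)) atTop := by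
          simp_rw [fun n => ofReal_integral_eq_lintegral_ofReal (hF n) (ae_of_all μ (hF0 n))]
      _ = ENNReal.ofReal L := (ENNReal.tendsto_ofReal hL).liminf_eq
  have hi : Integrable f μ :=
    ⟨hm, (hasFiniteIntegral_iff_ofReal hf0).2 (key.trans_lt ENNReal.ofReal_lt_top)⟩
  refine ⟨hi, ?_⟩
  rw [← ofReal_integral_eq_lintegral_ofReal hi hf0] at key
  exact (ENNReal.ofReal_le_ofReal_iff hL0).1 key

/-- Finitely many `L²`-convergent sequences converge almost everywhere along a common
subsequence. -/
theorem exists_subseq_ae_tendsto {ι : Type*} [Fintype ι] {W : ι → ℕ → Pt d → ℂ}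
    {g : ι → Pt d → ℂ} (hW : ∀ i n, MemLp (W i n) 2 volume) (hg2 : ∀ i, MemLp (g i) 2 volume)
    (hg : ∀ i, Tendsto (fun n => eLpNorm (W i n - g i) 2 volume) atTop (𝓝 0)) :
    ∃ ψ : ℕ → ℕ, StrictMono ψ ∧
      ∀ᵐ x, ∀ i, Tendsto (fun n => W i (ψ n) x) atTop (𝓝 (g i x)) := by
  set h : ℕ → Pt d → ℝ := fun n x => ∑ i, ‖W i n x - g i x‖ ^ 2 with hh
  have hi1 : ∀ n i, Integrable (fun x => ‖W i n x - g i x‖ ^ 2) volume := fun n i => by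
    simpa using ((hW i n).sub (hg2 i)).integrable_norm_pow (by norm_num)
  have hint : ∀ n, Integrable (h n) volume := fun n => integrable_finsetSum _ fun i _ => hi1 n i
  have hh0 : Tendsto (fun n => ∫ x, h n x) atTop (𝓝 0) := by
    have h1 : ∀ n, ∫ x, h n x = ∑ i, ∫ x, ‖W i n x - g i x‖ ^ 2 := fun n =>
      integral_finsetSum _ fun i _ => hi1 n i
    simp_rw [h1]
    have h2 := tendsto_finsetSum Finset.univ fun i _ =>
      tendsto_integral_norm_sub_sq (hW i) (hg2 i) (hg i)
    simpa using h2
  have hmeas : TendstoInMeasure volume h atTop (fun _ => 0) := by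
    refine tendstoInMeasure_of_tendsto_eLpNorm one_ne_zero
      (fun n => (hint n).aestronglyMeasurable) aestronglyMeasurable_const ?_
    have h1 := ENNReal.tendsto_ofReal hh0
    rw [ENNReal.ofReal_zero] at h1
    refine h1.congr fun n => ?_
    rw [eLpNorm_one_eq_lintegral_enorm, ofReal_integral_eq_lintegral_ofReal (hint n)
      (ae_of_all _ fun x => by positivity)]
    refine lintegral_congr fun x => ?_
    simp only [Pi.sub_apply, sub_zero]
    rw [← ofReal_norm, Real.norm_of_nonneg (by positivity)]
  obtain ⟨ψ, hψ, hae⟩ := hmeas.exists_seq_tendsto_ae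
  refine ⟨ψ, hψ, hae.mono fun x hx i => ?_⟩
  rw [tendsto_iff_norm_sub_tendsto_zero]
  refine squeeze_zero (g := fun n => √(h (ψ n) x)) (fun n => norm_nonneg _)
    (fun n => Real.le_sqrt_of_sq_le ?_) ?_
  · exact Finset.single_le_sum (f := fun j => ‖W j (ψ n) x - g j x‖ ^ 2)
      (fun j _ => by positivity) (Finset.mem_univ i)
  · simpa [Function.comp_def] using (Real.continuous_sqrt.tendsto 0).comp hx

theorem continuous_jetForm (V : Pt d → ℝ) (Ω c : ℝ) (x : Pt d) :
    Continuous fun q : (Fin d → ℂ) × ℂ => jetForm V Ω c x q.1 q.2 := by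
  have hang := continuous_angJet x
  unfold jetForm
  fun_prop

theorem tendsto_jetForm (V : Pt d → ℝ) (Ω c : ℝ) (x : Pt d) {G : ℕ → Fin d → ℂ} {g : Fin d → ℂ}
    {Z : ℕ → ℂ} {z : ℂ} (hG : Tendsto G atTop (𝓝 g)) (hZ : Tendsto Z atTop (𝓝 z)) :
    Tendsto (fun n => jetForm V Ω c x (G n) (Z n)) atTop (𝓝 (jetForm V Ω c x g z)) := by
  have h := (continuous_jetForm V Ω c x).tendsto (g, z)
  have h2 := h.comp (hG.prodMk_nhds hZ)
  simpa only [Function.comp_def] using h2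

namespace Admissible

variable {V : Pt d → ℝ} {p β Ω θ C : ℝ} {u v : Pt d → ℂ}

theorem integrable_rpow (H : Admissible V p β Ω θ C) (hu : MemX V u) :
    Integrable (fun x => ‖u x‖ ^ (p + 1)) volume :=
  hu.integrable_rpow H.one_le_dim H.one_lt H.subcritical

theorem add_smul (H : Admissible V p β Ω θ C) (hu : MemX V u) (hv : MemX V v) (c : ℂ) :
    MemX V (u + c • v) :=
  hu.add H.aemeasurable H.nonneg (hv.smul c)

theorem coeff_pos (H : Admissible V p β Ω θ C) : 0 < 2 * β / (p + 1) :=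
  div_pos (mul_pos two_pos H.beta_pos) (by linarith [H.one_lt])

/-- Any multiple of the mass density is controlled by the potential and the nonlinearity, up to a
compactly supported bounded error. -/
theorem exists_mass_bound (H : Admissible V p β Ω θ C) {A κ : ℝ} (hA : 0 ≤ A) (hκ : 0 < κ) :
    ∃ K : ℝ, ∀ u, MemX V u →
      A * mass u ≤ κ * (∫ x, V x * ‖u x‖ ^ 2) + 2 * β / (p + 1) * (∫ x, ‖u x‖ ^ (p + 1)) + K := by
  set b := 2 * β / (p + 1) with hb
  have hb0 : 0 < b := H.coeff_pos
  have hp := H.one_lt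
  obtain ⟨B, hBc, hB⟩ := mem_cocompact.1 (H.confining.eventually_ge_atTop (A / κ))
  have hBm : MeasurableSet B := hBc.isClosed.measurableSet
  -- above the threshold `T` the nonlinearity dominates
  set T : ℝ := (A / b) ^ (1 / (p - 1)) with hT
  have hT0 : 0 ≤ T := by positivity
  have hTp : T ^ (p - 1) = A / b := by
    rw [hT, ← Real.rpow_mul (by positivity), one_div_mul_cancel (by linarith), Real.rpow_one]
  have pt : ∀ x (t : ℝ), 0 ≤ t →
      A * t ^ 2 ≤ κ * (V x * t ^ 2) + b * t ^ (p + 1) + B.indicator (fun _ => A * T ^ 2) x := by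
    intro x t ht
    have hn : 0 ≤ b * t ^ (p + 1) := by positivity
    have hn2 : 0 ≤ κ * (V x * t ^ 2) := by have := H.nonneg x; positivity
    by_cases hx : x ∈ B
    · rw [indicator_of_mem hx]
      rcases le_total t T with h | h
      · have : A * t ^ 2 ≤ A * T ^ 2 := by gcongr
        linarith
      · have h1 : A ≤ b * t ^ (p - 1) := by
          have : A / b ≤ t ^ (p - 1) := hTp ▸ Real.rpow_le_rpow hT0 h (by linarith)
          rwa [div_le_iff₀' hb0] at this
        have h2 : t ^ (p + 1) = t ^ (p - 1) * t ^ 2 := by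
          rcases eq_or_lt_of_le ht with rfl | ht'
          · rw [Real.zero_rpow (by linarith)]; simp
          · rw [← Real.rpow_natCast t 2, ← Real.rpow_add ht']
            norm_num
            ring_nf
        have h3 : 0 ≤ A * T ^ 2 := by positivity
        rw [h2]
        nlinarith [mul_le_mul_of_nonneg_right h1 (sq_nonneg t)]
    · rw [indicator_of_notMem hx]
      have h1 : A / κ ≤ V x := hB hx
      rw [div_le_iff₀' hκ] at h1
      nlinarith [mul_le_mul_of_nonneg_right h1 (sq_nonneg t)]
  refine ⟨∫ x, B.indicator (fun _ => A * T ^ 2) x, fun u hu => ?_⟩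
  have i1 := hu.integrable_potential.const_mul κ
  have i2 := (H.integrable_rpow hu).const_mul b
  have i3 : Integrable (B.indicator fun _ : Pt d => A * T ^ 2) volume :=
    (integrable_indicator_iff hBm).2 (integrableOn_const hBc.measure_lt_top.ne)
  rw [mass, ← integral_const_mul, ← integral_const_mul, ← integral_const_mul,
    ← integral_add i1 i2, ← integral_add (i1.fun_add i2) i3]
  exact integral_mono (hu.integrable_sq.const_mul A) ((i1.fun_add i2).add i3)
    fun x => pt x _ (norm_nonneg _)

/-- The action is coercive on `X`. -/
theorem exists_coercive (H : Admissible V p β Ω θ C) (ω : ℝ) :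
    ∃ K : ℝ, ∀ u, MemX V u →
      (1 - θ) / 2 * ((∫ x, ∑ i, ‖weakPartial i u x‖ ^ 2) + ∫ x, V x * ‖u x‖ ^ 2) + mass u
        ≤ action V p β Ω ω u + K := by
  have hθ := H.subordinate.theta_lt_one
  obtain ⟨K, hK⟩ := H.exists_mass_bound (A := |C - ω| + 1) (κ := (1 - θ) / 2) (by positivity)
    (by linarith)
  refine ⟨K, fun u hu => ?_⟩
  have h1 := hK u hu
  have h2 := H.subordinate.le_quadForm hu
  have h3 : 0 ≤ mass u := integral_nonneg fun x => by positivity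
  have h4 := mul_le_mul_of_nonneg_right (le_abs_self (C - ω)) h3
  unfold action energy
  linarith

theorem bddBelow (H : Admissible V p β Ω θ C) (ω : ℝ) :
    BddBelow (action V p β Ω ω '' {u | MemX V u}) := by
  obtain ⟨K, hK⟩ := H.exists_coercive ω
  refine ⟨-K, ?_⟩
  rintro _ ⟨u, hu, rfl⟩
  have h1 := hK u hu
  have h2 : 0 ≤ mass u := integral_nonneg fun x => by positivity
  have h3 : 0 ≤ ∫ x, ∑ i, ‖weakPartial i u x‖ ^ 2 := integral_nonneg fun x => by positivity
  have h4 : 0 ≤ ∫ x, V x * ‖u x‖ ^ 2 :=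
    integral_nonneg fun x => mul_nonneg (H.nonneg x) (by positivity)
  have h5 : 0 ≤ (1 - θ) / 2 := by linarith [H.subordinate.theta_lt_one]
  nlinarith [mul_nonneg h5 (add_nonneg h3 h4)]

theorem groundAction_le (H : Admissible V p β Ω θ C) (ω : ℝ) (hu : MemX V u) :
    groundAction V p β Ω ω ≤ action V p β Ω ω u :=
  csInf_le (H.bddBelow ω) ⟨u, hu, rfl⟩

/-- Uniform convexity of the action in the gradient, up to a multiple of the mass: by the
parallelogram identity, near-minimizers that are close in `L²` have close gradients. -/
theorem gradient_sub_le (H : Admissible V p β Ω θ C) (ω : ℝ) (hu : MemX V u) (hv : MemX V v) :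
    (1 - θ) / 8 * (∫ x, ∑ i, ‖weakPartial i v x - weakPartial i u x‖ ^ 2)
      ≤ 1 / 2 * (action V p β Ω ω u - groundAction V p β Ω ω)
        + 1 / 2 * (action V p β Ω ω v - groundAction V p β Ω ω)
        + |C - ω| / 4 * ∫ x, ‖v x - u x‖ ^ 2 := by
  have hp := H.one_lt
  set k : Pt d → ℂ := v + ((-1 : ℝ) : ℂ) • u with hk
  have hkX : MemX V k := H.add_smul hv hu _
  have hkv : ∀ x, k x = v x - u x := fun x => by simp [hk, sub_eq_add_neg]
  have huv : u + ((1 : ℝ) : ℂ) • k = v := by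
    funext x
    simp [hkv]
  set w : Pt d → ℂ := u + ((1 / 2 : ℝ) : ℂ) • k with hw
  have hwX : MemX V w := H.add_smul hu hkX _
  have e1 := H.subordinate.quadForm_add_smul H.aemeasurable H.nonneg hu hkX ω 1
  have e2 := H.subordinate.quadForm_add_smul H.aemeasurable H.nonneg hu hkX ω (1 / 2)
  rw [huv] at e1
  rw [← hw] at e2
  have hN : ∫ x, ‖w x‖ ^ (p + 1)
      ≤ 1 / 2 * (∫ x, ‖u x‖ ^ (p + 1)) + 1 / 2 * ∫ x, ‖v x‖ ^ (p + 1) := by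
    have i1 := (H.integrable_rpow hu).const_mul (1 / 2)
    have i2 := (H.integrable_rpow hv).const_mul (1 / 2)
    rw [← integral_const_mul, ← integral_const_mul, ← integral_add i1 i2]
    refine integral_mono (H.integrable_rpow hwX) (i1.add i2) fun x => ?_
    have h1 : ‖w x‖ ≤ 1 / 2 * ‖u x‖ + 1 / 2 * ‖v x‖ := by
      have : w x = (1 / 2 : ℂ) * u x + (1 / 2 : ℂ) * v x := by
        simp only [hw, Pi.add_apply, Pi.smul_apply, hkv, smul_eq_mul]
        push_cast
        ring
      rw [this]
      refine (norm_add_le _ _).trans (le_of_eq ?_)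
      simp
    refine (Real.rpow_le_rpow (norm_nonneg _) h1 (by linarith)).trans ?_
    exact (convexOn_rpow (p := p + 1) (by linarith)).2 (norm_nonneg (u x)) (norm_nonneg (v x))
      (by norm_num : (0:ℝ) ≤ 1 / 2) (by norm_num : (0:ℝ) ≤ 1 / 2) (by norm_num)
  have hg : ∫ x, ∑ i, ‖weakPartial i k x‖ ^ 2
      = ∫ x, ∑ i, ‖weakPartial i v x - weakPartial i u x‖ ^ 2 := by
    refine integral_congr_ae ?_
    filter_upwards [hv.ae_jet_add_smul hu (-1)] with x hx
    refine Finset.sum_congr rfl fun i _ => ?_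
    rw [congrFun hx i]
    simp [sub_eq_add_neg]
  have hm : mass k = ∫ x, ‖v x - u x‖ ^ 2 := by simp only [mass, hkv]
  have hP : 0 ≤ ∫ x, V x * ‖k x‖ ^ 2 :=
    integral_nonneg fun x => mul_nonneg (H.nonneg x) (by positivity)
  have h2 := H.subordinate.le_quadForm hkX
  have h3 : 0 ≤ mass k := integral_nonneg fun x => by positivity
  have h4 := mul_le_mul_of_nonneg_right (le_abs_self (C - ω)) h3
  have h5 := H.groundAction_le ω hwX
  have h6 := mul_le_mul_of_nonneg_left hN H.coeff_pos.le
  have h7 : 0 ≤ (1 - θ) := by linarith [H.subordinate.theta_lt_one]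
  have h8 := mul_nonneg h7 hP
  rw [← hg, ← hm]
  unfold action energy at h5 ⊢
  linarith

/-- Minimizing sequences are bounded in `X`, hence relatively compact in `L²`. -/
theorem exists_subseq_tendsto_L2 (H : Admissible V p β Ω θ C) (ω : ℝ) {u : ℕ → Pt d → ℂ}
    (hu : ∀ n, MemX V (u n))
    (hlim : Tendsto (fun n => action V p β Ω ω (u n)) atTop (𝓝 (groundAction V p β Ω ω))) :
    ∃ φ : ℕ → ℕ, StrictMono φ ∧ ∃ f : Pt d → ℂ, MemLp f 2 volume ∧
      Tendsto (fun n => eLpNorm (u (φ n) - f) 2 volume) atTop (𝓝 0) := by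
  have hθ : 0 < 1 - θ := by linarith [H.subordinate.theta_lt_one]
  obtain ⟨K, hK⟩ := H.exists_coercive ω
  obtain ⟨S, hS⟩ := hlim.bddAbove_range
  have hS' : ∀ n, action V p β Ω ω (u n) ≤ S := fun n => hS ⟨n, rfl⟩
  have hM : ∀ n, 0 ≤ mass (u n) := fun n => integral_nonneg fun x => by positivity
  have hD : ∀ n, 0 ≤ ∫ x, ∑ i, ‖weakPartial i (u n) x‖ ^ 2 :=
    fun n => integral_nonneg fun x => by positivity
  have hP : ∀ n, 0 ≤ ∫ x, V x * ‖u n x‖ ^ 2 := fun n =>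
    integral_nonneg fun x => mul_nonneg (H.nonneg x) (by positivity)
  have hB : ∀ n, (∫ x, ∑ i, ‖weakPartial i (u n) x‖ ^ 2) + (∫ x, V x * ‖u n x‖ ^ 2)
      ≤ (S + K) / ((1 - θ) / 2) := fun n => by
    rw [le_div_iff₀' (by positivity)]
    linarith [hK _ (hu n), hS' n, hM n]
  refine exists_subseq_tendsto_eLpNorm H.nonneg H.confining hu
    (K := max (S + K) ((S + K) / ((1 - θ) / 2))) (fun n => ?_) (fun n => ?_) fun n => ?_
  · refine le_trans ?_ (le_max_left _ _)
    have : 0 ≤ (1 - θ) / 2 * ((∫ x, ∑ i, ‖weakPartial i (u n) x‖ ^ 2)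
      + ∫ x, V x * ‖u n x‖ ^ 2) := mul_nonneg (by positivity) (add_nonneg (hD n) (hP n))
    linarith [hK _ (hu n), hS' n]
  · exact le_trans (by linarith [hB n, hP n]) (le_max_right _ _)
  · exact le_trans (by linarith [hB n, hD n]) (le_max_right _ _)

/-- Along an `L²`-convergent minimizing sequence, the gradients converge in `L²`. -/
theorem exists_tendsto_gradient (H : Admissible V p β Ω θ C) (ω : ℝ) {w : ℕ → Pt d → ℂ}
    (hwX : ∀ n, MemX V (w n))
    (hlim : Tendsto (fun n => action V p β Ω ω (w n)) atTop (𝓝 (groundAction V p β Ω ω)))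
    {f : Pt d → ℂ} (hf2 : MemLp f 2 volume)
    (hf : Tendsto (fun n => eLpNorm (w n - f) 2 volume) atTop (𝓝 0)) (i : Fin d) :
    ∃ g : Pt d → ℂ, MemLp g 2 volume ∧
      Tendsto (fun n => eLpNorm (weakPartial i (w n) - g) 2 volume) atTop (𝓝 0) := by
  have hθ : 0 < 1 - θ := by linarith [H.subordinate.theta_lt_one]
  have he := tendsto_integral_norm_sub_sq (fun n => (hwX n).memLp) hf2 hf
  -- the gradients form a Cauchy sequence
  set s : ℕ → ℝ := fun n => ((1 - θ) / 8)⁻¹ * (1 / 2 * (action V p β Ω ω (w n)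
    - groundAction V p β Ω ω) + |C - ω| / 2 * ∫ x, ‖w n x - f x‖ ^ 2) with hs
  have hs0 : Tendsto s atTop (𝓝 0) := by
    have := (((hlim.sub_const (groundAction V p β Ω ω)).const_mul (1 / 2)).add
      (he.const_mul (|C - ω| / 2))).const_mul ((1 - θ) / 8)⁻¹
    simpa [hs] using this
  have hgrad : ∀ n m, ∫ x, ∑ i, ‖weakPartial i (w n) x - weakPartial i (w m) x‖ ^ 2
      ≤ s n + s m := by
    intro n m
    have h1 := H.gradient_sub_le ω (hwX m) (hwX n)
    have h2 : ∫ x, ‖w n x - w m x‖ ^ 2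
        ≤ 2 * (∫ x, ‖w n x - f x‖ ^ 2) + 2 * ∫ x, ‖w m x - f x‖ ^ 2 := by
      have hi : ∀ n, Integrable (fun x => ‖w n x - f x‖ ^ 2) volume := fun n => by
        simpa using ((hwX n).memLp.sub hf2).integrable_norm_pow (by norm_num)
      have hi2 : Integrable (fun x => ‖w n x - w m x‖ ^ 2) volume := by
        simpa using ((hwX n).memLp.sub (hwX m).memLp).integrable_norm_pow (by norm_num)
      rw [← integral_const_mul, ← integral_const_mul,
        ← integral_add ((hi n).const_mul 2) ((hi m).const_mul 2)]
      refine integral_mono hi2 (((hi n).const_mul 2).add ((hi m).const_mul 2)) fun x => ?_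
      have h3 : ‖w n x - w m x‖ ≤ ‖w n x - f x‖ + ‖w m x - f x‖ := by
        rw [show w n x - w m x = (w n x - f x) - (w m x - f x) by ring]
        exact norm_sub_le _ _
      simp only
      nlinarith [norm_nonneg (w n x - w m x), sq_nonneg (‖w n x - f x‖ - ‖w m x - f x‖)]
    have h3 := mul_le_mul_of_nonneg_left h2 (by positivity : 0 ≤ |C - ω| / 4)
    rw [hs]
    simp only
    rw [← mul_add, ← div_eq_inv_mul, le_div_iff₀' (by positivity)]
    linarith
  refine exists_tendsto_eLpNorm_of_cauchy (fun n => (hwX n).memLp_weakPartial i) fun ε hε => ?_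
  have h1 := ENNReal.tendsto_ofReal hs0
  rw [ENNReal.ofReal_zero] at h1
  obtain ⟨N, hN⟩ := (ENNReal.tendsto_atTop_zero.1 h1) (ε / 2) (ENNReal.half_pos hε.ne')
  refine ⟨N, fun n hn m hm => ?_⟩
  have hL := ((hwX n).memLp_weakPartial i).sub ((hwX m).memLp_weakPartial i)
  have hi : ∀ i, Integrable (fun x => ‖weakPartial i (w n) x - weakPartial i (w m) x‖ ^ 2)
      volume := fun i => by
    simpa using (((hwX n).memLp_weakPartial i).sub
      ((hwX m).memLp_weakPartial i)).integrable_norm_pow (by norm_num)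
  calc ∫⁻ x, ‖weakPartial i (w n) x - weakPartial i (w m) x‖ₑ ^ 2
      = ENNReal.ofReal (∫ x, ‖weakPartial i (w n) x - weakPartial i (w m) x‖ ^ 2) :=
        lintegral_enorm_sq_eq hL
    _ ≤ ENNReal.ofReal (s n + s m) := by
        refine ENNReal.ofReal_le_ofReal (le_trans ?_ (hgrad n m))
        refine integral_mono (hi i) (integrable_finsetSum _ fun j _ => hi j) fun x => ?_
        exact Finset.single_le_sum
          (f := fun j => ‖weakPartial j (w n) x - weakPartial j (w m) x‖ ^ 2)
          (fun j _ => by positivity) (Finset.mem_univ i)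
    _ ≤ ENNReal.ofReal (s n) + ENNReal.ofReal (s m) := ENNReal.ofReal_add_le
    _ ≤ ε / 2 + ε / 2 := add_le_add (hN n hn) (hN m hm)
    _ = ε := ENNReal.add_halves ε

/-- Lower semicontinuity of the action along sequences whose jets converge almost everywhere and
whose masses converge. -/
theorem action_le_of_ae_tendsto (H : Admissible V p β Ω θ C) (ω : ℝ) {w : ℕ → Pt d → ℂ}
    (hwX : ∀ n, MemX V (w n)) {L : ℝ}
    (hlim : Tendsto (fun n => action V p β Ω ω (w n)) atTop (𝓝 L))
    {f : Pt d → ℂ} {g : Fin d → Pt d → ℂ} (hf2 : MemLp f 2 volume)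
    (hg2 : ∀ i, MemLp (g i) 2 volume) (hfg : ∀ i, IsWeakPartial i f (g i))
    (hae0 : ∀ᵐ x, Tendsto (fun n => w n x) atTop (𝓝 (f x)))
    (hae : ∀ᵐ x, ∀ i, Tendsto (fun n => weakPartial i (w n) x) atTop (𝓝 (g i x)))
    (hmass : Tendsto (fun n => mass (w n)) atTop (𝓝 (mass f))) :
    MemX V f ∧ action V p β Ω ω f ≤ L := by
  have hθ : 0 < 1 - θ := by linarith [H.subordinate.theta_lt_one]
  -- Fatou's lemma for the energy density, made nonnegative by the shift `C`
  set b := 2 * β / (p + 1) with hb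
  have hb0 : 0 < b := H.coeff_pos
  have hp := H.one_lt
  have hFn : ∀ {u}, MemX V u → ∫ x, (jetForm V Ω C x (fun i => weakPartial i u x) (u x)
      + b * ‖u x‖ ^ (p + 1)) = action V p β Ω ω u + (C - ω) * mass u := by
    intro u hu
    rw [integral_add (H.subordinate.integrable_jetForm hu C) ((H.integrable_rpow hu).const_mul _),
      H.subordinate.integral_jetForm hu, integral_const_mul, action, energy]
    ring
  have hnn : ∀ x (G : Fin d → ℂ) z, 0 ≤ jetForm V Ω C x G z := fun x G z => by
    refine le_trans ?_ (H.subordinate.le_jetForm x G z)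
    have := H.nonneg x
    positivity
  obtain ⟨hFi, hFle⟩ := integrable_and_integral_le_of_ae_tendsto
    (F := fun n x => jetForm V Ω C x (fun i => weakPartial i (w n) x) (w n x)
      + b * ‖w n x‖ ^ (p + 1))
    (f := fun x => jetForm V Ω C x (fun i => g i x) (f x) + b * ‖f x‖ ^ (p + 1))
    (L := L + (C - ω) * mass f) (μ := volume)
    (fun n => (H.subordinate.integrable_jetForm (hwX _) C).add
      ((H.integrable_rpow (hwX _)).const_mul _))
    (fun n x => add_nonneg (hnn _ _ _) (by positivity)) (by
      filter_upwards [hae0, hae] with x hx0 hx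
      have c2 : Tendsto (fun n => fun i => weakPartial i (w n) x) atTop
          (𝓝 fun i => g i x) := tendsto_pi_nhds.2 hx
      have t1 : Tendsto (fun n => jetForm V Ω C x (fun i => weakPartial i (w n) x) (w n x)) atTop
          (𝓝 (jetForm V Ω C x (fun i => g i x) (f x))) :=
        tendsto_jetForm V Ω C x c2 hx0
      have t2 : Tendsto (fun n => b * ‖w n x‖ ^ (p + 1)) atTop (𝓝 (b * ‖f x‖ ^ (p + 1))) :=
        (hx0.norm.rpow_const (Or.inr (by linarith))).const_mul b
      exact t1.add t2)
    (by
      simp_rw [fun n => hFn (hwX n)]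
      exact hlim.add (hmass.const_mul _))
  have hfX : MemX V f := by
    refine MemX.of_isWeakPartial hf2 hfg hg2 ?_
    refine (hFi.const_mul (1 - θ)⁻¹).mono' (H.aemeasurable.aestronglyMeasurable.mul
      (hf2.aestronglyMeasurable.norm.pow 2)) (ae_of_all _ fun x => ?_)
    have h1 := H.subordinate.le_jetForm x (fun i => g i x) (f x)
    have h2 : 0 ≤ b * ‖f x‖ ^ (p + 1) := by positivity
    have h3 : 0 ≤ 1 / 2 * ∑ i, ‖g i x‖ ^ 2 := by positivity
    rw [Real.norm_of_nonneg (mul_nonneg (H.nonneg x) (by positivity)), ← div_eq_inv_mul,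
      le_div_iff₀' hθ]
    nlinarith [mul_nonneg hθ.le h3]
  refine ⟨hfX, ?_⟩
  have h1 : ∫ x, (jetForm V Ω C x (fun i => weakPartial i f x) (f x) + b * ‖f x‖ ^ (p + 1))
      = ∫ x, (jetForm V Ω C x (fun i => g i x) (f x) + b * ‖f x‖ ^ (p + 1)) := by
    refine integral_congr_ae ?_
    filter_upwards [ae_all_iff.2 fun i => (hfg i).weakPartial_ae_eq] with x hx
    simp only [hx]
  rw [hFn hfX] at h1
  linarith

/-- Minimizing sequences for the action are relatively compact: along a subsequence the masses
converge to the mass of a minimizer. -/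
theorem exists_subseq_minimizer (H : Admissible V p β Ω θ C) (ω : ℝ) {u : ℕ → Pt d → ℂ}
    (hu : ∀ n, MemX V (u n))
    (hlim : Tendsto (fun n => action V p β Ω ω (u n)) atTop (𝓝 (groundAction V p β Ω ω))) :
    ∃ φ : ℕ → ℕ, StrictMono φ ∧ ∃ f, MemX V f ∧
      action V p β Ω ω f = groundAction V p β Ω ω ∧
      Tendsto (fun n => mass (u (φ n))) atTop (𝓝 (mass f)) := by
  obtain ⟨φ, hφ, f, hf2, hf⟩ := H.exists_subseq_tendsto_L2 ω hu hlim
  set w : ℕ → Pt d → ℂ := fun n => u (φ n) with hw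
  have hwX : ∀ n, MemX V (w n) := fun n => hu _
  have hwlim := hlim.comp hφ.tendsto_atTop
  choose g hg2 hg using H.exists_tendsto_gradient ω hwX hwlim hf2 hf
  have hfg : ∀ i, IsWeakPartial i f (g i) := fun i =>
    IsWeakPartial.of_tendsto (fun n => (hwX n).hasWeakPartial i) (fun n => (hwX n).memLp)
      (fun n => (hwX n).memLp_weakPartial i) hf2 (hg2 i) hf (hg i)
  obtain ⟨ψ, hψ, hae0, hae⟩ : ∃ ψ : ℕ → ℕ, StrictMono ψ ∧
      (∀ᵐ x, Tendsto (fun n => w (ψ n) x) atTop (𝓝 (f x))) ∧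
      ∀ᵐ x, ∀ i, Tendsto (fun n => weakPartial i (w (ψ n)) x) atTop (𝓝 (g i x)) := by
    obtain ⟨ψ, hψ, h⟩ := exists_subseq_ae_tendsto (ι := Option (Fin d))
      (W := fun o n => o.elim (w n) fun i => weakPartial i (w n)) (g := fun o => o.elim f g)
      (by rintro (_ | i) n; exacts [(hwX n).memLp, (hwX n).memLp_weakPartial i])
      (by rintro (_ | i); exacts [hf2, hg2 i]) (by rintro (_ | i); exacts [hf, hg i])
    exact ⟨ψ, hψ, h.mono fun x hx => hx none, h.mono fun x hx i => hx (some i)⟩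
  have hmass : Tendsto (fun n => mass (w n)) atTop (𝓝 (mass f)) :=
    tendsto_integral_norm_sq (fun n => (hwX n).memLp) hf2 hf
  obtain ⟨hfX, hle⟩ := H.action_le_of_ae_tendsto ω (w := fun n => w (ψ n)) (fun n => hwX _)
    (hwlim.comp hψ.tendsto_atTop) hf2 hg2 hfg hae0 hae (hmass.comp hψ.tendsto_atTop)
  exact ⟨φ, hφ, f, hfX, le_antisymm hle (H.groundAction_le ω hfX), hmass⟩

end Admissible

/-! ### The Euler-Lagrange equation -/

/-- Derivative of `t ↦ |a + t b|^(p+1)`. -/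
theorem hasDerivAt_norm_rpow_line {p : ℝ} (hp : 1 < p) (a b : ℂ) (t : ℝ) :
    HasDerivAt (fun t : ℝ => ‖a + t * b‖ ^ (p + 1))
      ((p + 1) * (‖a + t * b‖ ^ (p - 1) * ((a + t * b) * conj b).re)) t := by
  have h1 : HasDerivAt (fun t : ℝ => a + (t : ℂ) * b) b t := by
    simpa using ((hasDerivAt_id t).ofReal_comp.mul_const b).const_add a
  have h2 := (hasFDerivAt_norm_rpow (a + t * b) (p := p + 1) (by linarith)).comp_hasDerivAt t h1
  refine h2.congr_deriv ?_
  rw [_root_.smul_apply, innerSL_apply_apply, Complex.inner, smul_eq_mul,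
    show p + 1 - 2 = p - 1 by ring]
  have : (b * conj (a + t * b)).re = ((a + t * b) * conj b).re := by
    rw [← Complex.conj_re (b * _), map_mul, Complex.conj_conj, mul_comm]
  rw [this]
  ring

theorem rpow_add_le_two_rpow {p : ℝ} (hp : 1 < p) {a b : ℝ} (ha : 0 ≤ a) (hb : 0 ≤ b) :
    (a + b) ^ (p + 1) ≤ 2 ^ (p + 1) * (a ^ (p + 1) + b ^ (p + 1)) := by
  have h1 : a + b ≤ 2 * max a b := by
    rw [two_mul]; exact add_le_add (le_max_left _ _) (le_max_right _ _)
  calc (a + b) ^ (p + 1) ≤ (2 * max a b) ^ (p + 1) := by gcongr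
    _ = 2 ^ (p + 1) * max a b ^ (p + 1) := Real.mul_rpow (by norm_num) (le_max_of_le_left ha)
    _ ≤ _ := by
      gcongr
      rcases max_cases a b with ⟨h, -⟩ | ⟨h, -⟩ <;> rw [h]
      · exact le_add_of_nonneg_right (by positivity)
      · exact le_add_of_nonneg_left (by positivity)

/-- The bound that dominates the `t`-derivative of `|u + t v|^(p+1)`, uniformly in `|t| ≤ 1`. -/
theorem norm_nonlinearity_le {p : ℝ} (hp : 1 < p) (a b : ℂ) {t : ℝ} (ht : |t| ≤ 1) :
    ‖a + t * b‖ ^ (p - 1) * (‖a + t * b‖ * ‖b‖) ≤ (‖a‖ + ‖b‖) ^ (p + 1) := by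
  have h1 : ‖a + t * b‖ ≤ ‖a‖ + ‖b‖ := by
    refine (norm_add_le _ _).trans ?_
    gcongr
    rw [norm_mul, Complex.norm_real, Real.norm_eq_abs]
    exact mul_le_of_le_one_left (norm_nonneg _) ht
  have h2 : ‖b‖ ≤ ‖a‖ + ‖b‖ := le_add_of_nonneg_left (norm_nonneg _)
  have h0 : 0 ≤ ‖a‖ + ‖b‖ := by positivity
  calc ‖a + t * b‖ ^ (p - 1) * (‖a + t * b‖ * ‖b‖)
      ≤ (‖a‖ + ‖b‖) ^ (p - 1) * ((‖a‖ + ‖b‖) * (‖a‖ + ‖b‖)) := by gcongr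
    _ = (‖a‖ + ‖b‖) ^ (p + 1) := by
      rcases eq_or_lt_of_le h0 with h | h
      · rw [← h, Real.zero_rpow (by linarith : p + 1 ≠ 0)]; simp
      · rw [← sq, ← Real.rpow_natCast _ 2, ← Real.rpow_add h]
        norm_num
        ring_nf

/-- The left-hand side of the weak form of the stationary equation for `u`, tested with `v`. -/
noncomputable def weakForm (V : Pt d → ℝ) (p β Ω ω : ℝ) (u v : Pt d → ℂ) : ℂ :=
  sesqForm V Ω ω u v + (β : ℂ) * ∫ x, ((‖u x‖ ^ (p - 1) : ℝ) : ℂ) * u x * conj (v x)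

theorem sesqForm_smul_right {V : Pt d → ℝ} {Ω : ℝ} {u v : Pt d → ℂ} (ω : ℝ)
    (hv : MemX V v) (c : ℂ) :
    sesqForm V Ω ω u (c • v) = conj c * sesqForm V Ω ω u v := by
  have e1 : ∫ x, ∑ i, weakPartial i u x * conj (weakPartial i (c • v) x)
      = conj c * ∫ x, ∑ i, weakPartial i u x * conj (weakPartial i v x) := by
    rw [← integral_const_mul]
    refine integral_congr_ae ?_
    filter_upwards [ae_all_iff.2 fun i => hv.weakPartial_smul c i] with x hx
    rw [Finset.mul_sum]
    refine Finset.sum_congr rfl fun i _ => ?_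
    rw [hx i, Pi.smul_apply, smul_eq_mul, map_mul]
    ring
  have e : ∀ f : Pt d → ℂ, ∫ x, f x * conj ((c • v) x) = conj c * ∫ x, f x * conj (v x) := by
    intro f
    rw [← integral_const_mul]
    refine integral_congr_ae (ae_of_all _ fun x => ?_)
    simp only [Pi.smul_apply, smul_eq_mul, map_mul]
    ring
  rw [sesqForm, e1, e, e, e, sesqForm]
  ring

theorem weakForm_smul_right {V : Pt d → ℝ} {p β Ω : ℝ} {u v : Pt d → ℂ} (ω : ℝ)
    (hv : MemX V v) (c : ℂ) :
    weakForm V p β Ω ω u (c • v) = conj c * weakForm V p β Ω ω u v := by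
  have e : ∫ x, ((‖u x‖ ^ (p - 1) : ℝ) : ℂ) * u x * conj ((c • v) x)
      = conj c * ∫ x, ((‖u x‖ ^ (p - 1) : ℝ) : ℂ) * u x * conj (v x) := by
    rw [← integral_const_mul]
    refine integral_congr_ae (ae_of_all _ fun x => ?_)
    simp only [Pi.smul_apply, smul_eq_mul, map_mul]
    ring
  rw [weakForm, weakForm, sesqForm_smul_right ω hv, e]
  ring

theorem action_eq_zero_of_ae_eq_zero {V : Pt d → ℝ} {p β Ω : ℝ} {u : Pt d → ℂ} (hp : 1 < p) (ω : ℝ)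
    (hu : u =ᵐ[volume] 0) : action V p β Ω ω u = 0 := by
  have h : ∀ i : Fin d, IsWeakPartial i (0 : Pt d → ℂ) 0 := fun i =>
    ⟨locallyIntegrable_zero, locallyIntegrable_zero, fun η _ _ => by simp⟩
  have h0 : ∀ᵐ x, ∀ i : Fin d, weakPartial i u x = 0 :=
    ae_all_iff.2 fun i => ((h i).congr hu.symm EventuallyEq.rfl).weakPartial_ae_eq
  have hp' : p + 1 ≠ 0 := by linarith
  have e1 : ∫ x : Pt d, ∑ i, ‖weakPartial i u x‖ ^ 2 = 0 :=
    integral_eq_zero_of_ae (h0.mono fun x hx => by simp [hx])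
  have e2 : ∫ x, V x * ‖u x‖ ^ 2 = 0 := integral_eq_zero_of_ae (hu.mono fun x hx => by simp [hx])
  have e3 : ∫ x, conj (u x) * Lz u x = 0 :=
    integral_eq_zero_of_ae (hu.mono fun x hx => by simp [hx])
  have e4 : ∫ x, ‖u x‖ ^ (p + 1) = 0 :=
    integral_eq_zero_of_ae (hu.mono fun x hx => by simp [hx, Real.zero_rpow hp'])
  have e5 : mass u = 0 := integral_eq_zero_of_ae (hu.mono fun x hx => by simp [hx])
  rw [action, energy, quadForm, rotTerm, e1, e2, e3, e4, e5]
  simp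

namespace Admissible

variable {V : Pt d → ℝ} {p β Ω θ C : ℝ} {u v : Pt d → ℂ}

theorem integrable_norm_add_rpow (H : Admissible V p β Ω θ C) (hu : MemX V u) (hv : MemX V v) :
    Integrable (fun x => (‖u x‖ + ‖v x‖) ^ (p + 1)) volume := by
  refine (((H.integrable_rpow hu).add (H.integrable_rpow hv)).const_mul (2 ^ (p + 1))).mono'
    ((hu.memLp.aestronglyMeasurable.norm.add
      hv.memLp.aestronglyMeasurable.norm).aemeasurable.pow_const _).aestronglyMeasurable
    (ae_of_all _ fun x => ?_)
  rw [Real.norm_of_nonneg (by positivity)]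
  exact rpow_add_le_two_rpow H.one_lt (norm_nonneg _) (norm_nonneg _)

theorem integrable_nonlinearity (H : Admissible V p β Ω θ C) (hu : MemX V u) (hv : MemX V v) :
    Integrable (fun x => ((‖u x‖ ^ (p - 1) : ℝ) : ℂ) * u x * conj (v x)) volume := by
  have hm : AEStronglyMeasurable (fun x => ((‖u x‖ ^ (p - 1) : ℝ) : ℂ) * u x * conj (v x))
      volume :=
    ((Complex.measurable_ofReal.comp_aemeasurable
      (hu.memLp.aestronglyMeasurable.norm.aemeasurable.pow_const _)).aestronglyMeasurable.mul
        hu.memLp.aestronglyMeasurable).mul hv.memLp.star.aestronglyMeasurable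
  refine (H.integrable_norm_add_rpow hu hv).mono' hm (ae_of_all _ fun x => ?_)
  rw [norm_mul, norm_mul, RCLike.norm_conj, Complex.norm_real, Real.norm_of_nonneg (by positivity),
    mul_assoc]
  simpa using norm_nonlinearity_le H.one_lt (u x) (v x) (t := 0) (by simp)

/-- The first variation of `‖u‖_{p+1}^{p+1}` in the direction `v`. -/
theorem hasDerivAt_integral_rpow (H : Admissible V p β Ω θ C) (hu : MemX V u) (hv : MemX V v) :
    HasDerivAt (fun t : ℝ => ∫ x, ‖u x + t * v x‖ ^ (p + 1))
      ((p + 1) * (∫ x, ((‖u x‖ ^ (p - 1) : ℝ) : ℂ) * u x * conj (v x)).re) 0 := by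
  have hp := H.one_lt
  have hmem : ∀ t : ℝ, MemX V (u + (t : ℂ) • v) := fun t => H.add_smul hu hv _
  have hint : ∀ t : ℝ, Integrable (fun x => ‖u x + t * v x‖ ^ (p + 1)) volume := fun t =>
    H.integrable_rpow (hmem t)
  have hi0 := H.integrable_nonlinearity hu hv
  have e0 : ∀ x, (p + 1) * (‖u x + (0 : ℝ) * v x‖ ^ (p - 1)
      * ((u x + (0 : ℝ) * v x) * conj (v x)).re)
      = (p + 1) * ((((‖u x‖ ^ (p - 1) : ℝ) : ℂ) * u x * conj (v x))).re := fun x => by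
    rw [mul_assoc (_ : ℂ), Complex.re_ofReal_mul]
    simp
  have key := hasDerivAt_integral_of_dominated_loc_of_deriv_le (μ := volume)
    (F := fun (t : ℝ) x => ‖u x + t * v x‖ ^ (p + 1))
    (F' := fun (t : ℝ) x => (p + 1) * (‖u x + t * v x‖ ^ (p - 1)
      * ((u x + t * v x) * conj (v x)).re)) (x₀ := (0 : ℝ)) (s := Metric.ball 0 1)
    (bound := fun x => (p + 1) * (‖u x‖ + ‖v x‖) ^ (p + 1))
    (Metric.ball_mem_nhds _ one_pos) (Eventually.of_forall fun t => (hint t).aestronglyMeasurable)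
    (hint 0) ?_ ?_ ((H.integrable_norm_add_rpow hu hv).const_mul _)
    (ae_of_all _ fun x t _ => hasDerivAt_norm_rpow_line hp (u x) (v x) t)
  · refine key.2.congr_deriv ?_
    simp_rw [e0]
    rw [integral_const_mul]
    congr 1
    exact integral_re hi0
  · have : AEStronglyMeasurable
        (fun x => (p + 1) * ((((‖u x‖ ^ (p - 1) : ℝ) : ℂ) * u x * conj (v x))).re) volume :=
      (hi0.re.const_mul _).aestronglyMeasurable
    exact this.congr (ae_of_all _ fun x => (e0 x).symm)
  · refine ae_of_all _ fun x t ht => ?_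
    have ht' : |t| ≤ 1 := by simpa using (Metric.mem_ball.1 ht).le
    rw [norm_mul, Real.norm_of_nonneg (by linarith : (0:ℝ) ≤ p + 1), norm_mul,
      Real.norm_of_nonneg (by positivity)]
    have h1 : ‖((u x + t * v x) * conj (v x)).re‖ ≤ ‖u x + t * v x‖ * ‖v x‖ := by
      refine (Complex.abs_re_le_norm _).trans (le_of_eq ?_)
      rw [norm_mul, RCLike.norm_conj]
    have h2 := norm_nonlinearity_le hp (u x) (v x) ht'
    refine mul_le_mul_of_nonneg_left (le_trans ?_ h2) (by linarith)
    exact mul_le_mul_of_nonneg_left h1 (by positivity)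

/-- The first variation of the action is `2 Re` of the weak form of the stationary equation. -/
theorem hasDerivAt_action (H : Admissible V p β Ω θ C) (ω : ℝ) (hu : MemX V u) (hv : MemX V v) :
    HasDerivAt (fun t : ℝ => action V p β Ω ω (u + (t : ℂ) • v))
      (2 * (weakForm V p β Ω ω u v).re) 0 := by
  have hp := H.one_lt
  have h1 := (H.hasDerivAt_integral_rpow hu hv).const_mul (2 * β / (p + 1))
  have h2 : HasDerivAt (fun t : ℝ => (quadForm V Ω u + ω * mass u)
      + 2 * t * (sesqForm V Ω ω u v).re + t ^ 2 * (quadForm V Ω v + ω * mass v))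
      (2 * (sesqForm V Ω ω u v).re) 0 := by
    have a := (((hasDerivAt_id (0:ℝ)).const_mul 2).mul_const (sesqForm V Ω ω u v).re).const_add
      (quadForm V Ω u + ω * mass u)
    have b := ((hasDerivAt_pow 2 (0:ℝ)).mul_const (quadForm V Ω v + ω * mass v))
    refine (a.add b).congr_deriv ?_
    simp
  have e : (fun t : ℝ => action V p β Ω ω (u + (t : ℂ) • v))
      = fun t : ℝ => ((quadForm V Ω u + ω * mass u) + 2 * t * (sesqForm V Ω ω u v).re
        + t ^ 2 * (quadForm V Ω v + ω * mass v))
        + 2 * β / (p + 1) * ∫ x, ‖u x + t * v x‖ ^ (p + 1) := by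
    funext t
    rw [← H.subordinate.quadForm_add_smul H.aemeasurable H.nonneg hu hv, action, energy]
    simp only [Pi.add_apply, Pi.smul_apply, smul_eq_mul]
    ring
  rw [e]
  refine (h2.add h1).congr_deriv ?_
  rw [weakForm, Complex.add_re, Complex.re_ofReal_mul]
  have : p + 1 ≠ 0 := by linarith
  field_simp

/-- Minimizers of the action satisfy the Euler-Lagrange equation. -/
theorem weakForm_eq_zero (H : Admissible V p β Ω θ C) {ω : ℝ} (hu : MemX V u)
    (hmin : action V p β Ω ω u = groundAction V p β Ω ω) (hv : MemX V v) :
    weakForm V p β Ω ω u v = 0 := by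
  have hre : ∀ {v}, MemX V v → (weakForm V p β Ω ω u v).re = 0 := by
    intro v hv
    have h1 : IsLocalMin (fun t : ℝ => action V p β Ω ω (u + (t : ℂ) • v)) 0 := by
      refine Eventually.of_forall fun t => ?_
      have e : u + ((0 : ℝ) : ℂ) • v = u := by simp
      simp only [e, hmin]
      exact H.groundAction_le ω (H.add_smul hu hv _)
    have := h1.hasDerivAt_eq_zero (H.hasDerivAt_action ω hu hv)
    linarith
  refine Complex.ext (hre hv) ?_
  -- testing with `i v` gives the imaginary part
  have h2 := hre (hv.smul Complex.I)
  rw [weakForm_smul_right ω hv] at h2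
  simpa using h2

end Admissible

/-! ### Existence of minimizers and ground states -/

theorem memX_zero (V : Pt d → ℝ) : MemX V 0 :=
  MemX.of_isWeakPartial (v := fun _ => 0) MemLp.zero
    (fun _ => ⟨locallyIntegrable_zero, locallyIntegrable_zero, fun η _ _ => by simp⟩)
    (fun _ => MemLp.zero) (by simp)

theorem mass_nonneg (u : Pt d → ℂ) : 0 ≤ mass u := integral_nonneg fun x => by positivity

theorem MemX.mass_pos {V : Pt d → ℝ} {u : Pt d → ℂ} (hu : MemX V u)
    (h0 : ¬ u =ᵐ[volume] 0) : 0 < mass u := by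
  refine (mass_nonneg u).lt_of_ne fun h => h0 ?_
  have h1 := (integral_eq_zero_iff_of_nonneg (fun x => by positivity) hu.integrable_sq).1 h.symm
  exact h1.mono fun x hx => by simpa using hx

theorem mass_smul (t : ℝ) (u : Pt d → ℂ) : mass ((t : ℂ) • u) = t ^ 2 * mass u := by
  rw [mass, mass, ← integral_const_mul]
  refine integral_congr_ae (ae_of_all _ fun x => ?_)
  simp [mul_pow]

theorem MemX.quadForm_smul {V : Pt d → ℝ} {u : Pt d → ℂ} (hu : MemX V u) (Ω t : ℝ) :
    quadForm V Ω ((t : ℂ) • u) = t ^ 2 * quadForm V Ω u := by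
  have hw : ∀ᵐ x, ∀ i, weakPartial i ((t : ℂ) • u) x = t * weakPartial i u x :=
    ae_all_iff.2 fun i => hu.weakPartial_smul (t : ℂ) i
  have e1 : ∫ x, ∑ i, ‖weakPartial i ((t : ℂ) • u) x‖ ^ 2
      = t ^ 2 * ∫ x, ∑ i, ‖weakPartial i u x‖ ^ 2 := by
    rw [← integral_const_mul]
    refine integral_congr_ae (hw.mono fun x hx => ?_)
    simp only [hx, norm_mul, Complex.norm_real, mul_pow, Real.norm_eq_abs, sq_abs, Finset.mul_sum]
  have e2 : ∫ x, V x * ‖((t : ℂ) • u) x‖ ^ 2 = t ^ 2 * ∫ x, V x * ‖u x‖ ^ 2 := by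
    rw [← integral_const_mul]
    refine integral_congr_ae (ae_of_all _ fun x => ?_)
    simp only [Pi.smul_apply, norm_smul, Complex.norm_real, mul_pow, Real.norm_eq_abs, sq_abs]
    ring
  have e3 : ∫ x, conj (((t : ℂ) • u) x) * Lz ((t : ℂ) • u) x
      = ((t ^ 2 : ℝ) : ℂ) * ∫ x, conj (u x) * Lz u x := by
    rw [← integral_const_mul]
    refine integral_congr_ae (hw.mono fun x hx => ?_)
    unfold Lz
    split_ifs with h
    · simp only [hx, Pi.smul_apply, smul_eq_mul, map_mul, Complex.conj_ofReal]
      push_cast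
      ring
    · simp
  rw [quadForm, rotTerm, e1, e2, e3, Complex.re_ofReal_mul, quadForm, rotTerm]
  ring

theorem integral_rpow_smul {t : ℝ} (ht : 0 ≤ t) (q : ℝ) (u : Pt d → ℂ) :
    ∫ x, ‖((t : ℂ) • u) x‖ ^ q = t ^ q * ∫ x, ‖u x‖ ^ q := by
  rw [← integral_const_mul]
  refine integral_congr_ae (ae_of_all _ fun x => ?_)
  simp only [Pi.smul_apply, norm_smul, Complex.norm_real, Real.norm_of_nonneg ht]
  exact Real.mul_rpow ht (norm_nonneg _)

theorem action_eq_add (V : Pt d → ℝ) (p β Ω ω ω' : ℝ) (u : Pt d → ℂ) :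
    action V p β Ω ω' u = action V p β Ω ω u + (ω' - ω) * mass u := by
  unfold action
  ring

theorem convex_freqs (V : Pt d → ℝ) (Ω : ℝ) : Convex ℝ (freqs V Ω) := by
  refine OrdConnected.convex ⟨fun a _ b hb x hx => ?_⟩
  exact lt_of_le_of_lt (EReal.coe_le_coe_iff.2 hx.2) hb

/-- `u` minimizes the action over `X`. -/
structure IsMinimizer (V : Pt d → ℝ) (p β Ω ω : ℝ) (u : Pt d → ℂ) : Prop where
  memX : MemX V u
  action_eq : action V p β Ω ω u = groundAction V p β Ω ω

namespace Admissible

variable {V : Pt d → ℝ} {p β Ω θ C ω ω' : ℝ} {u v : Pt d → ℂ}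

/-- Below `-λ₀` the infimum of the action is negative: along `t u` with `u` a suitable trial
function the quadratic part is negative and dominates the nonlinearity as `t → 0`. -/
theorem groundAction_neg (H : Admissible V p β Ω θ C) (hω : ω ∈ freqs V Ω) :
    groundAction V p β Ω ω < 0 := by
  have hp := H.one_lt
  have h1 : lambda0 V Ω < ((-ω : ℝ) : EReal) := by
    have : (ω : EReal) < - lambda0 V Ω := hω
    rw [EReal.lt_neg_comm] at this
    simpa using this
  obtain ⟨u, h2⟩ := iInf_lt_iff.1 h1
  obtain ⟨⟨hu, hu0⟩, h3⟩ := iInf_lt_iff.1 h2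
  have hm := hu.mass_pos hu0
  rw [EReal.coe_lt_coe_iff, div_lt_iff₀ hm] at h3
  set a := quadForm V Ω u + ω * mass u with ha
  set b := 2 * β / (p + 1) * ∫ x, ‖u x‖ ^ (p + 1) with hb
  have ha0 : a < 0 := by rw [ha]; linarith
  have hc : Tendsto (fun t : ℝ => a + t ^ (p - 1) * b) (𝓝[>] 0) (𝓝 (a + 0 ^ (p - 1) * b)) :=
    ((((Real.continuousAt_rpow_const 0 (p - 1) (Or.inr (by linarith))).tendsto).mul_const
      b).const_add a).mono_left nhdsWithin_le_nhds
  rw [Real.zero_rpow (by linarith), zero_mul, add_zero] at hc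
  obtain ⟨t, ht, ht0⟩ := ((hc.eventually_lt_const ha0).and self_mem_nhdsWithin).exists
  refine (H.groundAction_le ω (hu.smul (t : ℂ))).trans_lt ?_
  have e : t ^ (p + 1) = t ^ 2 * t ^ (p - 1) := by
    rw [← Real.rpow_natCast t 2, ← Real.rpow_add ht0]
    congr 1
    push_cast
    ring
  have h4 : action V p β Ω ω ((t : ℂ) • u) = t ^ 2 * (a + t ^ (p - 1) * b) := by
    rw [action, energy, hu.quadForm_smul, mass_smul, integral_rpow_smul ht0.le, e, ha, hb]
    ring
  rw [h4]
  exact mul_neg_of_pos_of_neg (by positivity) ht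

theorem exists_isMinimizer (H : Admissible V p β Ω θ C) (ω : ℝ) :
    ∃ u, IsMinimizer V p β Ω ω u := by
  obtain ⟨a, -, ha, hmem⟩ := exists_seq_tendsto_sInf
    (S := action V p β Ω ω '' {u | MemX V u}) ⟨_, 0, memX_zero V, rfl⟩ (H.bddBelow ω)
  choose u hu hau using hmem
  obtain ⟨-, -, f, hf, hfe, -⟩ := H.exists_subseq_minimizer ω (u := u) hu
    (ha.congr fun n => (hau n).symm)
  exact ⟨f, hf, hfe⟩

theorem isLeast_groundAction (H : Admissible V p β Ω θ C) (ω : ℝ) :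
    IsLeast (action V p β Ω ω '' {u | MemX V u}) (groundAction V p β Ω ω) := by
  obtain ⟨u, hu⟩ := H.exists_isMinimizer ω
  refine ⟨⟨u, hu.memX, hu.action_eq⟩, ?_⟩
  rintro _ ⟨v, hv, rfl⟩
  exact H.groundAction_le ω hv

/-- Below `-λ₀` minimizers of the action are nontrivial solutions of the stationary equation. -/
theorem isSolution (H : Admissible V p β Ω θ C) (hω : ω ∈ freqs V Ω)
    (hu : IsMinimizer V p β Ω ω u) : IsSolution V p β Ω ω u where
  memX := hu.memX
  ne_zero h := by
    have h1 := H.groundAction_neg hω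
    rw [← hu.action_eq, action_eq_zero_of_ae_eq_zero H.one_lt ω h] at h1
    exact lt_irrefl _ h1
  weak_eq v hv := by
    rw [← H.weakForm_eq_zero hu.memX hu.action_eq hv, weakForm, sesqForm]
    ring

theorem mem_groundStates_iff (H : Admissible V p β Ω θ C) (hω : ω ∈ freqs V Ω) :
    u ∈ groundStates V p β Ω ω ↔ IsMinimizer V p β Ω ω u := by
  constructor
  · rintro ⟨hu, hmin⟩
    obtain ⟨v, hv⟩ := H.exists_isMinimizer ω
    exact ⟨hu.memX, le_antisymm ((hmin v (H.isSolution hω hv)).trans_eq hv.action_eq)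
      (H.groundAction_le ω hu.memX)⟩
  · intro hu
    exact ⟨H.isSolution hω hu, fun v hv => hu.action_eq.trans_le (H.groundAction_le ω hv.memX)⟩

/-! ### Dependence on the frequency -/

/-- The mass of a minimizer is a supergradient of the ground-state action. -/
theorem groundAction_le_add (H : Admissible V p β Ω θ C) (hu : IsMinimizer V p β Ω ω u) (ω' : ℝ) :
    groundAction V p β Ω ω' ≤ groundAction V p β Ω ω + (ω' - ω) * mass u := by
  rw [← hu.action_eq, ← action_eq_add]
  exact H.groundAction_le ω' hu.memX

theorem mass_anti (H : Admissible V p β Ω θ C) (hu : IsMinimizer V p β Ω ω u)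
    (hv : IsMinimizer V p β Ω ω' v) (h : ω < ω') : mass v ≤ mass u := by
  have h1 := H.groundAction_le_add hu ω'
  have h2 := H.groundAction_le_add hv ω
  have h3 : (ω' - ω) * mass v ≤ (ω' - ω) * mass u := by linarith
  exact le_of_mul_le_mul_left h3 (by linarith)

theorem concaveOn_groundAction (H : Admissible V p β Ω θ C) {s : Set ℝ} (hs : Convex ℝ s) :
    ConcaveOn ℝ s (groundAction V p β Ω) := by
  refine ⟨hs, fun x _ y _ a b ha hb hab => ?_⟩
  obtain ⟨u, hu⟩ := H.exists_isMinimizer (a • x + b • y)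
  have h1 := mul_le_mul_of_nonneg_left (H.groundAction_le_add hu x) ha
  have h2 := mul_le_mul_of_nonneg_left (H.groundAction_le_add hu y) hb
  simp only [smul_eq_mul] at h1 h2 ⊢
  obtain rfl : b = 1 - a := by linarith
  nlinarith

/-- Minimizers at convergent frequencies: along a subsequence the masses converge to the mass of a
minimizer at the limit frequency. -/
theorem exists_subseq_mass (H : Admissible V p β Ω θ C) {w : ℕ → ℝ} {u : ℕ → Pt d → ℂ}
    (hu : ∀ n, IsMinimizer V p β Ω (w n) (u n)) (hw : Tendsto w atTop (𝓝 ω)) :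
    ∃ φ : ℕ → ℕ, StrictMono φ ∧ ∃ f, IsMinimizer V p β Ω ω f ∧
      Tendsto (fun n => mass (u (φ n))) atTop (𝓝 (mass f)) := by
  obtain ⟨a, ha⟩ := hw.bddBelow_range
  -- masses decrease with the frequency, so a minimizer at a lower frequency bounds them all
  obtain ⟨g, hg⟩ := H.exists_isMinimizer (a - 1)
  obtain ⟨k, hk⟩ := H.exists_isMinimizer ω
  have hM : ∀ n, mass (u n) ≤ mass g := fun n =>
    H.mass_anti hg (hu n) (by linarith [ha ⟨n, rfl⟩])
  have hlim : Tendsto (fun n => action V p β Ω ω (u n)) atTop (𝓝 (groundAction V p β Ω ω)) := by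
    have hd : Tendsto (fun n => groundAction V p β Ω ω + |w n - ω| * (mass k + mass g)) atTop
        (𝓝 (groundAction V p β Ω ω)) := by
      have := ((hw.sub_const ω).abs.mul_const (mass k + mass g)).const_add (groundAction V p β Ω ω)
      simpa using this
    refine tendsto_of_tendsto_of_tendsto_of_le_of_le tendsto_const_nhds hd
      (fun n => H.groundAction_le ω (hu n).memX) fun n => ?_
    have h1 := H.groundAction_le_add hk (w n)
    have h2 := action_eq_add V p β Ω (w n) ω (u n)
    have h3 : (w n - ω) * mass k ≤ |w n - ω| * mass k :=
      mul_le_mul_of_nonneg_right (le_abs_self _) (mass_nonneg _)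
    have h4 : (ω - w n) * mass (u n) ≤ |w n - ω| * mass g := by
      refine mul_le_mul ?_ (hM n) (mass_nonneg _) (abs_nonneg _)
      rw [abs_sub_comm]
      exact le_abs_self _
    simp only
    rw [h2, (hu n).action_eq]
    linarith
  obtain ⟨φ, hφ, f, hf, hfe, hm⟩ := H.exists_subseq_minimizer ω (fun n => (hu n).memX) hlim
  exact ⟨φ, hφ, f, ⟨hf, hfe⟩, hm⟩

/-- If the masses of chosen minimizers lie in a closed set `K` as the frequency tends to `ω`, and
`m` is the only mass in `K` of a minimizer at `ω`, then the masses tend to `m`. -/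
theorem tendsto_mass (H : Admissible V p β Ω θ C) {U : ℝ → Pt d → ℂ}
    (hU : ∀ ω, IsMinimizer V p β Ω ω (U ω)) {l : Filter ℝ} [l.IsCountablyGenerated]
    (hl : l ≤ 𝓝 ω) {K : Set ℝ} (hK : IsClosed K) (hUK : ∀ᶠ ω' in l, mass (U ω') ∈ K) {m : ℝ}
    (hm : ∀ f, IsMinimizer V p β Ω ω f → mass f ∈ K → mass f = m) :
    Tendsto (fun ω' => mass (U ω')) l (𝓝 m) := by
  refine tendsto_of_seq_tendsto fun w hw => tendsto_of_subseq_tendsto fun ns hns => ?_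
  have hwn := hw.comp hns
  obtain ⟨φ, hφ, f, hf, hlim⟩ := H.exists_subseq_mass (fun n => hU (w (ns n))) (hwn.mono_right hl)
  refine ⟨φ, ?_⟩
  have hfK : mass f ∈ K :=
    hK.mem_of_tendsto hlim ((hwn.comp hφ.tendsto_atTop).eventually hUK)
  rw [← hm f hf hfK]
  exact hlim

theorem isCompact_mass (H : Admissible V p β Ω θ C) (ω : ℝ) :
    IsCompact (mass '' {u | IsMinimizer V p β Ω ω u}) := by
  refine IsSeqCompact.isCompact fun m hm => ?_
  choose u hu hmu using hm
  obtain ⟨φ, hφ, f, hf, hlim⟩ := H.exists_subseq_mass hu (tendsto_const_nhds (x := ω))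
  refine ⟨mass f, ⟨f, hf, rfl⟩, φ, hφ, hlim.congr fun n => hmu _⟩

/-- To the left of `ω` the difference quotient lies between the largest mass at `ω` and the mass of
a minimizer at `ω'`, which tends to it as `ω' ↑ ω`. -/
theorem hasDerivWithinAt_Iio (H : Admissible V p β Ω θ C) {m : ℝ}
    (hm : IsGreatest (mass '' {u | IsMinimizer V p β Ω ω u}) m) :
    HasDerivWithinAt (groundAction V p β Ω) m (Iio ω) ω := by
  choose U hU using H.exists_isMinimizer
  obtain ⟨⟨g, hg, rfl⟩, hmax⟩ := hm
  rw [hasDerivWithinAt_iff_tendsto_slope' (by simp)]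
  have hge : ∀ ω' < ω, mass g ≤ mass (U ω') := fun ω' h => H.mass_anti (hU ω') hg h
  have hlim : Tendsto (fun ω' => mass (U ω')) (𝓝[<] ω) (𝓝 (mass g)) :=
    H.tendsto_mass hU (l := 𝓝[<] ω) nhdsWithin_le_nhds isClosed_Ici (K := Ici (mass g))
      (eventually_mem_nhdsWithin.mono hge)
      fun f hf hfK => le_antisymm (hmax ⟨f, hf, rfl⟩) hfK
  refine tendsto_of_tendsto_of_tendsto_of_le_of_le' tendsto_const_nhds hlim ?_ ?_ <;>
    refine eventually_mem_nhdsWithin.mono fun ω' hω' => ?_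
  · rw [slope_comm, slope_def_field, le_div_iff₀ (sub_pos.2 hω')]
    linarith [H.groundAction_le_add hg ω']
  · rw [slope_comm, slope_def_field, div_le_iff₀ (sub_pos.2 hω')]
    linarith [H.groundAction_le_add (hU ω') ω]

/-- To the right of `ω` the difference quotient lies between the mass of a minimizer at `ω'` and the
smallest mass at `ω`, to which the former tends as `ω' ↓ ω`. -/
theorem hasDerivWithinAt_Ioi (H : Admissible V p β Ω θ C) {m : ℝ}
    (hm : IsLeast (mass '' {u | IsMinimizer V p β Ω ω u}) m) :
    HasDerivWithinAt (groundAction V p β Ω) m (Ioi ω) ω := by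
  choose U hU using H.exists_isMinimizer
  obtain ⟨⟨g, hg, rfl⟩, hmin⟩ := hm
  rw [hasDerivWithinAt_iff_tendsto_slope' (by simp)]
  have hle : ∀ ω' > ω, mass (U ω') ≤ mass g := fun ω' h => H.mass_anti hg (hU ω') h
  have hlim : Tendsto (fun ω' => mass (U ω')) (𝓝[>] ω) (𝓝 (mass g)) :=
    H.tendsto_mass hU (l := 𝓝[>] ω) nhdsWithin_le_nhds isClosed_Iic (K := Iic (mass g))
      (eventually_mem_nhdsWithin.mono hle)
      fun f hf hfK => le_antisymm hfK (hmin ⟨f, hf, rfl⟩)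
  refine tendsto_of_tendsto_of_tendsto_of_le_of_le' hlim tendsto_const_nhds ?_ ?_ <;>
    refine eventually_mem_nhdsWithin.mono fun ω' hω' => ?_
  · rw [slope_def_field, le_div_iff₀ (sub_pos.2 hω')]
    linarith [H.groundAction_le_add (hU ω') ω]
  · rw [slope_def_field, div_le_iff₀ (sub_pos.2 hω')]
    linarith [H.groundAction_le_add hg ω']

end Admissible

end RNLS

theorem proposition4p3 (d : ℕ) (hd : 1 ≤ d) (p : ℝ) (hp : 1 < p)
    (hp' : 3 ≤ d → p < ((d : ℝ) + 2) / ((d : ℝ) - 2))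
    (β : ℝ) (hβ : 0 < β)
    (V : RNLS.Pt d → ℝ) (hVm : AEMeasurable V volume) (hV0 : ∀ x, 0 ≤ V x)
    (hV : Tendsto V (cocompact (RNLS.Pt d)) atTop)
    (Ω : ℝ) (hΩ : Ω = 0 ∨ (0 < |Ω| ∧ ((|Ω| : ℝ) : EReal) < RNLS.rotMax V)) :
    -- the infimum over `X` is attained, exactly at the action ground states
    (∀ ω ∈ RNLS.freqs V Ω,
      IsLeast (RNLS.action V p β Ω ω '' {u | RNLS.MemX V u}) (RNLS.groundAction V p β Ω ω) ∧
      ∀ u, u ∈ RNLS.groundStates V p β Ω ω ↔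
        RNLS.MemX V u ∧ RNLS.action V p β Ω ω u = RNLS.groundAction V p β Ω ω) ∧
    ConcaveOn ℝ (RNLS.freqs V Ω) (RNLS.groundAction V p β Ω) ∧
    ∀ ω ∈ RNLS.freqs V Ω,
      IsGreatest (RNLS.groundMasses V p β Ω ω) (RNLS.mSup V p β Ω ω) ∧
      IsLeast (RNLS.groundMasses V p β Ω ω) (RNLS.mInf V p β Ω ω) ∧
      HasDerivWithinAt (RNLS.groundAction V p β Ω) (RNLS.mSup V p β Ω ω) (Iio ω) ω ∧
      HasDerivWithinAt (RNLS.groundAction V p β Ω) (RNLS.mInf V p β Ω ω) (Ioi ω) ω := by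
  obtain ⟨θ, C, hsub⟩ := RNLS.exists_subordinate hV0 hΩ
  have H : RNLS.Admissible V p β Ω θ C := ⟨hd, hp, hp', hβ, hVm, hV0, hV, hsub⟩
  refine ⟨fun ω hω => ⟨H.isLeast_groundAction ω, fun u => ?_⟩,
    H.concaveOn_groundAction (RNLS.convex_freqs V Ω), fun ω hω => ?_⟩
  · rw [H.mem_groundStates_iff hω]
    exact ⟨fun h => ⟨h.memX, h.action_eq⟩, fun h => ⟨h.1, h.2⟩⟩
  · have hN : RNLS.groundMasses V p β Ω ω = RNLS.mass '' {u | RNLS.IsMinimizer V p β Ω ω u} := by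
      rw [RNLS.groundMasses]
      congr 1
      ext u
      exact H.mem_groundStates_iff hω
    have hc := H.isCompact_mass ω
    obtain ⟨u, hu⟩ := H.exists_isMinimizer ω
    have hne : (RNLS.mass '' {u | RNLS.IsMinimizer V p β Ω ω u}).Nonempty := ⟨_, u, hu, rfl⟩
    have hg := hc.isGreatest_sSup hne
    have hl := hc.isLeast_sInf hne
    rw [RNLS.mSup, RNLS.mInf, hN]
    exact ⟨hg, hl, H.hasDerivWithinAt_Iio hg, H.hasDerivWithinAt_Ioi hl⟩
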